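/- Let $\mathbb N=\{1,2,3,\dots\}$, and for $n\in\mathbb N$ let $X_n=\{1,\dots,n\}\times\mathbb N$; the set $\{i\}\times\mathbb N$ is the $i$-th ray. Permutations act on the right. The Houghton group $H_n\le \mathrm{Sym}(X_n)$ consists of all $g\in\mathrm{Sym}(X_n)$ for which there are $z_1,\dots,z_n\in\mathbb N$ and $t_1,\dots,t_n\in\mathbb Z$ with $(i,m)g=(i,m+t_i)$ for all $i$ and all $m\ge z_i$. The symmetric group $S_n$ acts on $X_n$ by $(i,m)\sigma=(i\sigma,m)$, and $H_n\rtimes S_n\le\mathrm{Sym}(X_n)$ is the subgroup generated by $H_n$ and these permutations. For $2\le i\le n$ let $g_i\in H_n$ be given by $(1,m)g_i=(1,m+1)$, $(i,1)g_i=(1,1)$, $(i,m)g_i=(i,m-1)$ for $m>1$, and $(j,m)g_i=(j,m)$ for $j\ne 1,i$. For $n\ge2$, elements of $H_n\rtimes S_n$ are given as words in the following generators and their inverses: $g_2$, the element of $S_n$ exchanging rays $1$ and $2$, and, if $n\ge 3$, the element $(1\,2\,\cdots\,n)$ of $S_n$, or, if $n=2$, the transposition of the points $(1,1)$ and $(2,1)$.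 For $n\ge 2$ and $p\in\mathbb N$ let $U_p=\langle \mathrm{FAlt}(X_n),\,g_2^p,\dots,g_n^p\rangle\le H_n$, where $\mathrm{FAlt}(X_n)$ is the group of even permutations of $X_n$ with finite support. Let $\phi:X_n\to X_{np}$ be the bijection $(i,(q-1)p+d)\mapsto((i-1)p+d,\,q)$, for $1\le i\le n$, $1\le d\le p$, $q\in\mathbb N$, and let $(U_p)\hat\phi=\{\phi^{-1}u\phi\mid u\in U_p\}\le H_{np}$. Then there is an algorithm which, given $n\ge2$, $p\in\mathbb N$, words representing elements $a,b\in H_{np}\rtimes S_{np}$, and a word representing an element $x\in H_{np}$ with $x^{-1}ax=b$, decides whether $a$ and $b$ are conjugate in $(U_p)\hat\phi$, that is, whether there exists $y\in(U_p)\hat\phi$ with $y^{-1}ay=b$. -/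

import Mathlib

open Equiv

/-- The point set `X_n`, a disjoint union of `n` rays. Rays and positions on a ray are counted
from `0`, so `(i, m)` here is the point `(i+1, m+1)` in the numbering that starts from `1`. -/
abbrev RaySpace (n : ℕ) : Type := Fin n × ℕ

/-- `g` translates the far part of every ray: there are `z_i` and `t_i` with
`(i, m) g = (i, m + t_i)` for all `m ≥ z_i`. -/
def EventuallyTranslates {n : ℕ} (g : Perm (RaySpace n)) : Prop :=
  ∃ (z : Fin n → ℕ) (t : Fin n → ℤ), ∀ (i : Fin n) (m : ℕ), z i ≤ m →
    (g (i, m)).1 = i ∧ ((g (i, m)).2 : ℤ) = (m : ℤ) + t i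

/-- The Houghton group `H_n`. -/
def houghton (n : ℕ) : Subgroup (Perm (RaySpace n)) where
  carrier := {g | EventuallyTranslates g}
  one_mem' := ⟨fun _ => 0, fun _ => 0, fun i m _ => by simp⟩
  mul_mem' := by
    rintro g h ⟨z, t, hg⟩ ⟨z', t', hh⟩
    refine ⟨fun i => z' i + z i + (t' i).natAbs, fun i => t' i + t i, fun i m hm => ?_⟩
    dsimp only at hm
    obtain ⟨h1, h2⟩ := hh i m (by omega)
    have e : h (i, m) = (i, (h (i, m)).2) := Prod.ext h1 rfl
    obtain ⟨g1, g2⟩ := hg i (h (i, m)).2 (by omega)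
    rw [Perm.mul_apply, e]
    exact ⟨g1, by rw [g2, h2]; ring⟩
  inv_mem' := by
    rintro g ⟨z, t, hg⟩
    refine ⟨fun i => z i + (t i).natAbs, fun i => -t i, fun i m hm => ?_⟩
    dsimp only at hm
    obtain ⟨k, hk⟩ : ∃ k : ℕ, (k : ℤ) = (m : ℤ) - t i :=
      ⟨((m : ℤ) - t i).toNat, by omega⟩
    obtain ⟨g1, g2⟩ := hg i k (by omega)
    have e : g (i, k) = (i, m) := Prod.ext g1 (by dsimp only; omega)
    have e' : g⁻¹ (i, m) = (i, k) := by rw [← e]; simp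
    rw [e']
    exact ⟨rfl, by dsimp only; omega⟩

/-- The permutation that translates ray `i` by `1` outwards and ray `j` by `1` inwards, the
initial point of ray `j` being sent to the initial point of ray `i`; other rays are fixed. -/
def rayShift {n : ℕ} (i j : Fin n) (hij : i ≠ j) : Perm (RaySpace n) where
  toFun x :=
    if x.1 = i then (i, x.2 + 1)
    else if x.1 = j then (if x.2 = 0 then (i, 0) else (j, x.2 - 1))
    else x
  invFun x :=
    if x.1 = i then (if x.2 = 0 then (j, 0) else (i, x.2 - 1))
    else if x.1 = j then (j, x.2 + 1)
    else x
  left_inv := by rintro ⟨k, m⟩; grind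
  right_inv := by rintro ⟨k, m⟩; grind

/-- The isometric permutation of the rays induced by `σ`: `(i, m) ↦ (i σ, m)`. -/
def rayPerm {n : ℕ} (σ : Perm (Fin n)) : Perm (RaySpace n) :=
  σ.prodCongr (Equiv.refl ℕ)

/-- The first and the second ray. -/
def ray₁ {n : ℕ} (hn : 2 ≤ n) : Fin n := ⟨0, by omega⟩
def ray₂ {n : ℕ} (hn : 2 ≤ n) : Fin n := ⟨1, by omega⟩

theorem ray₁_ne_ray₂ {n : ℕ} (hn : 2 ≤ n) : ray₁ hn ≠ ray₂ hn := by
  simp [ray₁, ray₂]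

/-- The three generators of `H_n ⋊ S_n`, which is the group of all permutations of `X_n` that
agree, far out on each ray, with a translation followed by an isometric permutation of the rays.
They are `g_2`, the isometric exchange of the first two rays, and, if `n ≥ 3`, the isometric
rotation of the rays; if `n = 2` (where the rotation is the exchange), the third generator is the
transposition of the initial points of the two rays. -/
def generator {n : ℕ} (hn : 2 ≤ n) : Fin 3 → Perm (RaySpace n)
  | 0 => rayShift (ray₁ hn) (ray₂ hn) (ray₁_ne_ray₂ hn)
  | 1 => rayPerm (Equiv.swap (ray₁ hn) (ray₂ hn))
  | 2 => if n = 2 then Equiv.swap (ray₁ hn, 0) (ray₂ hn, 0) else rayPerm (finRotate n)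

/-- Words in three letters and their inverses; `(s, false)` is the inverse of `(s, true)`. -/
abbrev GenWord : Type := List (Fin 3 × Bool)

/-- The element of `H_n ⋊ S_n` represented by a word. Permutations act on the right: the first
letter of the word is applied first. -/
def GenWord.toPerm {n : ℕ} (hn : 2 ≤ n) : GenWord → Perm (RaySpace n)
  | [] => Equiv.refl _
  | (s, true) :: w => (generator hn s).trans (GenWord.toPerm hn w)
  | (s, false) :: w => (generator hn s).symm.trans (GenWord.toPerm hn w)

/-- `x` conjugates `a` to `b`: `x⁻¹ a x = b`, where permutations act on the right. -/
def ConjugatesTo {α : Type*} (x a b : Perm α) : Prop :=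
  (x.symm.trans a).trans x = b

/-- `FAlt(α)`: the even permutations with finite support. -/
def finitaryAlternating (α : Type*) [DecidableEq α] : Set (Perm α) :=
  {g | ∃ (s : Finset α) (σ : Perm s), Perm.sign σ = 1 ∧ g = Perm.ofSubtype σ}

/-- `U_p = ⟨FAlt(X_n), g_i ^ p (i = 2, …, n)⟩ ≤ H_n`. -/
def subgroupU {n : ℕ} (hn : 2 ≤ n) (p : ℕ) : Subgroup (Perm (RaySpace n)) :=
  Subgroup.closure (finitaryAlternating (RaySpace n) ∪
    {g | ∃ (i : Fin n) (hi : ray₁ hn ≠ i), g = rayShift (ray₁ hn) i hi ^ p})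

/-- The bijection `X_n → X_{np}` that sends, in order, the points of ray `i` whose position is
congruent to `d` modulo `p` (`0 ≤ d < p`) to the points of ray `i p + d`. -/
def raySplit (n p : ℕ) (hp : 1 ≤ p) : RaySpace n ≃ RaySpace (n * p) where
  toFun x := (finProdFinEquiv (x.1, ⟨x.2 % p, Nat.mod_lt _ hp⟩), x.2 / p)
  invFun y := ((finProdFinEquiv.symm y.1).1, (finProdFinEquiv.symm y.1).2 + p * y.2)
  left_inv := by
    rintro ⟨i, m⟩
    simp [Nat.mod_add_div]
  right_inv := by
    rintro ⟨k, m⟩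
    obtain ⟨⟨i, d⟩, rfl⟩ := finProdFinEquiv.surjective k
    have hd := d.2
    simp [Nat.add_mul_mod_self_left, Nat.mod_eq_of_lt hd, Nat.add_mul_div_left _ _ hp,
      Nat.div_eq_of_lt hd]

/-- The image of `U_p` in `Sym(X_{np})` under the isomorphism `Sym(X_n) ≅ Sym(X_{np})` induced
by the bijection `raySplit`. -/
def imageU {n p : ℕ} (hn : 2 ≤ n) (hp : 1 ≤ p) : Subgroup (Perm (RaySpace (n * p))) :=
  (subgroupU hn p).map (raySplit n p hp).permCongrHom.toMonoidHom

theorem two_le_mul_of {n p : ℕ} (hn : 2 ≤ n) (hp : 1 ≤ p) : 2 ≤ n * p :=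
  le_trans hn (Nat.le_mul_of_pos_right n hp)

/-! Write `N = np`. Since `x` lies in `H_N`, the conjugators from `a` to `b` in `H_N` are the
products `x * c` with `c` in `H_N` commuting with `a`. Membership in the image of `U_p` means that
the translation vector is constant on each block of `p` rays and that, unless `n ≥ 3` and `p` is
odd, a parity vanishes. In that exceptional case the commutator of `p`-th powers of two ray shifts
is odd and finitary, so parity is no obstruction. Otherwise the generators commute modulo even
permutations and have independent translation vectors, so the number of transpositions modulo 2 is
well defined (`mem_imageU_iff`, `notMem_imageU_of_parity_one`).

Let `T` be the group of translation vectors of elements of `H_N` that commute with `a`. It is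
described by three conditions whose failure can be found by search
(`mem_commutingTranslations_iff`), because a compatible far translation extends equivariantly along
the orbits of `a`. Every class of `T / 2T` has a representative `ρ` of explicitly bounded size
(`exists_bounded_add_two_smul`), so only finitely many classes matter. Fix one, and let `tx` be the
translation vector of `x`.

If no vector of `tx + ρ + 2T` is block-constant, a linear form modulo some `d` vanishes on `2T` and
on the block-constant vectors but not at `tx + ρ` (`exists_dual_certificate`). Otherwise some
conjugator `y` has such a vector. If `y` is odd and an odd finitary permutation commutes with `a`,
multiplying by it repairs the parity. If there is no such permutation, all block-translating
conjugators of the class have the same parity: two of them differ by some `h` commuting with `a`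
whose vector is `2v` with `v` in `T`; an element `g` realizing `v` is again block-translating, so `g
^ 2` is even, and `h` differs from `g ^ 2` by an even finitary permutation. One odd conjugator
therefore excludes the whole class. The absence of odd finitary permutations in the centralizer is a
condition on orbits (`HasRigidOrbits`). Together this is `forall_certificate_iff`.

So both existence and nonexistence of a conjugator have finite certificates, and a parallel search
decides. Certificates can be checked because words act rigidly above an explicit height (`Tame`),
which reduces equality of permutations to finitely many points (`Tame.ext`), and because all
evaluations are primitive recursive. -/

/-- `g` translates every ray `i` by `t i` from height `M` on. -/
def TranslatesFrom {n : ℕ} (M : ℕ) (g : Perm (RaySpace n)) (t : Fin n → ℤ) : Prop :=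
  ∀ i m, M ≤ m → (g (i, m)).1 = i ∧ ((g (i, m)).2 : ℤ) = m + t i

/-- `g` translates the far part of every ray `i` by `t i`. -/
def TranslatesBy {n : ℕ} (g : Perm (RaySpace n)) (t : Fin n → ℤ) : Prop :=
  ∃ M, TranslatesFrom M g t

/-! ### Eventual translations and rigid behaviour above an explicit height -/

section Translations

variable {n : ℕ} {g h : Perm (RaySpace n)} {t t' : Fin n → ℤ} {M M' : ℕ}

theorem TranslatesFrom.apply (hg : TranslatesFrom M g t) {i : Fin n} {m k : ℕ} (hm : M ≤ m)
    (hk : (k : ℤ) = m + t i) : g (i, m) = (i, k) := by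
  obtain ⟨h1, h2⟩ := hg i m hm
  exact Prod.ext h1 (by dsimp only; omega)

theorem mem_houghton_iff : g ∈ houghton n ↔ ∃ t, TranslatesBy g t := by
  constructor
  · rintro ⟨z, t, hg⟩
    exact ⟨t, ∑ i, z i, fun i m hm => hg i m
      ((Finset.single_le_sum (f := z) (fun _ _ => Nat.zero_le _) (Finset.mem_univ i)).trans hm)⟩
  · rintro ⟨t, M, hg⟩
    exact ⟨fun _ => M, t, hg⟩

theorem TranslatesBy.one : TranslatesBy (1 : Perm (RaySpace n)) 0 :=
  ⟨0, fun i m _ => by simp⟩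

theorem TranslatesBy.mul (hg : TranslatesBy g t) (hh : TranslatesBy h t') :
    TranslatesBy (g * h) (t + t') := by
  obtain ⟨M, hg⟩ := hg
  obtain ⟨M', hh⟩ := hh
  -- The sum bounds every `|t' i|`, so the image under `h` is still above `M`.
  refine ⟨M + M' + ∑ i, (t' i).natAbs, fun i m hm => ?_⟩
  have := Finset.single_le_sum (f := fun i => (t' i).natAbs) (fun _ _ => Nat.zero_le _)
    (Finset.mem_univ i)
  obtain ⟨h1, h2⟩ := hh i m (by omega)
  have e : h (i, m) = (i, (h (i, m)).2) := Prod.ext h1 rfl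
  obtain ⟨g1, g2⟩ := hg i (h (i, m)).2 (by omega)
  rw [Perm.mul_apply, e]
  exact ⟨g1, by rw [g2, h2, Pi.add_apply]; ring⟩

theorem TranslatesBy.inv (hg : TranslatesBy g t) : TranslatesBy g⁻¹ (-t) := by
  obtain ⟨M, hg⟩ := hg
  refine ⟨M + ∑ i, (t i).natAbs, fun i m hm => ?_⟩
  have := Finset.single_le_sum (f := fun i => (t i).natAbs) (fun _ _ => Nat.zero_le _)
    (Finset.mem_univ i)
  obtain ⟨k, hk⟩ : ∃ k : ℕ, (k : ℤ) = (m : ℤ) - t i := ⟨((m : ℤ) - t i).toNat, by omega⟩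
  have e' : g⁻¹ (i, m) = (i, k) := by
    rw [Perm.inv_eq_iff_eq, hg.apply (k := m) (by omega) (by omega)]
  rw [e']
  exact ⟨rfl, by simp only [Pi.neg_apply]; omega⟩

theorem TranslatesBy.pow (hg : TranslatesBy g t) (k : ℕ) :
    TranslatesBy (g ^ k) (k • t) := by
  induction k with
  | zero => simpa using TranslatesBy.one
  | succ k ih => rw [pow_succ, succ_nsmul]; exact ih.mul hg

theorem TranslatesBy.zpow (hg : TranslatesBy g t) (k : ℤ) :
    TranslatesBy (g ^ k) (k • t) := by
  obtain ⟨k, rfl | rfl⟩ := k.eq_nat_or_neg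
  · simpa using hg.pow k
  · simpa using (hg.pow k).inv

theorem TranslatesBy.unique (hg : TranslatesBy g t) (hg' : TranslatesBy g t') : t = t' := by
  obtain ⟨M, hg⟩ := hg
  obtain ⟨M', hg'⟩ := hg'
  funext i
  have h1 := (hg i (M + M') (by omega)).2
  have h2 := (hg' i (M + M') (by omega)).2
  omega

/-- Iterates of a translation that stay above the threshold. -/
theorem TranslatesFrom.pow_apply (hg : TranslatesFrom M g t) {i : Fin n} (hi : 0 ≤ t i) (q : ℕ)
    {m k : ℕ} (hm : M ≤ m) (hk : (k : ℤ) = m + q * t i) : (g ^ q) (i, m) = (i, k) := by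
  induction q generalizing k with
  | zero => simp at hk; simp [hk]
  | succ q ih =>
    obtain ⟨j, hj⟩ : ∃ j : ℕ, (j : ℤ) = m + q * t i :=
      ⟨(m + q * t i).toNat, by have : 0 ≤ (q : ℤ) * t i := by positivity
                               omega⟩
    rw [pow_succ', Perm.mul_apply, ih hj]
    have : 0 ≤ (q : ℤ) * t i := by positivity
    exact hg.apply (by omega) (by rw [hk, hj]; push_cast; ring)

/-- For an inward drift the iterates are followed from the far point `k` down to `m`; started at `m`
they could drop below the threshold. -/
theorem TranslatesFrom.pow_apply_of_neg (hg : TranslatesFrom M g t) {i : Fin n} (hi : t i ≤ 0)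
    (q : ℕ) {m k : ℕ} (hm : M ≤ m) (hk : (k : ℤ) = m - q * t i) :
    (g ^ q) (i, k) = (i, m) := by
  induction q generalizing k with
  | zero => simp at hk; simp [hk]
  | succ q ih =>
    obtain ⟨j, hj⟩ : ∃ j : ℕ, (j : ℤ) = m - q * t i :=
      ⟨(m - q * t i).toNat, by have : 0 ≤ (q : ℤ) * (- t i) := by
                                 have : 0 ≤ - t i := by omega
                                 positivity
                               rw [mul_neg] at this
                               omega⟩
    have h0 : 0 ≤ (q : ℤ) * (- t i) := by
      have : 0 ≤ - t i := by omega
      positivity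
    rw [mul_neg] at h0
    push_cast at hk
    have e : g (i, k) = (i, j) := hg.apply (by
      have : (k : ℤ) = j - t i := by rw [hk, hj]; ring
      omega) (by rw [hk, hj]; ring)
    rw [pow_succ, Perm.mul_apply, e, ih hj]

/-- A finitary-support criterion: translating by `0` far out. -/
theorem TranslatesBy.exists_fixes (hg : TranslatesBy g 0) :
    ∃ M, ∀ i m, M ≤ m → g (i, m) = (i, m) := by
  obtain ⟨M, hg⟩ := hg
  exact ⟨M, fun i m hm => hg.apply hm (by simp)⟩

/-- From height `M` on, `g` carries each ray rigidly onto a part of some ray. -/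
def Tame {n : ℕ} (M : ℕ) (g : Perm (RaySpace n)) : Prop :=
  ∀ i k, g (i, M + k) = ((g (i, M)).1, (g (i, M)).2 + k)

theorem Tame.mono (hg : Tame M g) (h : M ≤ M') : Tame M' g := by
  obtain ⟨d, rfl⟩ := Nat.exists_eq_add_of_le h
  intro i k
  rw [hg i d, add_assoc, hg i (d + k)]
  simp [add_assoc]

theorem Tame.apply_add (hg : Tame M g) (i : Fin n) {m : ℕ} (hm : M ≤ m) (k : ℕ) :
    g (i, m + k) = ((g (i, m)).1, (g (i, m)).2 + k) := hg.mono hm i k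

theorem Tame.one : Tame 0 (1 : Perm (RaySpace n)) := fun i k => by simp

/-- Above `M'` the images under `h` climb one unit per unit, so `M` further units bring them above
`M`, however far inwards `h` translates. -/
theorem Tame.mul (hg : Tame M g) (hh : Tame M' h) : Tame (M + M') (g * h) := by
  intro i k
  rw [Perm.mul_apply, Perm.mul_apply, hh.apply_add i (by omega) k, add_comm M M', hh i M,
    ← hg.apply_add _ (by omega)]

theorem Tame.pow (hg : Tame M g) (k : ℕ) : Tame (k * M) (g ^ k) := by
  induction k with
  | zero => simpa using Tame.one
  | succ k ih => rw [pow_succ, Nat.succ_mul]; exact ih.mul hg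

/-- The value at height `M` determines the rest of the ray, so equality becomes a finite check. -/
theorem Tame.ext (hg : Tame M g) (hh : Tame M h)
    (H : ∀ i m, m ≤ M → g (i, m) = h (i, m)) : g = h := by
  ext1 ⟨i, m⟩
  by_cases hm : m ≤ M
  · exact H i m hm
  · obtain ⟨d, rfl⟩ := Nat.exists_eq_add_of_le (Nat.le_of_not_le hm)
    rw [hg i d, hh i d, H i M le_rfl]

theorem Tame.translatesFrom (hg : Tame M g) (h1 : ∀ i, (g (i, M)).1 = i) :
    TranslatesFrom M g (fun i => ((g (i, M)).2 : ℤ) - M) := by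
  intro i m hm
  obtain ⟨d, rfl⟩ := Nat.exists_eq_add_of_le hm
  rw [hg i d, h1 i]
  refine ⟨rfl, ?_⟩
  push_cast
  ring

/-- Rigidity lets the eventual translation be read off at the explicit height `M` instead of an
unknown one. -/
theorem Tame.translatesBy_apply (hg : Tame M g) (ht : TranslatesBy g t) (i : Fin n) {m : ℕ}
    (hm : M ≤ m) : (g (i, m)).1 = i ∧ ((g (i, m)).2 : ℤ) = m + t i := by
  obtain ⟨M', ht⟩ := ht
  have h1 := ht i (m + M') (by omega)
  rw [hg.apply_add i hm M'] at h1
  refine ⟨h1.1, ?_⟩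
  have := h1.2
  push_cast at this
  omega

/-- The map on rays induced by a tame permutation is injective. -/
theorem Tame.ray_injective (hg : Tame M g) : Function.Injective fun i => (g (i, M)).1 := by
  intro i j hij
  dsimp only at hij
  -- If two rays went to the same ray, climbing on each by the image height of the other would give
  -- a common image.
  have e : g (i, M + (g (j, M)).2) = g (j, M + (g (i, M)).2) := by
    rw [hg i, hg j, hij, add_comm]
  exact congrArg Prod.fst (g.injective e)

/-- The permutation of the rays induced by a tame permutation. -/
noncomputable def Tame.rayMap (hg : Tame M g) : Perm (Fin n) :=
  Equiv.ofBijective _ (Finite.injective_iff_bijective.1 hg.ray_injective)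

theorem Tame.rayMap_apply (hg : Tame M g) (i : Fin n) {m : ℕ} (hm : M ≤ m) :
    (g (i, m)).1 = hg.rayMap i := by
  obtain ⟨d, rfl⟩ := Nat.exists_eq_add_of_le hm
  rw [hg i d]
  rfl

/-- A point above `M` descends by at most `M` in one step; the second claim records this and keeps
the iterates in the rigid zone. -/
theorem Tame.pow_rayMap (hg : Tame M g) (k : ℕ) (i : Fin n) {m : ℕ} (hm : k * M ≤ m) :
    ((g ^ k) (i, m)).1 = (hg.rayMap ^ k) i ∧ m ≤ ((g ^ k) (i, m)).2 + k * M := by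
  induction k with
  | zero => simp
  | succ k ih =>
    rw [Nat.succ_mul] at hm ⊢
    obtain ⟨h1, h2⟩ := ih (by omega)
    rw [pow_succ', pow_succ', Perm.mul_apply, Perm.mul_apply]
    set z := (g ^ k) (i, m) with hz
    have e : z = (z.1, z.2) := rfl
    rw [e, hg.rayMap_apply _ (by omega), h1]
    refine ⟨rfl, ?_⟩
    obtain ⟨d, hd⟩ := Nat.exists_eq_add_of_le (show M ≤ z.2 by omega)
    rw [hd, hg]
    dsimp only
    omega

theorem Tame.exists_pow_translatesFrom (hg : Tame M g) :
    ∃ L, 0 < L ∧ ∀ i, ((g ^ L) (i, L * M)).1 = i := by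
  refine ⟨orderOf hg.rayMap, orderOf_pos _, fun i => ?_⟩
  rw [(hg.pow_rayMap _ i le_rfl).1, pow_orderOf_eq_one, Perm.one_apply]

end Translations

/-! ### Vanishing of total translations by counting -/

section Counting

open Classical in
theorem Nat.count_add_of_forall {q : ℕ → Prop} {M k : ℕ} (h : ∀ m, M ≤ m → q m) :
    Nat.count q (M + k) = Nat.count q M + k := by
  induction k with
  | zero => rfl
  | succ k ih => rw [← add_assoc, Nat.count_succ, if_pos (h _ (by omega)), ih, add_assoc]

open Classical in
theorem Nat.count_add_of_forall_not {q : ℕ → Prop} {M k : ℕ} (h : ∀ m, M ≤ m → ¬ q m) :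
    Nat.count q (M + k) = Nat.count q M := by
  induction k with
  | zero => rfl
  | succ k ih => rw [← add_assoc, Nat.count_succ, if_neg (h _ (by omega)), ih, add_zero]

open Classical in
theorem card_sigma_count {n : ℕ} (F : Set (RaySpace n)) (f : Fin n → ℕ) (A : Finset (RaySpace n))
    (hA : ∀ z, z ∈ A ↔ z ∈ F ∧ z.2 < f z.1) :
    A.card = ∑ i, Nat.count (fun m => (i, m) ∈ F) (f i) := by
  rw [Finset.card_eq_sum_card_fiberwise (f := Prod.fst) (t := Finset.univ)
    (fun _ _ => Finset.mem_univ _)]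
  refine Finset.sum_congr rfl fun i _ => ?_
  rw [Nat.count_eq_card_filter_range]
  refine Finset.card_bij (fun z _ => z.2) ?_ ?_ ?_
  · rintro ⟨j, m⟩ hz
    simp only [Finset.mem_filter, hA, Finset.mem_range] at hz ⊢
    obtain ⟨⟨h1, h2⟩, rfl⟩ := hz
    exact ⟨h2, h1⟩
  · rintro ⟨j, m⟩ hz ⟨j', m'⟩ hz' e
    simp only [Finset.mem_filter] at hz hz'
    exact Prod.ext (hz.2.trans hz'.2.symm) e
  · intro m hm
    simp only [Finset.mem_filter, Finset.mem_range] at hm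
    exact ⟨(i, m), by simp [hA, hm], rfl⟩

/-- A permutation that translates far out and preserves a set containing the far part of the rays
in `R` and missing the far part of the others has total translation `0` on `R`. -/
theorem TranslatesBy.sum_eq_zero {n : ℕ} {c : Perm (RaySpace n)} {w : Fin n → ℤ}
    (hc : TranslatesBy c w) (F : Set (RaySpace n)) (hF : ∀ z, c z ∈ F ↔ z ∈ F)
    (R : Finset (Fin n)) (hR : ∃ M, ∀ i m, M ≤ m → ((i, m) ∈ F ↔ i ∈ R)) :
    ∑ i ∈ R, w i = 0 := by
  classical
  obtain ⟨M₁, hc⟩ := hc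
  obtain ⟨M₂, hR⟩ := hR
  set K := ∑ i, (w i).natAbs with hK
  have hwK : ∀ i, (w i).natAbs ≤ K := fun i =>
    Finset.single_le_sum (f := fun i => (w i).natAbs) (fun _ _ => Nat.zero_le _)
      (Finset.mem_univ i)
  set M := M₁ + M₂ + K with hM
  let f : Fin n → ℕ := fun i => ((M : ℤ) + w i).toNat
  have hf : ∀ i, (f i : ℤ) = M + w i := fun i => by
    have := hwK i
    simp only [f]
    omega
  let A : Finset (RaySpace n) := {z ∈ Finset.univ ×ˢ Finset.range M | z ∈ F}
  have hA : ∀ z, z ∈ A ↔ z ∈ F ∧ z.2 < M := fun z => by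
    simp only [A, Finset.mem_filter, Finset.mem_product, Finset.mem_univ, Finset.mem_range,
      true_and]
    tauto
  -- `c` carries the part of `F` below height `M` onto the part below the heights `M + w i`. The two
  -- sets are equinumerous, and far out each unit of height contributes one point of `F` on the rays
  -- in `R` and none on the others.
  have key : ∀ z, (c⁻¹ z).2 < M ↔ z.2 < f z.1 := by
    rintro ⟨j, m⟩
    dsimp only
    rw [← not_iff_not, not_lt, not_lt]
    constructor
    · intro h
      obtain ⟨h1, h2⟩ := hc (c⁻¹ (j, m)).1 (c⁻¹ (j, m)).2 (by omega)
      have e : c ((c⁻¹ (j, m)).1, (c⁻¹ (j, m)).2) = (j, m) := by simp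
      rw [e] at h1 h2
      dsimp only at h1 h2
      have := hf j
      rw [← h1] at h2
      omega
    · intro h
      have := hf j
      obtain ⟨k, hk⟩ : ∃ k : ℕ, (k : ℤ) = m - w j := ⟨((m : ℤ) - w j).toNat, by
        have := hwK j
        omega⟩
      have e : c⁻¹ (j, m) = (j, k) := by
        rw [Perm.inv_eq_iff_eq, hc.apply (k := m) (by omega) (by omega)]
      rw [e]
      dsimp only
      omega
  have h1 := card_sigma_count F (fun _ => M) A hA
  have h2 := card_sigma_count F f (A.map c.toEmbedding) (fun z => by
    rw [Finset.mem_map_equiv, hA, ← hF]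
    have := key z
    simp only [Equiv.apply_symm_apply]
    rw [← this]
    rfl)
  rw [Finset.card_map, h1] at h2
  have h3 : ∀ i, ((Nat.count (fun m => (i, m) ∈ F) (f i) : ℕ) : ℤ) =
      (Nat.count (fun m => (i, m) ∈ F) M : ℕ) + if i ∈ R then w i else 0 := by
    intro i
    obtain ⟨k, hk⟩ := Nat.exists_eq_add_of_le (show M₂ ≤ f i by
      have := hf i
      have := hwK i
      omega)
    obtain ⟨k', hk'⟩ := Nat.exists_eq_add_of_le (show M₂ ≤ M by omega)
    have := hf i
    rw [hk, hk']
    by_cases hi : i ∈ R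
    · rw [Nat.count_add_of_forall (fun m hm => (hR i m hm).2 hi),
        Nat.count_add_of_forall (fun m hm => (hR i m hm).2 hi), if_pos hi]
      omega
    · rw [Nat.count_add_of_forall_not (fun m hm h => hi ((hR i m hm).1 h)),
        Nat.count_add_of_forall_not (fun m hm h => hi ((hR i m hm).1 h)), if_neg hi]
      simp
  have h4 : (∑ i, ((Nat.count (fun m => (i, m) ∈ F) M : ℕ) : ℤ)) =
      ∑ i, ((Nat.count (fun m => (i, m) ∈ F) (f i) : ℕ) : ℤ) := by exact_mod_cast h2
  simp only [h3, Finset.sum_add_distrib] at h4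
  rw [Finset.sum_ite_mem, Finset.univ_inter] at h4
  linarith

theorem TranslatesBy.sum_univ_eq_zero {n : ℕ} {c : Perm (RaySpace n)} {w : Fin n → ℤ}
    (hc : TranslatesBy c w) : ∑ i, w i = 0 :=
  hc.sum_eq_zero Set.univ (by simp) Finset.univ ⟨0, by simp⟩

end Counting

/-! ### Equivariant extension of partial maps -/

section EquivariantExtension

/-- A partial map defined on `S` and compatible with the action of `a` extends to a map that
commutes with `a` and is the identity on the orbits that miss `S`. -/
theorem exists_equivariant_extension {α : Type*} (a : Perm α) (S : Set α) (g : α → α)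
    (hg : ∀ z ∈ S, ∀ k : ℤ, (a ^ k) z ∈ S → g ((a ^ k) z) = (a ^ k) (g z)) :
    ∃ c : α → α, (∀ z (k : ℤ), c ((a ^ k) z) = (a ^ k) (c z)) ∧ (∀ z ∈ S, c z = g z) ∧
      ∀ z, (∀ k : ℤ, (a ^ k) z ∉ S) → c z = z := by
  classical
  let c : α → α := fun z => if h : ∃ k : ℤ, (a ^ k) z ∈ S then
    (a ^ (-h.choose)) (g ((a ^ h.choose) z)) else z
  -- The value does not depend on which power is used to bring `z` into `S`.
  have key : ∀ z (k : ℤ), (a ^ k) z ∈ S → c z = (a ^ (-k)) (g ((a ^ k) z)) := by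
    intro z k hk
    have h : ∃ k : ℤ, (a ^ k) z ∈ S := ⟨k, hk⟩
    have e : (a ^ k) z = (a ^ (k - h.choose)) ((a ^ h.choose) z) := by
      rw [← Perm.mul_apply, ← zpow_add, sub_add_cancel]
    simp only [c, dif_pos h]
    rw [e, hg _ h.choose_spec _ (e ▸ hk), ← Perm.mul_apply, ← zpow_add]
    congr 2
    ring
  have hneg : ∀ z, (¬ ∃ k : ℤ, (a ^ k) z ∈ S) → c z = z := fun z h => dif_neg h
  refine ⟨c, fun z k => ?_, fun z hz => ?_, fun z hz => hneg z (by simpa using hz)⟩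
  · by_cases h : ∃ l : ℤ, (a ^ l) z ∈ S
    · obtain ⟨l, hl⟩ := h
      have e : (a ^ (l - k)) ((a ^ k) z) = (a ^ l) z := by
        rw [← Perm.mul_apply, ← zpow_add, sub_add_cancel]
      rw [key z l hl, key _ (l - k) (by rwa [e]), e, ← Perm.mul_apply, ← zpow_add]
      congr 2
      ring
    · rw [hneg z h, hneg]
      rintro ⟨l, hl⟩
      exact h ⟨l + k, by rwa [zpow_add, Perm.mul_apply]⟩
  · simpa using key z 0 (by simpa using hz)

end EquivariantExtension

/-! ### Commuting permutations that translate the rays with drift -/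

section NonzeroRays

variable {n : ℕ} {a : Perm (RaySpace n)} {L H : ℕ} {s : Fin n → ℤ}

theorem TranslatesBy.of_forall {c : Perm (RaySpace n)} {w : Fin n → ℤ}
    (h : ∀ i, ∃ M, ∀ m, M ≤ m → (c (i, m)).1 = i ∧ ((c (i, m)).2 : ℤ) = m + w i) :
    TranslatesBy c w := by
  choose M hM using h
  exact ⟨∑ i, M i, fun i m hm => hM i m
    ((Finset.single_le_sum (f := M) (fun _ _ => Nat.zero_le _) (Finset.mem_univ i)).trans hm)⟩

/-- Far points of a ray on which `a ^ L` is a nontrivial translation have infinite orbits. -/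
theorem pow_apply_ne_of_far (hL : TranslatesFrom H (a ^ L) s) {i : Fin n} {m : ℕ} (hi : s i ≠ 0)
    (hm : H ≤ m) {k : ℕ} (hk : 0 < k) : (a ^ k) (i, m) ≠ (i, m) := by
  intro h
  have h' : ((a ^ L) ^ k) (i, m) = (i, m) := by
    rw [← pow_mul, mul_comm, pow_mul]
    exact Function.IsFixedPt.perm_pow h L
  have hk' : (0 : ℤ) < k := by exact_mod_cast hk
  rcases lt_or_gt_of_ne hi with hi | hi
  · have h0 : 0 < (k : ℤ) * (- s i) := mul_pos hk' (by omega)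
    rw [mul_neg] at h0
    obtain ⟨m', hm'⟩ : ∃ m' : ℕ, (m' : ℤ) = m - k * s i := ⟨(m - k * s i).toNat, by omega⟩
    have := hL.pow_apply_of_neg hi.le k hm hm'
    rw [← h'] at this
    have := congrArg Prod.snd (((a ^ L) ^ k).injective this)
    dsimp only at this
    omega
  · have h0 : 0 < (k : ℤ) * s i := mul_pos hk' hi
    obtain ⟨m', hm'⟩ : ∃ m' : ℕ, (m' : ℤ) = m + k * s i := ⟨(m + k * s i).toNat, by omega⟩
    have := hL.pow_apply hi.le k hm hm'
    rw [h'] at this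
    have := congrArg Prod.snd this
    dsimp only at this
    omega

/-- Aperiodicity is a property of the orbit, so it may be checked at any of its points. -/
theorem pow_apply_ne_of_zpow {α : Type*} {a : Perm α} {z : α} (l : ℤ)
    (h : ∀ k : ℕ, 0 < k → (a ^ k) ((a ^ l) z) ≠ (a ^ l) z) (k : ℕ) (hk : 0 < k) :
    (a ^ k) z ≠ z := by
  intro e
  apply h k hk
  rw [← Perm.mul_apply, ← zpow_natCast, ← zpow_add, add_comm, zpow_add, Perm.mul_apply,
    zpow_natCast, e]

theorem finite_lt_height (B : ℕ) : {z : RaySpace n | z.2 < B}.Finite :=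
  (Set.Finite.prod (Set.finite_univ (α := Fin n)) (Set.finite_lt_nat B)).subset
    fun _ hz => ⟨Set.mem_univ _, hz⟩

/-- An infinite orbit eventually leaves every bounded region. -/
theorem eventually_height_ge {z : RaySpace n} (hz : ∀ k : ℕ, 0 < k → (a ^ k) z ≠ z) (B : ℕ) :
    ∃ k₀ : ℕ, ∀ k ≥ k₀, B ≤ ((a ^ k) z).2 := by
  have hinj : Function.Injective fun k : ℕ => (a ^ k) z := by
    have aux : ∀ k d : ℕ, (a ^ k) z = (a ^ (k + d)) z → d = 0 := by
      intro k d e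
      by_contra hd
      rw [pow_add, Perm.mul_apply] at e
      exact hz d (Nat.pos_of_ne_zero hd) ((a ^ k).injective e).symm
    intro k l e
    dsimp only at e
    rcases Nat.le_total k l with h | h
    · obtain ⟨d, rfl⟩ := Nat.exists_eq_add_of_le h
      rw [aux k d e, add_zero]
    · obtain ⟨d, rfl⟩ := Nat.exists_eq_add_of_le h
      rw [aux l d e.symm, add_zero]
  have hfin : {k : ℕ | ((a ^ k) z).2 < B}.Finite :=
    (finite_lt_height B).preimage (f := fun k : ℕ => (a ^ k) z) hinj.injOn
  obtain ⟨k₀, hk₀⟩ := hfin.bddAbove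
  refine ⟨k₀ + 1, fun k hk => ?_⟩
  by_contra h
  have := hk₀ (show k ∈ {k : ℕ | ((a ^ k) z).2 < B} from not_le.1 h)
  omega

theorem ne_zero_of_infinite (hL : TranslatesFrom H (a ^ L) s) (hL0 : 0 < L) {z : RaySpace n}
    (hz : ∀ k : ℕ, 0 < k → (a ^ k) z ≠ z) (hH : H ≤ z.2) : s z.1 ≠ 0 := by
  intro h
  exact hz L hL0 (hL.apply (i := z.1) hH (by rw [h, add_zero]))

theorem eventually_far (hL : TranslatesFrom H (a ^ L) s) (hL0 : 0 < L) {z : RaySpace n}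
    (hz : ∀ k : ℕ, 0 < k → (a ^ k) z ≠ z) (B : ℕ) :
    ∃ k₀ : ℕ, ∀ k ≥ k₀, B ≤ ((a ^ k) z).2 ∧ s ((a ^ k) z).1 ≠ 0 := by
  obtain ⟨k₀, hk₀⟩ := eventually_height_ge hz (B + H)
  refine ⟨k₀, fun k hk => ⟨by have := hk₀ k hk; omega, ?_⟩⟩
  refine ne_zero_of_infinite hL hL0 ?_ (by have := hk₀ k hk; omega)
  refine pow_apply_ne_of_zpow (-k : ℤ) ?_
  simpa using hz

/-- Translate the point `z` along its ray. -/
def shiftPoint {n : ℕ} (w : Fin n → ℤ) (z : RaySpace n) : RaySpace n :=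
  (z.1, ((z.2 : ℤ) + w z.1).toNat)

/-- A far translation supported on the rays where `a ^ L` moves, and compatible with `a`, is
induced by a permutation that commutes with `a`. -/
theorem exists_commute_of_nonzero (hL : TranslatesFrom H (a ^ L) s) (hL0 : 0 < L)
    {w : Fin n → ℤ} {B : ℕ} (hB : ∀ i, (w i).natAbs ≤ B) (hw0 : ∀ i, s i = 0 → w i = 0)
    (hw : ∀ z : RaySpace n, ∀ k : ℕ, s z.1 ≠ 0 → H + B ≤ z.2 → s ((a ^ k) z).1 ≠ 0 →
      H + B ≤ ((a ^ k) z).2 → (a ^ k) (shiftPoint w z) = shiftPoint w ((a ^ k) z)) :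
    ∃ c : Perm (RaySpace n), TranslatesBy c w ∧ Commute c a := by
  let S : Set (RaySpace n) := {z | s z.1 ≠ 0 ∧ H + B ≤ z.2}
  have hcompat : ∀ z ∈ S, ∀ k : ℤ, (a ^ k) z ∈ S →
      shiftPoint w ((a ^ k) z) = (a ^ k) (shiftPoint w z) := by
    intro z hz k hk
    obtain ⟨k, rfl | rfl⟩ := k.eq_nat_or_neg
    · rw [zpow_natCast] at hk ⊢
      exact (hw z k hz.1 hz.2 hk.1 hk.2).symm
    · have e : (a ^ k) ((a ^ (-k : ℤ)) z) = z := by simp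
      have := hw _ k hk.1 hk.2 (by rw [e]; exact hz.1) (by rw [e]; exact hz.2)
      rw [e] at this
      rw [← this]
      simp
  obtain ⟨c, hc1, hc2, hc3⟩ := exists_equivariant_extension a S (shiftPoint w) hcompat
  have hinf : ∀ z, (∃ l : ℤ, (a ^ l) z ∈ S) → ∀ k : ℕ, 0 < k → (a ^ k) z ≠ z := by
    rintro z ⟨l, hl⟩
    exact pow_apply_ne_of_zpow l fun k hk =>
      pow_apply_ne_of_far hL hl.1 ((Nat.le_add_right _ _).trans hl.2) hk
  -- The second `B` keeps these points in `S` after a shift by `w`.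
  have hfar : ∀ z, (∃ l : ℤ, (a ^ l) z ∈ S) → ∃ k₀ : ℕ, ∀ k ≥ k₀, H + 2 * B ≤ ((a ^ k) z).2 ∧
      s ((a ^ k) z).1 ≠ 0 := fun z hz => eventually_far hL hL0 (hinf z hz) _
  have hshift : ∀ z : RaySpace n, s z.1 ≠ 0 → H + 2 * B ≤ z.2 → shiftPoint w z ∈ S := by
    intro z h1 h2
    refine ⟨h1, ?_⟩
    have := hB z.1
    simp only [shiftPoint]
    omega
  have hval : ∀ z (k : ℕ), (a ^ k) z ∈ S → (a ^ k) (c z) = shiftPoint w ((a ^ k) z) := by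
    intro z k hk
    rw [← hc2 _ hk]
    simpa using (hc1 z k).symm
  have hshinj : ∀ z ∈ S, ∀ z' ∈ S, shiftPoint w z = shiftPoint w z' → z = z' := by
    rintro ⟨i, m⟩ hz ⟨i', m'⟩ hz' e
    simp only [shiftPoint, Prod.mk.injEq] at e
    obtain ⟨rfl, e⟩ := e
    have := hB i
    have h1 := hz.2
    have h2 := hz'.2
    dsimp only at h1 h2
    congr 1
    omega
  -- The union of the orbits meeting `S` is preserved, so it does not mix with its complement, where
  -- `c` is the identity.
  have hsat : ∀ z, (∃ l : ℤ, (a ^ l) z ∈ S) → ∃ l : ℤ, (a ^ l) (c z) ∈ S := by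
    intro z hz
    obtain ⟨k, hk⟩ := hfar z hz
    obtain ⟨h1, h2⟩ := hk k le_rfl
    refine ⟨k, ?_⟩
    rw [zpow_natCast, hval z k ⟨h2, by omega⟩]
    exact hshift _ h2 h1
  have hinj : Function.Injective c := by
    intro z z' e
    by_cases hz : ∃ l : ℤ, (a ^ l) z ∈ S <;> by_cases hz' : ∃ l : ℤ, (a ^ l) z' ∈ S
    · obtain ⟨k, hk⟩ := hfar z hz
      obtain ⟨k', hk'⟩ := hfar z' hz'
      -- One common power of `a` moves both points into `S`, where `c` is the injective map
      -- `shiftPoint w`.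
      obtain ⟨h1, h2⟩ := hk (k + k') (by omega)
      obtain ⟨h1', h2'⟩ := hk' (k + k') (by omega)
      have m1 : (a ^ (k + k')) z ∈ S := ⟨h2, by omega⟩
      have m2 : (a ^ (k + k')) z' ∈ S := ⟨h2', by omega⟩
      apply (a ^ (k + k')).injective
      apply hshinj _ m1 _ m2
      rw [← hval z _ m1, ← hval z' _ m2, e]
    · exfalso
      rw [hc3 z' (by simpa using hz')] at e
      exact hz' (e ▸ hsat z hz)
    · exfalso
      rw [hc3 z (by simpa using hz)] at e
      exact hz (e ▸ hsat z' hz')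
    · rwa [hc3 z (by simpa using hz), hc3 z' (by simpa using hz')] at e
  have hsurj : Function.Surjective c := by
    intro z
    by_cases hz : ∃ l : ℤ, (a ^ l) z ∈ S
    · obtain ⟨k, hk⟩ := hfar z hz
      obtain ⟨h1, h2⟩ := hk k le_rfl
      set y := (a ^ k) z with hy
      have hBy := hB y.1
      have hu : (y.1, ((y.2 : ℤ) - w y.1).toNat) ∈ S := ⟨h2, by dsimp only; omega⟩
      refine ⟨(a ^ (-k : ℤ)) (y.1, ((y.2 : ℤ) - w y.1).toNat), ?_⟩
      rw [hc1, hc2 _ hu]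
      have : shiftPoint w (y.1, ((y.2 : ℤ) - w y.1).toNat) = y := by
        refine Prod.ext rfl ?_
        simp only [shiftPoint]
        omega
      rw [this, hy]
      simp
    · exact ⟨z, hc3 z (by simpa using hz)⟩
  have hbij : Function.Bijective c := ⟨hinj, hsurj⟩
  obtain ⟨e, he⟩ : ∃ e : Perm (RaySpace n), ∀ z, e z = c z := ⟨.ofBijective c hbij, fun _ => rfl⟩
  refine ⟨e, ⟨H + B, fun i m hm => ?_⟩, ?_⟩
  · rw [he]
    by_cases hi : s i = 0
    · have : ∀ l : ℤ, (a ^ l) (i, m) ∉ S := fun l hl =>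
        hinf _ ⟨l, hl⟩ L hL0 (hL.apply (by omega) (by rw [hi, add_zero]))
      rw [hc3 _ this, hw0 i hi]
      simp
    · rw [hc2 _ ⟨hi, hm⟩]
      refine ⟨rfl, ?_⟩
      have := hB i
      simp only [shiftPoint]
      omega
  · ext1 z
    simpa [he] using hc1 z 1

end NonzeroRays

/-! ### Commuting permutations that shift the rays without drift -/

section ZeroRays

variable {n : ℕ} {a : Perm (RaySpace n)} {M L H : ℕ} {s : Fin n → ℤ}

/-- The `r`-th power of `a` fixes the far part of ray `i`. -/
def FixesRay {n : ℕ} (a : Perm (RaySpace n)) (r : ℕ) (i : Fin n) : Prop :=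
  ∃ M, ∀ m, M ≤ m → (a ^ r) (i, m) = (i, m)

/-- Above `r * M` the power is rigid, so a single point of the ray decides. -/
theorem Tame.fixesRay_iff (ha : Tame M a) {r : ℕ} {i : Fin n} {m : ℕ} (hm : r * M ≤ m) :
    FixesRay a r i ↔ (a ^ r) (i, m) = (i, m) := by
  constructor
  · rintro ⟨M', h⟩
    have := h (m + M') (by omega)
    rw [(ha.pow r).apply_add i hm] at this
    obtain ⟨h1, h2⟩ := Prod.mk.inj this
    exact Prod.ext h1 (by dsimp only; omega)
  · intro h
    refine ⟨m, fun m' hm' => ?_⟩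
    obtain ⟨d, rfl⟩ := Nat.exists_eq_add_of_le hm'
    rw [(ha.pow r).apply_add i hm, h]

theorem FixesRay.mul {r : ℕ} {i : Fin n} (h : FixesRay a r i) (q : ℕ) :
    FixesRay a (r * q) i := by
  obtain ⟨M, h⟩ := h
  exact ⟨M, fun m hm => by rw [pow_mul]; exact Function.IsFixedPt.perm_pow (h m hm) q⟩

theorem FixesRay.mod {r k : ℕ} {i : Fin n} (h : FixesRay a r i) (hk : FixesRay a k i) :
    FixesRay a (k % r) i := by
  obtain ⟨M, h⟩ := h.mul (k / r)
  obtain ⟨M', hk⟩ := hk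
  refine ⟨M + M', fun m hm => ?_⟩
  have := hk m (by omega)
  rwa [← Nat.mod_add_div k r, pow_add, Perm.mul_apply, h m (by omega)] at this

/-- A power of `a` mapping a ray without drift to itself fixes it. -/
theorem Tame.fixesRay_of_ray_eq (ha : Tame M a) (hL : TranslatesFrom H (a ^ L) s) (hL0 : 0 < L)
    {i : Fin n} (hi : s i = 0) {k : ℕ} (hk : (ha.rayMap ^ k) i = i) : FixesRay a k i := by
  set K := k * M + H with hK
  obtain ⟨u, hu⟩ : ∃ u : ℤ, ∀ m : ℕ, K ≤ m → ((a ^ k) (i, m)).1 = i ∧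
      (((a ^ k) (i, m)).2 : ℤ) = m + u := by
    refine ⟨(((a ^ k) (i, K)).2 : ℤ) - K, fun m hm => ?_⟩
    obtain ⟨d, rfl⟩ := Nat.exists_eq_add_of_le hm
    rw [(ha.pow k).apply_add i (by omega)]
    refine ⟨(ha.pow_rayMap k i (by omega)).1.trans hk, ?_⟩
    push_cast
    ring
  -- `a ^ k` translates the ray by some `u`, so its `L`-th power translates by `L * u`; but that is
  -- a power of `a ^ L`, which fixes the far part of the ray. Hence `u = 0`.
  have hpow : ∀ q : ℕ, ∃ m₀ : ℕ, ∀ m : ℕ, m₀ ≤ m → (((a ^ k) ^ q) (i, m)).1 = i ∧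
      ((((a ^ k) ^ q) (i, m)).2 : ℤ) = m + q * u := by
    intro q
    induction q with
    | zero => exact ⟨0, fun m _ => by simp⟩
    | succ q ih =>
      obtain ⟨m₀, ih⟩ := ih
      refine ⟨m₀ + K + q * u.natAbs, fun m hm => ?_⟩
      obtain ⟨h1, h2⟩ := ih m (by omega)
      rw [pow_succ', Perm.mul_apply]
      have e : ((a ^ k) ^ q) (i, m) = (i, (((a ^ k) ^ q) (i, m)).2) := Prod.ext h1 rfl
      have hqu : -((q * u.natAbs : ℕ) : ℤ) ≤ q * u := by
        push_cast
        have : -|u| ≤ u := neg_abs_le u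
        have h0 : (0 : ℤ) ≤ q := by positivity
        nlinarith
      obtain ⟨g1, g2⟩ := hu (((a ^ k) ^ q) (i, m)).2 (by omega)
      rw [e]
      refine ⟨g1, ?_⟩
      rw [g2, h2]
      push_cast
      ring
  obtain ⟨m₀, h⟩ := hpow L
  have h2 := (h (m₀ + H) (by omega)).2
  rw [← pow_mul, mul_comm, pow_mul] at h2
  have e : ((a ^ L) ^ k) (i, m₀ + H) = (i, m₀ + H) :=
    Function.IsFixedPt.perm_pow (hL.apply (by omega) (by rw [hi, add_zero])) k
  rw [e] at h2
  have hu0 : u = 0 := by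
    have : (L : ℤ) * u = 0 := by dsimp only at h2; omega
    rcases mul_eq_zero.1 this with h | h
    · omega
    · exact h
  subst hu0
  exact ⟨K, fun m hm => Prod.ext (hu m hm).1 (by have := (hu m hm).2; dsimp only; omega)⟩

/-- The translation vector `1` on the cycle of ray `i` and `-1` on the cycle of ray `j`. -/
noncomputable def cycleDiff {n : ℕ} (σ : Perm (Fin n)) (i j : Fin n) (l : Fin n) : ℤ :=
  open Classical in (if σ.SameCycle l i then 1 else 0) - (if σ.SameCycle l j then 1 else 0)

/-- The permutation moving the part of ray `i` above `K` up, that of ray `j` down. -/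
theorem exists_far_rayShift {n : ℕ} {i j : Fin n} (hij : i ≠ j) (K : ℕ) :
    ∃ e : Perm (RaySpace n), (∀ m, K ≤ m → e (i, m) = (i, m + 1)) ∧
      (∀ m, K ≤ m → e (j, m + 1) = (j, m)) ∧ e (j, K) = (i, K) := by
  refine ⟨⟨fun x => if x.1 = i ∧ K ≤ x.2 then (i, x.2 + 1) else if x.1 = j ∧ K ≤ x.2 then
      (if x.2 = K then (i, K) else (j, x.2 - 1)) else x,
    fun x => if x.1 = i ∧ K ≤ x.2 then (if x.2 = K then (j, K) else (i, x.2 - 1))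
      else if x.1 = j ∧ K ≤ x.2 then (j, x.2 + 1) else x, ?_, ?_⟩, ?_, ?_, ?_⟩
  · rintro ⟨l, m⟩
    grind
  · rintro ⟨l, m⟩
    grind
  all_goals
    simp only [Equiv.coe_fn_mk]
    grind

/-- Reducing exponents below `L` makes the one height `L * M` sufficient for the rigidity of all
powers, negative ones included. -/
theorem exists_zpow_apply_eq_pow {α : Type*} (a : Perm α) {L : ℕ} (hL0 : 0 < L) (k : ℤ) :
    ∃ k' < L, ∀ z, (a ^ L) z = z → (a ^ k) z = (a ^ k') z := by
  have h0 : (0 : ℤ) < L := by exact_mod_cast hL0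
  refine ⟨(k % L).toNat, by have := Int.emod_lt_of_pos k h0; omega, fun z hz => ?_⟩
  have e : (a ^ (L * (k / L) : ℤ)) z = z := by
    rw [zpow_mul, zpow_natCast]
    exact Function.IsFixedPt.perm_zpow hz _
  have h1 := Int.emod_nonneg k h0.ne'
  conv_lhs => rw [← Int.emod_add_mul_ediv k L, zpow_add, Perm.mul_apply, e]
  conv_lhs => rw [← Int.toNat_of_nonneg h1, zpow_natCast]

/-- Two drift-free ray cycles of equal length admit a commuting shift. -/
theorem exists_commute_cycleDiff (ha : Tame M a) (hL : TranslatesFrom H (a ^ L) s) (hL0 : 0 < L)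
    {i j : Fin n} (hi : s i = 0) (hj : s j = 0) (hper : ∀ k, FixesRay a k i ↔ FixesRay a k j)
    (hij : ¬ ha.rayMap.SameCycle i j) :
    ∃ c : Perm (RaySpace n), TranslatesBy c (cycleDiff ha.rayMap i j) ∧ Commute c a := by
  classical
  have hne : i ≠ j := fun h => hij (h ▸ Perm.SameCycle.refl _ _)
  set K := H + L * M with hK
  obtain ⟨e, he1, he2, he3⟩ := exists_far_rayShift hne K
  let S : Set (RaySpace n) := {z | (z.1 = i ∨ z.1 = j) ∧ K ≤ z.2}
  have hSL : ∀ z ∈ S, (a ^ L) z = z := by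
    rintro ⟨l, m⟩ ⟨h1, h2⟩
    dsimp only at h1 h2
    refine hL.apply (by omega) ?_
    rcases h1 with rfl | rfl <;> simp [*]
  have hfix : ∀ l, (l = i ∨ l = j) → ∀ k, k < L → FixesRay a k l → ∀ z ∈ S, (a ^ k) z = z := by
    rintro l hl k hk hf ⟨l', m⟩ ⟨h1, h2⟩
    dsimp only at h1 h2
    have hm : k * M ≤ m := by
      have := Nat.mul_le_mul_right M hk.le
      omega
    have hf' : FixesRay a k l' := by
      rcases hl with rfl | rfl <;> rcases h1 with rfl | rfl <;> first | exact hf | simpa [hper] using hf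
    exact (ha.fixesRay_iff hm).1 hf'
  -- A power returning one point of `S` to `S` fixes all of `S`: the rays `i` and `j` lie in
  -- different cycles, so it maps a ray to itself, hence fixes its far part, and the equal periods
  -- transfer this to the other ray. Compatibility of `e` with `a` is then trivial.
  have hS : ∀ z ∈ S, ∀ k : ℤ, (a ^ k) z ∈ S → ∀ z' ∈ S, (a ^ k) z' = z' := by
    intro z hz k hk z' hz'
    obtain ⟨k', hk', ek⟩ := exists_zpow_apply_eq_pow a hL0 k
    rw [ek z' (hSL z' hz')]
    rw [ek z (hSL z hz)] at hk
    have hz1 := hz.1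
    have hz2 : K ≤ z.2 := hz.2
    have hray := (ha.pow_rayMap k' z.1 (m := z.2) (by
      have := Nat.mul_le_mul_right M hk'.le
      omega)).1
    have hray' : ((a ^ k') z).1 = (ha.rayMap ^ k') z.1 := hray
    have hsame : (ha.rayMap ^ k') z.1 = z.1 := by
      rcases hz1 with h | h <;> rcases hk.1 with h' | h' <;> rw [hray', h] at h' <;> rw [h]
      · exact h'
      · exact absurd ⟨k', by simpa using h'⟩ hij
      · exact absurd (Perm.SameCycle.symm ⟨k', by simpa using h'⟩) hij
      · exact h'
    refine hfix z.1 hz1 k' hk' (ha.fixesRay_of_ray_eq hL hL0 ?_ hsame) z' hz'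
    rcases hz1 with h | h <;> rw [h] <;> assumption
  have heS : ∀ z ∈ S, e z ∈ S := by
    rintro ⟨l, m⟩ ⟨h1, h2⟩
    dsimp only at h1 h2
    rcases h1 with rfl | rfl
    · rw [he1 m h2]
      exact ⟨Or.inl rfl, by dsimp only; omega⟩
    · rcases Nat.eq_or_lt_of_le h2 with rfl | h
      · rw [he3]
        exact ⟨Or.inl rfl, le_rfl⟩
      · obtain ⟨m, rfl⟩ : ∃ m', m = m' + 1 := ⟨m - 1, by omega⟩
        rw [he2 m (by omega)]
        exact ⟨Or.inr rfl, by dsimp only; omega⟩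
  have heS' : ∀ z ∈ S, e.symm z ∈ S := by
    rintro ⟨l, m⟩ ⟨h1, h2⟩
    dsimp only at h1 h2
    rcases h1 with rfl | rfl
    · rcases Nat.eq_or_lt_of_le h2 with rfl | h
      · rw [← he3]
        rw [Equiv.symm_apply_apply]
        exact ⟨Or.inr rfl, le_rfl⟩
      · obtain ⟨m, rfl⟩ : ∃ m', m = m' + 1 := ⟨m - 1, by omega⟩
        rw [← he1 m (by omega)]
        rw [Equiv.symm_apply_apply]
        exact ⟨Or.inl rfl, by dsimp only; omega⟩
    · rw [← he2 m (by omega)]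
      rw [Equiv.symm_apply_apply]
      exact ⟨Or.inr rfl, by dsimp only; omega⟩
  obtain ⟨c, hc1, hc2, hc3⟩ := exists_equivariant_extension a S e (fun z hz k hk => by
    rw [hS z hz k hk z hz, hS z hz k hk _ (heS z hz)])
  obtain ⟨c', hc1', hc2', hc3'⟩ := exists_equivariant_extension a S e.symm (fun z hz k hk => by
    rw [hS z hz k hk z hz, hS z hz k hk _ (heS' z hz)])
  have hback : ∀ z (k : ℤ), (a ^ (-k)) ((a ^ k) z) = z := fun z k => by simp
  have inv1 : ∀ z, c' (c z) = z := by
    intro z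
    by_cases h : ∃ k : ℤ, (a ^ k) z ∈ S
    · obtain ⟨k, hk⟩ := h
      rw [← hback z k, hc1, hc1', hc2 _ hk, hc2' _ (heS _ hk), Equiv.symm_apply_apply]
    · rw [hc3 z (by simpa using h), hc3' z (by simpa using h)]
  have inv2 : ∀ z, c (c' z) = z := by
    intro z
    by_cases h : ∃ k : ℤ, (a ^ k) z ∈ S
    · obtain ⟨k, hk⟩ := h
      rw [← hback z k, hc1', hc1, hc2' _ hk, hc2 _ (heS' _ hk), Equiv.apply_symm_apply]
    · rw [hc3' z (by simpa using h), hc3 z (by simpa using h)]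
  obtain ⟨f, hf⟩ : ∃ f : Perm (RaySpace n), ∀ z, f z = c z := ⟨⟨c, c', inv1, inv2⟩, fun _ => rfl⟩
  refine ⟨f, TranslatesBy.of_forall fun l => ?_, ?_⟩
  · by_cases hli : ha.rayMap.SameCycle l i
    · obtain ⟨q, hq⟩ := hli.exists_nat_pow_eq
      have hlj : ¬ ha.rayMap.SameCycle l j := fun h => hij (hli.symm.trans h)
      -- `a ^ q` carries the far part of ray `l` rigidly to ray `i`; the extra `q * M` covers its
      -- possible descent.
      refine ⟨K + q * M, fun m hm => ?_⟩
      obtain ⟨h1, h2⟩ := ha.pow_rayMap q l (m := m) (by omega)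
      have hS1 : (a ^ (q : ℤ)) (l, m) ∈ S := by
        rw [zpow_natCast]
        exact ⟨Or.inl (h1.trans hq), by omega⟩
      have e1 : (a ^ q) (l, m) = (i, ((a ^ q) (l, m)).2) := Prod.ext (h1.trans hq) rfl
      have e2 : f (l, m) = (l, m + 1) := by
        rw [hf]
        apply (a ^ (q : ℤ)).injective
        rw [← hc1, hc2 _ hS1, zpow_natCast, (ha.pow q).apply_add l (by omega), e1,
          he1 _ (by omega)]
      rw [e2, cycleDiff, if_pos hli, if_neg hlj]
      simp
    · by_cases hlj : ha.rayMap.SameCycle l j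
      · obtain ⟨q, hq⟩ := hlj.exists_nat_pow_eq
        refine ⟨K + q * M + 1, fun m hm => ?_⟩
        obtain ⟨m, rfl⟩ : ∃ m', m = m' + 1 := ⟨m - 1, by omega⟩
        obtain ⟨h1, h2⟩ := ha.pow_rayMap q l (m := m) (by omega)
        have e1 : (a ^ q) (l, m) = (j, ((a ^ q) (l, m)).2) := Prod.ext (h1.trans hq) rfl
        have e2 : (a ^ q) (l, m + 1) = (j, ((a ^ q) (l, m)).2 + 1) := by
          rw [(ha.pow q).apply_add l (by omega), e1]
        have hS1 : (a ^ (q : ℤ)) (l, m + 1) ∈ S := by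
          rw [zpow_natCast, e2]
          exact ⟨Or.inr rfl, by dsimp only; omega⟩
        have e3 : f (l, m + 1) = (l, m) := by
          rw [hf]
          apply (a ^ (q : ℤ)).injective
          rw [← hc1, hc2 _ hS1, zpow_natCast, e2, he2 _ (by omega), ← e1]
        rw [e3, cycleDiff, if_neg hli, if_pos hlj]
        simp
      · refine ⟨L * M, fun m hm => ?_⟩
        have hnot : ∀ k : ℤ, (a ^ k) (l, m) ∉ S := by
          intro k hk
          have hfixL : (a ^ L) (l, m) = (l, m) := by
            apply (a ^ k).injective
            rw [← Perm.mul_apply, ← zpow_natCast, ← zpow_add, add_comm, zpow_add, Perm.mul_apply,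
              zpow_natCast, hSL _ hk]
          obtain ⟨k', hk', ek⟩ := exists_zpow_apply_eq_pow a hL0 k
          rw [ek _ hfixL] at hk
          have h1 := (ha.pow_rayMap k' l (m := m)
            ((Nat.mul_le_mul_right M hk'.le).trans hm)).1
          rcases hk.1 with h | h <;> rw [h1] at h
          · exact hli ⟨k', by simpa using h⟩
          · exact hlj ⟨k', by simpa using h⟩
        rw [hf, hc3 _ hnot, cycleDiff, if_neg hli, if_neg hlj]
        simp
  · ext1 z
    simpa [hf] using hc1 z 1

end ZeroRays

/-! ### The group `T` of commuting translation vectors, and `T` modulo `2T` -/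

section CommutingTranslations

/-- The translation vectors of the elements of the Houghton group that commute with `a`. -/
def commutingTranslations {n : ℕ} (a : Perm (RaySpace n)) : AddSubgroup (Fin n → ℤ) where
  carrier := {w | ∃ c : Perm (RaySpace n), TranslatesBy c w ∧ Commute c a}
  zero_mem' := ⟨1, .one, Commute.one_left a⟩
  add_mem' := by
    rintro w w' ⟨c, h1, h2⟩ ⟨c', h1', h2'⟩
    exact ⟨c * c', h1.mul h1', h2.mul_left h2'⟩
  neg_mem' := by
    rintro w ⟨c, h1, h2⟩
    exact ⟨c⁻¹, h1.inv, h2.inv_left⟩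

theorem mem_commutingTranslations {n : ℕ} {a : Perm (RaySpace n)} {w : Fin n → ℤ} :
    w ∈ commutingTranslations a ↔ ∃ c : Perm (RaySpace n), TranslatesBy c w ∧ Commute c a :=
  Iff.rfl

/-- The conditions on a translation vector `w` (with entries bounded by `B`) that characterize
membership in `commutingTranslations a`. -/
structure IsAdmissible {n : ℕ} (a : Perm (RaySpace n)) (M H B : ℕ) (s w : Fin n → ℤ) : Prop where
  cycle : ∀ i, w (a (i, M)).1 = w i
  fixed : ∀ r, open Classical in ∑ i with FixesRay a r i, w i = 0
  orbit : ∀ z : RaySpace n, ∀ k : ℕ, s z.1 ≠ 0 → H + B ≤ z.2 → s ((a ^ k) z).1 ≠ 0 →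
    H + B ≤ ((a ^ k) z).2 → (a ^ k) (shiftPoint w z) = shiftPoint w ((a ^ k) z)

variable {n : ℕ} {a c : Perm (RaySpace n)} {M L H B : ℕ} {s w : Fin n → ℤ}

theorem TranslatesFrom.translatesBy (h : TranslatesFrom M c w) : TranslatesBy c w := ⟨M, h⟩

/-- A permutation commuting with `a` translates every ray with drift from an explicit height on. -/
theorem Commute.apply_eq_shiftPoint (hL : TranslatesFrom H (a ^ L) s) (hc : TranslatesBy c w)
    (hca : Commute c a) {z : RaySpace n} (hB : (w z.1).natAbs ≤ B) (hi : s z.1 ≠ 0)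
    (hm : H + B ≤ z.2) : c z = shiftPoint w z := by
  obtain ⟨i, m⟩ := z
  dsimp only at hi hm hB
  obtain ⟨m', hm'⟩ : ∃ m' : ℕ, (m' : ℤ) = m + w i := ⟨((m : ℤ) + w i).toNat, by omega⟩
  have e : shiftPoint w (i, m) = (i, m') := Prod.ext rfl (by simp only [shiftPoint]; omega)
  rw [e]
  obtain ⟨K, hc⟩ := hc
  have hq' : ∀ (q : ℕ) z, c (((a ^ L) ^ q) z) = ((a ^ L) ^ q) (c z) := fun q z => by
    rw [← Perm.mul_apply, ← Perm.mul_apply, ((hca.pow_right L).pow_right q).eq]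
  rcases lt_or_gt_of_ne hi with hi | hi
  · have h0 : (K : ℤ) ≤ K * (- s i) := by nlinarith
    rw [mul_neg] at h0
    obtain ⟨u, hu⟩ : ∃ u : ℕ, (u : ℤ) = m - K * s i := ⟨(m - K * s i).toNat, by omega⟩
    obtain ⟨u', hu'⟩ : ∃ u' : ℕ, (u' : ℤ) = m' - K * s i := ⟨(m' - K * s i).toNat, by omega⟩
    have e1 := hL.pow_apply_of_neg hi.le K (by omega) hu
    have e2 := hL.pow_apply_of_neg hi.le K (m := m') (by omega) hu'
    rw [← e1, hq', hc.apply (k := u') (by omega) (by omega), e2]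
  · have h0 : (K : ℤ) ≤ K * s i := by nlinarith
    obtain ⟨u, hu⟩ : ∃ u : ℕ, (u : ℤ) = m + K * s i := ⟨(m + K * s i).toNat, by omega⟩
    obtain ⟨u', hu'⟩ : ∃ u' : ℕ, (u' : ℤ) = m' + K * s i := ⟨(m' + K * s i).toNat, by omega⟩
    have e1 := hL.pow_apply hi.le K (m := m) (by omega) hu
    have e2 := hL.pow_apply hi.le K (m := m') (by omega) hu'
    apply ((a ^ L) ^ K).injective
    rw [← hq', e1, e2, hc.apply (k := u') (by omega) (by omega)]

/-- Far out `a` maps ray `i` rigidly to its image ray, so `c a = a c` transports the displacement of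
`c` from one to the other. -/
theorem Tame.translation_ray_eq (ha : Tame M a) (hc : TranslatesBy c w) (hca : Commute c a)
    (i : Fin n) : w (a (i, M)).1 = w i := by
  obtain ⟨K, hc⟩ := hc
  obtain ⟨u, hu⟩ : ∃ u : ℕ, (u : ℤ) = (M + K + (w i).natAbs : ℕ) + w i :=
    ⟨((M + K + (w i).natAbs : ℕ) + w i).toNat, by omega⟩
  have e1 : c (a (i, M + K + (w i).natAbs)) = a (c (i, M + K + (w i).natAbs)) := by
    rw [← Perm.mul_apply, hca.eq, Perm.mul_apply]
  rw [hc.apply (by omega) hu] at e1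
  obtain ⟨d, hd⟩ : ∃ d, u = M + d := ⟨u - M, by omega⟩
  rw [add_assoc, ha i, hd, ha i] at e1
  obtain ⟨-, h2⟩ := hc (a (i, M)).1 ((a (i, M)).2 + (K + (w i).natAbs)) (by omega)
  rw [e1] at h2
  dsimp only at h2
  omega

/-- The sum condition holds since `c` preserves the fixed-point set of `a ^ r`, which far out
consists of whole rays. -/
theorem isAdmissible_of_mem (ha : Tame M a) (hL : TranslatesFrom H (a ^ L) s)
    (hB : ∀ i, (w i).natAbs ≤ B) (hw : w ∈ commutingTranslations a) :
    IsAdmissible a M H B s w := by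
  classical
  obtain ⟨c, hc, hca⟩ := hw
  refine ⟨ha.translation_ray_eq hc hca, fun r => ?_, fun z k h1 h2 h3 h4 => ?_⟩
  · convert hc.sum_eq_zero {z | (a ^ r) z = z} (fun z => ?_) {i | FixesRay a r i}
      ⟨r * M, fun i m hm => ?_⟩
    · simp only [Set.mem_ofPred_eq]
      rw [← Perm.mul_apply, ← (hca.pow_right r).eq, Perm.mul_apply, c.injective.eq_iff]
    · simp only [Set.mem_ofPred_eq, Finset.mem_filter, Finset.mem_univ, true_and]
      exact (ha.fixesRay_iff hm).symm
  · rw [← hca.apply_eq_shiftPoint hL hc (hB _) h1 h2, ← hca.apply_eq_shiftPoint hL hc (hB _) h3 h4,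
      ← Perm.mul_apply, ← Perm.mul_apply, (hca.pow_right k).eq]

theorem Tame.sameCycle_eq (ha : Tame M a) (h : ∀ i, w (a (i, M)).1 = w i) {i j : Fin n}
    (hij : ha.rayMap.SameCycle i j) : w i = w j := by
  obtain ⟨k, rfl⟩ := hij.exists_nat_pow_eq
  induction k with
  | zero => rfl
  | succ k ih =>
    rw [pow_succ', Perm.mul_apply]
    exact (ih ⟨k, by simp⟩).trans (h _).symm

/-- Pairs of drift-free rays of equal period lying in different cycles. -/
def Tame.IsShiftPair (ha : Tame M a) (s : Fin n → ℤ) (i j : Fin n) : Prop :=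
  s i = 0 ∧ s j = 0 ∧ (∀ k, FixesRay a k i ↔ FixesRay a k j) ∧ ¬ ha.rayMap.SameCycle i j

theorem Tame.IsShiftPair.mem (ha : Tame M a) (hL : TranslatesFrom H (a ^ L) s) (hL0 : 0 < L)
    {i j : Fin n} (h : ha.IsShiftPair s i j) :
    cycleDiff ha.rayMap i j ∈ commutingTranslations a :=
  exists_commute_cycleDiff ha hL hL0 h.1 h.2.1 h.2.2.1 h.2.2.2

open Classical in
/-- The shift vectors of all pairs of rays, `0` for the pairs that admit no shift. -/
noncomputable def Tame.shiftVector (ha : Tame M a) (s : Fin n → ℤ) (q : Fin n × Fin n) :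
    Fin n → ℤ :=
  if ha.IsShiftPair s q.1 q.2 then cycleDiff ha.rayMap q.1 q.2 else 0

theorem Tame.shiftVector_mem (ha : Tame M a) (hL : TranslatesFrom H (a ^ L) s) (hL0 : 0 < L)
    (q : Fin n × Fin n) : ha.shiftVector s q ∈ commutingTranslations a := by
  rw [shiftVector]
  split_ifs with h
  · exact h.mem ha hL hL0
  · exact zero_mem _

theorem Tame.natAbs_shiftVector_le (ha : Tame M a) (q : Fin n × Fin n) (l : Fin n) :
    (ha.shiftVector s q l).natAbs ≤ 1 := by
  rw [shiftVector]
  split_ifs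
  · rw [cycleDiff]
    split_ifs <;> simp
  · simp

/-- The drift is itself a commuting translation vector, hence constant on ray cycles; a cycle
through a drift-free ray has only such rays. -/
theorem Tame.shiftVector_eq_zero (ha : Tame M a) (hL : TranslatesFrom H (a ^ L) s)
    (q : Fin n × Fin n) {l : Fin n} (hl : s l ≠ 0) : ha.shiftVector s q l = 0 := by
  have hs : ∀ i, s (a (i, M)).1 = s i :=
    ha.translation_ray_eq ⟨H, hL⟩ (Commute.refl a |>.pow_left L)
  rw [shiftVector]
  split_ifs with h
  · rw [cycleDiff, if_neg, if_neg, sub_zero]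
    · exact fun h' => hl ((ha.sameCycle_eq hs h').trans h.2.1)
    · exact fun h' => hl ((ha.sameCycle_eq hs h').trans h.1)
  · rfl

open Classical in
theorem exists_opposite_of_sum_eq_zero {ι : Type*} {R : Finset ι} {w : ι → ℤ}
    (h : ∑ i ∈ R, w i = 0) {i : ι} (hi : i ∈ R) (hwi : w i ≠ 0) :
    ∃ i ∈ R, ∃ j ∈ R, 0 < w i ∧ w j < 0 := by
  rcases lt_or_gt_of_ne hwi with hlt | hgt
  · by_contra! hcon
    have : ∑ i ∈ R, w i < ∑ i ∈ R, 0 := Finset.sum_lt_sum (fun j hj => by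
      by_contra! hj'
      exact absurd hlt (not_lt.2 (hcon j hj i hi hj'))) ⟨i, hi, hlt⟩
    simp [h] at this
  · by_contra! hcon
    have : ∑ i ∈ R, 0 < ∑ i ∈ R, w i := Finset.sum_lt_sum (fun j hj => hcon i hi j hj hgt)
      ⟨i, hi, hgt⟩
    simp [h] at this

open Classical in
/-- Vectors supported on drift-free rays, constant on ray cycles and with vanishing period sums are
integer combinations of shift vectors. -/
theorem mem_span_shiftVector (ha : Tame M a) (hL : TranslatesFrom H (a ^ L) s) (hL0 : 0 < L)
    (h0 : ∀ i, s i ≠ 0 → w i = 0) (h1 : ∀ i, w (a (i, M)).1 = w i)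
    (h2 : ∀ r, ∑ i with FixesRay a r i, w i = 0) :
    w ∈ Submodule.span ℤ (Set.range (ha.shiftVector s)) := by
  -- Subtracting a shift vector from a positive towards a negative entry lowers the `ℓ¹`-norm.
  induction hN : ∑ i, (w i).natAbs using Nat.strong_induction_on generalizing w with
  | _ N ih =>
  by_cases hw : w = 0
  · rw [hw]
    exact zero_mem _
  have hex : ∃ r, 0 < r ∧ ∃ i, w i ≠ 0 ∧ FixesRay a r i := by
    obtain ⟨i, hi⟩ := Function.ne_iff.1 hw
    refine ⟨L, hL0, i, hi, H, fun m hm => hL.apply hm ?_⟩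
    rw [not_imp_comm.1 (h0 i) hi, add_zero]
  obtain ⟨hr0, i₀, hi₀, hf₀⟩ := Nat.find_spec hex
  have hmin := fun k => Nat.find_min hex (m := k)
  set r := Nat.find hex with hr
  obtain ⟨i, hi, j, hj, hwi, hwj⟩ := exists_opposite_of_sum_eq_zero (h2 r) (i := i₀)
    (by simpa using hf₀) hi₀
  simp only [Finset.mem_filter, Finset.mem_univ, true_and] at hi hj
  -- Minimality of `r` over the support of `w` makes it the exact period of every ray of the support
  -- that it fixes, so `i` and `j` have equal periods.
  have hdvd : ∀ l, w l ≠ 0 → FixesRay a r l → ∀ k, FixesRay a k l ↔ r ∣ k := by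
    intro l hwl hl k
    constructor
    · intro hk
      by_contra hnd
      exact hmin _ (Nat.mod_lt k hr0)
        ⟨Nat.pos_of_ne_zero fun h => hnd (Nat.dvd_of_mod_eq_zero h), l, hwl, hl.mod hk⟩
    · rintro ⟨q, rfl⟩
      exact hl.mul q
  have hpair : ha.IsShiftPair s i j := by
    refine ⟨not_imp_comm.1 (h0 i) hwi.ne', not_imp_comm.1 (h0 j) hwj.ne, fun k => ?_, fun h => ?_⟩
    · rw [hdvd i hwi.ne' hi, hdvd j hwj.ne hj]
    · have := ha.sameCycle_eq h1 h
      omega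
  have hv : ha.shiftVector s (i, j) = cycleDiff ha.rayMap i j := if_pos hpair
  have hadm := isAdmissible_of_mem ha hL (fun l => ha.natAbs_shiftVector_le (s := s) (i, j) l)
    (ha.shiftVector_mem hL hL0 (i, j))
  have hlt : ∀ l, (w l - ha.shiftVector s (i, j) l).natAbs ≤ (w l).natAbs := by
    intro l
    rw [hv, cycleDiff]
    by_cases hli : ha.rayMap.SameCycle l i
    · have := ha.sameCycle_eq h1 hli
      rw [if_pos hli, if_neg fun h => hpair.2.2.2 (hli.symm.trans h)]
      omega
    · rw [if_neg hli]
      split_ifs with hlj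
      · have := ha.sameCycle_eq h1 hlj
        omega
      · simp
  have hlti : (w i - ha.shiftVector s (i, j) i).natAbs < (w i).natAbs := by
    rw [hv, cycleDiff, if_pos (Perm.SameCycle.refl _ _), if_neg hpair.2.2.2]
    omega
  have hmem := ih _ (by
      rw [← hN]
      exact Finset.sum_lt_sum (fun l _ => hlt l) ⟨i, Finset.mem_univ _, hlti⟩)
    (w := w - ha.shiftVector s (i, j))
    (fun l hl => by rw [Pi.sub_apply, h0 l hl, ha.shiftVector_eq_zero hL _ hl, sub_zero])
    (fun l => by rw [Pi.sub_apply, Pi.sub_apply, h1, hadm.cycle])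
    (fun r => by simp only [Pi.sub_apply, Finset.sum_sub_distrib, h2, hadm.fixed, sub_zero]) rfl
  rw [← sub_add_cancel w (ha.shiftVector s (i, j))]
  exact add_mem hmem (Submodule.subset_span ⟨_, rfl⟩)

theorem sum_smul_shiftVector_mem (ha : Tame M a) (hL : TranslatesFrom H (a ^ L) s) (hL0 : 0 < L)
    (f : Fin n × Fin n → ℤ) :
    ∑ q, f q • ha.shiftVector s q ∈ commutingTranslations a :=
  sum_mem fun q _ => zsmul_mem (ha.shiftVector_mem hL hL0 q) _

open Classical in
/-- The drift-free part of an admissible vector is a combination of shift vectors. -/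
theorem IsAdmissible.exists_zero_part (ha : Tame M a) (hL : TranslatesFrom H (a ^ L) s)
    (hL0 : 0 < L) (hw : IsAdmissible a M H B s w) :
    ∃ f : Fin n × Fin n → ℤ, ∑ q, f q • ha.shiftVector s q = fun i => if s i = 0 then w i else 0 := by
  have hs : ∀ i, s (a (i, M)).1 = s i :=
    ha.translation_ray_eq ⟨H, hL⟩ (Commute.refl a |>.pow_left L)
  have hfix : ∀ r, 0 < r → ∀ i, FixesRay a r i → s i = 0 := by
    rintro r hr0 i ⟨K, hK⟩
    by_contra hi
    exact pow_apply_ne_of_far hL hi (m := H + K) (by omega) hr0 (hK _ (by omega))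
  have hsum : ∀ r, 0 < r → ∑ i with FixesRay a r i, (if s i = 0 then w i else 0) = 0 := by
    intro r hr0
    refine Eq.trans ?_ (hw.fixed r)
    exact Finset.sum_congr rfl fun i hi => if_pos (hfix r hr0 i (by simpa using hi))
  rw [← Submodule.mem_span_range_iff_exists_fun]
  refine mem_span_shiftVector ha hL hL0 (fun i hi => if_neg hi) (fun i => ?_) (fun r => ?_)
  · simp only [hs, hw.cycle]
  · rcases Nat.eq_zero_or_pos r with rfl | hr0
    · have e : ∑ i with FixesRay a 0 i, (if s i = 0 then w i else 0) =
          ∑ i with FixesRay a L i, (if s i = 0 then w i else 0) := by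
        rw [← Finset.sum_filter, ← Finset.sum_filter, Finset.filter_filter, Finset.filter_filter]
        refine Finset.sum_congr (Finset.filter_congr fun i _ => ?_) fun _ _ => rfl
        constructor
        · rintro ⟨-, h⟩
          exact ⟨⟨H, fun m hm => hL.apply hm (by rw [h, add_zero])⟩, h⟩
        · rintro ⟨-, h⟩
          exact ⟨⟨0, fun m _ => by simp⟩, h⟩
      rw [e, hsum L hL0]
    · exact hsum r hr0

-- For the converse, `w` splits into its drift-free part, a combination of shift vectors, and its
-- part on rays with drift, which the orbit condition allows to be extended.
open Classical in
theorem mem_commutingTranslations_iff (ha : Tame M a) (hL : TranslatesFrom H (a ^ L) s)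
    (hL0 : 0 < L) (hB : ∀ i, (w i).natAbs ≤ B) :
    w ∈ commutingTranslations a ↔ IsAdmissible a M H B s w := by
  refine ⟨isAdmissible_of_mem ha hL hB, fun hw => ?_⟩
  obtain ⟨f, hf⟩ := hw.exists_zero_part ha hL hL0
  have h0 := sum_smul_shiftVector_mem ha hL hL0 f
  rw [hf] at h0
  have h1 : (fun i => if s i = 0 then 0 else w i) ∈ commutingTranslations a := by
    refine exists_commute_of_nonzero hL hL0 (B := B) (fun i => ?_) (fun i hi => if_pos hi)
      (fun z k hz1 hz2 hz3 hz4 => ?_)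
    · split_ifs
      · simp
      · exact hB i
    · have hsp : ∀ y : RaySpace n, s y.1 ≠ 0 →
          shiftPoint (fun i => if s i = 0 then 0 else w i) y = shiftPoint w y := by
        intro y hy
        simp only [shiftPoint, if_neg hy]
      rw [hsp _ hz1, hsp _ hz3]
      exact hw.orbit z k hz1 hz2 hz3 hz4
  have := add_mem h0 h1
  convert this using 1
  funext i
  simp only [Pi.add_apply]
  split_ifs <;> simp

/-- On rays with drift joined by an orbit, commuting translations are proportional to the drift. -/
theorem mul_eq_mul_of_orbit (hL : TranslatesFrom H (a ^ L) s) (hw : w ∈ commutingTranslations a)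
    {z : RaySpace n} {k : ℕ} (h1 : s z.1 ≠ 0) (h2 : H ≤ z.2) (h3 : s ((a ^ k) z).1 ≠ 0)
    (h4 : H ≤ ((a ^ k) z).2) : w z.1 * s ((a ^ k) z).1 = w ((a ^ k) z).1 * s z.1 := by
  obtain ⟨c, hc, hca⟩ := hw
  -- Powers of `a ^ L`, negative ones for an inward drift, move `y` arbitrarily far out along its
  -- own ray.
  have push : ∀ K : ℕ, ∀ y : RaySpace n, s y.1 ≠ 0 → H ≤ y.2 →
      ∃ (l : ℤ) (m : ℕ), K ≤ m ∧ (a ^ l) y = (y.1, m) := by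
    rintro K ⟨i, m⟩ hi hm
    dsimp only at hi hm
    rcases lt_or_gt_of_ne hi with hi | hi
    · have h0 : (K : ℤ) ≤ K * (- s i) := by nlinarith
      rw [mul_neg] at h0
      obtain ⟨u, hu⟩ : ∃ u : ℕ, (u : ℤ) = m - K * s i := ⟨(m - K * s i).toNat, by omega⟩
      have e1 := hL.pow_apply_of_neg hi.le K hm hu
      refine ⟨-((L * K : ℕ) : ℤ), u, by omega, ?_⟩
      rw [zpow_neg, Perm.inv_eq_iff_eq, zpow_natCast, pow_mul, e1]
    · have h0 : (K : ℤ) ≤ K * s i := by nlinarith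
      obtain ⟨u, hu⟩ : ∃ u : ℕ, (u : ℤ) = m + K * s i := ⟨(m + K * s i).toNat, by omega⟩
      have e1 := hL.pow_apply hi.le K hm hu
      refine ⟨((L * K : ℕ) : ℤ), u, by omega, ?_⟩
      rw [zpow_natCast, pow_mul, e1]
  set i := z.1
  set j := ((a ^ k) z).1
  obtain ⟨K₁, hg⟩ := hc.zpow (s i)
  obtain ⟨K₂, hh⟩ := hL.translatesBy.zpow (w i)
  obtain ⟨l₁, m₁, hm₁, e₁⟩ := push (K₁ + K₂) z h1 h2
  obtain ⟨l₂, m₂, hm₂, e₂⟩ := push (K₁ + K₂) ((a ^ k) z) h3 h4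
  have e₃ : (j, m₂) = (a ^ (l₂ + k - l₁)) (i, m₁) := by
    rw [← e₁, ← Perm.mul_apply, ← zpow_add, sub_add_cancel, zpow_add, Perm.mul_apply,
      zpow_natCast, ← e₂]
  -- Both sides translate ray `i` by `w i * s i`. As both permutations commute with `a`, they also
  -- agree at the point of the same orbit on ray `j`, where their translations can be compared.
  have c1 : (c ^ s i) (i, m₁) = ((a ^ L) ^ w i) (i, m₁) := by
    obtain ⟨a1, a2⟩ := hg i m₁ (by omega)
    obtain ⟨b1, b2⟩ := hh i m₁ (by omega)
    refine Prod.ext (a1.trans b1.symm) ?_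
    simp only [Pi.smul_apply, smul_eq_mul] at a2 b2
    rw [mul_comm] at b2
    omega
  have c2 : (c ^ s i) (j, m₂) = ((a ^ L) ^ w i) (j, m₂) := by
    rw [e₃, ← Perm.mul_apply, ← Perm.mul_apply, ((hca.zpow_left (s i)).zpow_right _).eq,
      (((Commute.refl a).pow_left L).zpow_left (w i) |>.zpow_right _).eq, Perm.mul_apply,
      Perm.mul_apply, c1]
  have a2 := (hg j m₂ (by omega)).2
  have b2 := (hh j m₂ (by omega)).2
  rw [c2, b2] at a2
  simp only [Pi.smul_apply, smul_eq_mul] at a2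
  linarith

theorem natAbs_le_sum (w : Fin n → ℤ) (i : Fin n) : (w i).natAbs ≤ ∑ i, (w i).natAbs :=
  Finset.single_le_sum (f := fun i => (w i).natAbs) (fun _ _ => Nat.zero_le _) (Finset.mem_univ i)

/-- Every commuting translation is bounded modulo twice the commuting translations. -/
theorem exists_bounded_add_two_smul (ha : Tame M a) (hL : TranslatesFrom H (a ^ L) s) (hL0 : 0 < L)
    (hβ : n * n ≤ B) (hs : ∀ i, 2 * (s i).natAbs ≤ B) (hw : w ∈ commutingTranslations a) :
    ∃ ρ ∈ commutingTranslations a, ∃ v ∈ commutingTranslations a,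
      (∀ i, (ρ i).natAbs ≤ B) ∧ w = ρ + (2 : ℤ) • v := by
  classical
  have hadm := isAdmissible_of_mem ha hL (natAbs_le_sum w) hw
  obtain ⟨f, hf⟩ := hadm.exists_zero_part ha hL hL0
  -- Subtracting `2 * j i * s i` leaves at most `2 * |s i|`. The ratio of `w` to the drift is
  -- constant along orbits, so `j` is too, and where it equals `q` the vector `j * s` is the
  -- translation of `(a ^ L) ^ q`.
  let j : Fin n → ℤ := fun i => ⌊(w i : ℚ) / (2 * s i)⌋
  have hj : (fun i => j i * s i) ∈ commutingTranslations a := by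
    refine exists_commute_of_nonzero hL hL0 (natAbs_le_sum _) (fun i hi => by simp [hi])
      (fun z k hz1 hz2 hz3 hz4 => ?_)
    have hprop := mul_eq_mul_of_orbit hL hw hz1 (by omega) hz3 (by omega)
    have hjj : j ((a ^ k) z).1 = j z.1 := by
      simp only [j]
      congr 1
      rw [div_eq_div_iff (by positivity) (by positivity)]
      have : ((w z.1 * s ((a ^ k) z).1 : ℤ) : ℚ) = (w ((a ^ k) z).1 * s z.1 : ℤ) := by
        rw [hprop]
      push_cast at this
      linear_combination -2 * this
    set q := j z.1
    have hcomm : Commute ((a ^ L) ^ q) a := ((Commute.refl a).pow_left L).zpow_left q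
    have hsh : ∀ y : RaySpace n, j y.1 = q → s y.1 ≠ 0 → H + ∑ i, (j i * s i).natAbs ≤ y.2 →
        ((a ^ L) ^ q) y = shiftPoint (fun i => j i * s i) y := by
      intro y hy1 hy2 hy3
      have hle := natAbs_le_sum (fun i => j i * s i) y.1
      rw [hcomm.apply_eq_shiftPoint hL (hL.translatesBy.zpow q)
        (B := ∑ i, (j i * s i).natAbs) ?_ hy2 hy3]
      · simp only [shiftPoint, Pi.smul_apply, smul_eq_mul, hy1]
      · rw [← hy1]
        exact hle
    rw [← hsh _ rfl hz1 hz2, ← hsh _ hjj hz3 hz4, ← Perm.mul_apply, ← Perm.mul_apply,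
      (hcomm.pow_right k).eq]
  -- Halving the coefficients leaves remainders `0` or `1`, hence entries at most the number `n * n`
  -- of pairs.
  have hv0 := sum_smul_shiftVector_mem ha hL hL0 fun q => f q / 2
  have hv := add_mem hv0 hj
  set v := ∑ q, (f q / 2) • ha.shiftVector s q + fun i => j i * s i with hvdef
  refine ⟨w - (2 : ℤ) • v, sub_mem hw (zsmul_mem hv 2), v, hv, fun i => ?_, by abel⟩
  by_cases hi : s i = 0
  · have e : (w - (2 : ℤ) • v) i = ∑ q, (f q % 2) * ha.shiftVector s q i := by
      have h1 := congrFun hf i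
      simp only [hi, if_true, Finset.sum_apply, Pi.smul_apply, smul_eq_mul] at h1
      simp only [hvdef, Pi.sub_apply, Pi.smul_apply, Pi.add_apply, Finset.sum_apply, smul_eq_mul,
        hi, mul_zero, add_zero]
      rw [← h1, Finset.mul_sum, ← Finset.sum_sub_distrib]
      refine Finset.sum_congr rfl fun q _ => ?_
      rw [Int.emod_def]
      ring
    rw [e]
    refine le_trans ?_ hβ
    refine (Int.natAbs_sum_le _ _).trans ?_
    refine (Finset.sum_le_card_nsmul _ _ 1 fun q _ => ?_).trans (by simp)
    rw [Int.natAbs_mul]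
    have h1 := ha.natAbs_shiftVector_le (s := s) q i
    have h2 : (f q % 2).natAbs ≤ 1 := by omega
    exact (Nat.mul_le_mul h2 h1).trans (by simp)
  · have e : (w - (2 : ℤ) • v) i = w i - j i * (2 * s i) := by
      simp only [hvdef, Pi.sub_apply, Pi.smul_apply, Pi.add_apply, Finset.sum_apply, smul_eq_mul,
        ha.shiftVector_eq_zero hL _ hi, mul_zero, Finset.sum_const_zero, zero_add]
      ring
    rw [e]
    refine le_trans ?_ (hs i)
    have hx : (2 * (s i : ℚ)) ≠ 0 := by positivity
    have h1 := Int.floor_le ((w i : ℚ) / (2 * s i))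
    have h2 := Int.lt_floor_add_one ((w i : ℚ) / (2 * s i))
    change (j i : ℚ) ≤ _ at h1
    change _ < (j i : ℚ) + 1 at h2
    have h3 : |(w i : ℚ) - j i * (2 * s i)| ≤ |2 * (s i : ℚ)| := by
      have : (w i : ℚ) - j i * (2 * s i) = ((w i : ℚ) / (2 * s i) - j i) * (2 * s i) := by
        field_simp
      rw [this, abs_mul]
      refine mul_le_of_le_one_left (abs_nonneg _) ?_
      rw [abs_le]
      constructor <;> linarith
    have h4 : |w i - j i * (2 * s i)| ≤ |2 * s i| := by exact_mod_cast h3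
    rw [Int.abs_eq_natAbs, Int.abs_eq_natAbs] at h4
    omega

end CommutingTranslations

/-! ### Parity of finitary permutations, and words with counted transpositions -/

section Parity

variable {α : Type*} [DecidableEq α]

/-- `f` is a product of a list of transpositions whose length has parity `e`. -/
def HasParity (f : Perm α) (e : ZMod 2) : Prop :=
  ∃ l : List (Perm α), (∀ g ∈ l, g.IsSwap) ∧ (l.length : ZMod 2) = e ∧ l.prod = f

variable {f g : Perm α} {e e' : ZMod 2}

theorem HasParity.one : HasParity (1 : Perm α) 0 := ⟨[], by simp⟩

theorem HasParity.of_isSwap (h : f.IsSwap) : HasParity f 1 := ⟨[f], by simp [h]⟩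

theorem HasParity.mul (hf : HasParity f e) (hg : HasParity g e') : HasParity (f * g) (e + e') := by
  obtain ⟨l, h1, rfl, rfl⟩ := hf
  obtain ⟨l', h1', rfl, rfl⟩ := hg
  refine ⟨l ++ l', fun x hx => ?_, by simp, by simp⟩
  rcases List.mem_append.1 hx with h | h
  · exact h1 x h
  · exact h1' x h

theorem HasParity.inv (hf : HasParity f e) : HasParity f⁻¹ e := by
  obtain ⟨l, h1, rfl, rfl⟩ := hf
  refine ⟨(l.map fun x => x⁻¹).reverse, fun x hx => ?_, by simp, (List.prod_inv_reverse l).symm⟩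
  simp only [List.mem_reverse, List.mem_map] at hx
  obtain ⟨y, hy, rfl⟩ := hx
  obtain ⟨u, v, huv, rfl⟩ := h1 y hy
  exact ⟨u, v, huv, by simp⟩

theorem IsSwap.conj {g : Perm α} (hg : g.IsSwap) (h : Perm α) : (h * g * h⁻¹).IsSwap := by
  obtain ⟨u, v, huv, rfl⟩ := hg
  exact ⟨h u, h v, h.injective.ne huv, by rw [Equiv.swap_apply_apply]⟩

theorem HasParity.conj (hf : HasParity f e) (h : Perm α) : HasParity (h * f * h⁻¹) e := by
  obtain ⟨l, h1, rfl, rfl⟩ := hf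
  refine ⟨l.map fun x => h * x * h⁻¹, fun x hx => ?_, by simp, ?_⟩
  · obtain ⟨y, hy, rfl⟩ := List.mem_map.1 hx
    exact IsSwap.conj (h1 y hy) h
  · exact (map_list_prod (MulAut.conj h) l).symm

theorem hasParity_ofSubtype {s : Finset α} (σ : Perm s) :
    ∃ k : ℕ, Perm.sign σ = (-1) ^ k ∧ HasParity (Perm.ofSubtype σ) k := by
  induction σ using Perm.swap_induction_on with
  | one => exact ⟨0, by simp, by simpa using HasParity.one⟩
  | swap_mul σ x y hxy ih =>
    obtain ⟨k, h1, h2⟩ := ih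
    refine ⟨k + 1, by rw [Perm.sign_mul, Perm.sign_swap hxy, h1, pow_succ'], ?_⟩
    rw [map_mul, Perm.ofSubtype_swap_eq, Nat.cast_add, Nat.cast_one, add_comm]
    exact HasParity.mul (.of_isSwap ⟨x, y, Subtype.coe_injective.ne hxy, rfl⟩) h2

/-- Realizing the product on a finite set reduces uniqueness of parity to the sign homomorphism. -/
theorem exists_ofSubtype_of_list (l : List (Perm α)) (hl : ∀ g ∈ l, g.IsSwap) :
    ∃ s₀ : Finset α, ∀ s : Finset α, s₀ ⊆ s → ∃ σ : Perm s, Perm.sign σ = (-1) ^ l.length ∧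
      Perm.ofSubtype σ = l.prod := by
  induction l with
  | nil => exact ⟨∅, fun s _ => ⟨1, by simp⟩⟩
  | cons g l ih =>
    obtain ⟨s₀, hs₀⟩ := ih fun g hg => hl g (List.mem_cons_of_mem _ hg)
    obtain ⟨u, v, huv, rfl⟩ := hl g List.mem_cons_self
    refine ⟨insert u (insert v s₀), fun s hs => ?_⟩
    obtain ⟨σ, h1, h2⟩ := hs₀ s fun x hx => hs (by simp [hx])
    have hu : u ∈ s := hs (by simp)
    have hv : v ∈ s := hs (by simp)
    refine ⟨Equiv.swap ⟨u, hu⟩ ⟨v, hv⟩ * σ, ?_, ?_⟩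
    · rw [Perm.sign_mul, Perm.sign_swap (by simpa using huv), h1, List.length_cons, pow_succ']
    · rw [map_mul, Perm.ofSubtype_swap_eq, h2, List.prod_cons]

theorem neg_one_pow_eq_one_iff_cast (k : ℕ) : ((-1 : ℤˣ) ^ k = 1) ↔ (k : ZMod 2) = 0 := by
  rw [ZMod.natCast_eq_zero_iff_even]
  constructor
  · intro h
    by_contra hk
    rw [Nat.not_even_iff_odd] at hk
    rw [hk.neg_one_pow] at h
    exact absurd h (by decide)
  · intro h
    exact h.neg_one_pow

theorem mem_finitaryAlternating_iff : f ∈ finitaryAlternating α ↔ HasParity f 0 := by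
  constructor
  · rintro ⟨s, σ, h1, rfl⟩
    obtain ⟨k, h2, h3⟩ := hasParity_ofSubtype σ
    rw [h1] at h2
    rwa [(neg_one_pow_eq_one_iff_cast k).1 h2.symm] at h3
  · rintro ⟨l, h1, h2, rfl⟩
    obtain ⟨s, hs⟩ := exists_ofSubtype_of_list l h1
    obtain ⟨σ, h3, h4⟩ := hs s subset_rfl
    exact ⟨s, σ, by rw [h3, neg_one_pow_eq_one_iff_cast, h2], h4.symm⟩

theorem not_hasParity_one_one : ¬ HasParity (1 : Perm α) 1 := by
  rintro ⟨l, h1, h2, h3⟩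
  obtain ⟨s, hs⟩ := exists_ofSubtype_of_list l h1
  obtain ⟨σ, h4, h5⟩ := hs s subset_rfl
  rw [h3] at h5
  have : σ = 1 := Perm.ofSubtype_injective (by rw [h5, map_one])
  rw [this, map_one] at h4
  rw [(neg_one_pow_eq_one_iff_cast _).1 h4.symm] at h2
  exact absurd h2 (by decide)

theorem zmod_two_cases (e : ZMod 2) : e = 0 ∨ e = 1 := by
  revert e
  decide

theorem HasParity.unique (hf : HasParity f e) (hf' : HasParity f e') : e = e' := by
  have h := hf.mul hf'.inv
  rw [mul_inv_cancel] at h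
  rcases zmod_two_cases (e + e') with h' | h'
  · clear hf hf' h
    revert e e'
    decide
  · rw [h'] at h
    exact absurd h not_hasParity_one_one

theorem exists_hasParity_of_finite (s : Finset α) (hs : ∀ x, f x ≠ x → x ∈ s) :
    ∃ e, HasParity f e := by
  have h1 : ∀ x, f x ∈ s ↔ x ∈ s := by
    intro x
    by_cases h : f x = x
    · rw [h]
    · exact iff_of_true (hs _ fun h' => h (f.injective h')) (hs x h)
  obtain ⟨k, -, h⟩ := hasParity_ofSubtype (f.subtypePerm h1 : Perm s)
  rw [Perm.ofSubtype_subtypePerm h1 hs] at h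
  exact ⟨k, h⟩

variable (α) in
/-- The even finitary permutations as a subgroup. -/
def evenSubgroup : Subgroup (Perm α) where
  carrier := {f | HasParity f 0}
  one_mem' := .one
  mul_mem' h h' := by simpa using HasParity.mul h h'
  inv_mem' h := HasParity.inv h

instance : (evenSubgroup α).Normal := ⟨fun _ hf h => HasParity.conj hf h⟩

/-- Products of transpositions and of elements of `G` and their inverses, with the parity of the
number of transpositions. -/
inductive GenParity (G : Set (Perm α)) : ZMod 2 → Perm α → Prop
  | one : GenParity G 0 1
  | swap {e : ZMod 2} {g h : Perm α} : g.IsSwap → GenParity G e h → GenParity G (e + 1) (g * h)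
  | gen {e : ZMod 2} {g h : Perm α} : g ∈ G → GenParity G e h → GenParity G e (g * h)
  | gen_inv {e : ZMod 2} {g h : Perm α} : g ∈ G → GenParity G e h → GenParity G e (g⁻¹ * h)

variable {G : Set (Perm α)} {h : Perm α}

theorem GenParity.mul (hf : GenParity G e f) (hg : GenParity G e' g) :
    GenParity G (e + e') (f * g) := by
  induction hf with
  | one => simpa using hg
  | swap h1 _ ih => rw [mul_assoc, add_right_comm]; exact .swap h1 ih
  | gen h1 _ ih => rw [mul_assoc]; exact .gen h1 ih
  | gen_inv h1 _ ih => rw [mul_assoc]; exact .gen_inv h1 ih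

/-- Transpositions move to the left past elements of `G` by conjugation, which keeps their parity.
-/
theorem GenParity.exists_factor (hf : GenParity G e h) :
    ∃ f u, HasParity f e ∧ u ∈ Subgroup.closure G ∧ h = f * u := by
  induction hf with
  | one => exact ⟨1, 1, .one, one_mem _, by simp⟩
  | swap h1 _ ih =>
    obtain ⟨f, u, h2, h3, rfl⟩ := ih
    exact ⟨_, u, add_comm (1 : ZMod 2) _ ▸ (HasParity.of_isSwap h1).mul h2, h3,
      (mul_assoc _ _ _).symm⟩
  | @gen _ g _ h1 _ ih =>
    obtain ⟨f, u, h2, h3, rfl⟩ := ih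
    exact ⟨_, g * u, h2.conj g, mul_mem (Subgroup.subset_closure h1) h3, by group⟩
  | @gen_inv _ g _ h1 _ ih =>
    obtain ⟨f, u, h2, h3, rfl⟩ := ih
    exact ⟨_, g⁻¹ * u, h2.conj g⁻¹, mul_mem (inv_mem (Subgroup.subset_closure h1)) h3, by group⟩

theorem HasParity.genParity (hf : HasParity f e) : GenParity G e f := by
  obtain ⟨l, h1, rfl, rfl⟩ := hf
  induction l with
  | nil => simpa using GenParity.one
  | cons g l ih =>
    simp only [List.length_cons, Nat.cast_add, Nat.cast_one, List.prod_cons]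
    exact .swap (h1 _ List.mem_cons_self) (ih fun g hg => h1 g (List.mem_cons_of_mem _ hg))

theorem genParity_of_mem_closure (h : f ∈ Subgroup.closure G) : GenParity G 0 f := by
  induction h using Subgroup.closure_induction_left with
  | one => exact .one
  | mul_left x hx y _ ih => exact .gen hx ih
  | inv_mul_cancel x hx y _ ih => exact .gen_inv hx ih

theorem mem_closure_finitaryAlternating_union_iff :
    h ∈ Subgroup.closure (finitaryAlternating α ∪ G) ↔ GenParity G 0 h := by
  constructor
  · intro hh
    induction hh using Subgroup.closure_induction_left with
    | one => exact .one
    | mul_left x hx y _ ih =>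
      rcases hx with hx | hx
      · simpa using (mem_finitaryAlternating_iff.1 hx).genParity.mul ih
      · exact .gen hx ih
    | inv_mul_cancel x hx y _ ih =>
      rcases hx with hx | hx
      · simpa using (mem_finitaryAlternating_iff.1 hx).inv.genParity.mul ih
      · exact .gen_inv hx ih
  · intro hh
    obtain ⟨f, u, h1, h2, rfl⟩ := hh.exists_factor
    exact mul_mem (Subgroup.subset_closure (Or.inl (mem_finitaryAlternating_iff.2 h1)))
      (Subgroup.closure_mono Set.subset_union_right h2)

theorem GenParity.inv (hf : GenParity G e f) : GenParity G e f⁻¹ := by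
  obtain ⟨f, u, h1, h2, rfl⟩ := hf.exists_factor
  rw [mul_inv_rev]
  simpa using (genParity_of_mem_closure (inv_mem h2)).mul (h1.inv.genParity (G := G))

end Parity

/-! ### Ray shifts modulo even permutations, and membership in `U_p` -/

section RayShifts

variable {n : ℕ}

/-- The generators `g_i ^ p`. -/
def shiftPowers (hn : 2 ≤ n) (p : ℕ) : Set (Perm (RaySpace n)) :=
  {g | ∃ (i : Fin n) (hi : ray₁ hn ≠ i), g = rayShift (ray₁ hn) i hi ^ p}

theorem mem_subgroupU_iff (hn : 2 ≤ n) (p : ℕ) (h : Perm (RaySpace n)) :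
    h ∈ subgroupU hn p ↔ GenParity (shiftPowers hn p) 0 h :=
  mem_closure_finitaryAlternating_union_iff

theorem rayShift_translatesBy {i j : Fin n} (hij : i ≠ j) :
    TranslatesBy (rayShift i j hij) (Pi.single i 1 - Pi.single j 1) := by
  refine ⟨1, fun l m hm => ?_⟩
  simp only [rayShift, Equiv.coe_fn_mk, Pi.sub_apply, Pi.single_apply]
  split_ifs <;> simp_all
  omega

/-- The two orders differ only in which of the initial points of rays `j` and `k` reaches ray `i`
first. -/
theorem rayShift_mul_rayShift {i j k : Fin n} (hij : i ≠ j) (hik : i ≠ k) (hjk : j ≠ k) :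
    rayShift i j hij * rayShift i k hik =
      rayShift i k hik * rayShift i j hij * Equiv.swap (j, 0) (k, 0) := by
  ext1 ⟨l, m⟩
  simp only [Perm.mul_apply, Equiv.swap_apply_def]
  simp only [rayShift, Equiv.coe_fn_mk]
  grind

theorem rayShift_tame {i j : Fin n} (hij : i ≠ j) : Tame 1 (rayShift i j hij) := by
  intro l k
  simp only [rayShift, Equiv.coe_fn_mk]
  grind

/-- The class of a transposition is central modulo even permutations. -/
theorem mk_swap_comm {α : Type*} [DecidableEq α] {τ : Perm α} (hτ : τ.IsSwap)
    (x : Perm α ⧸ evenSubgroup α) : x * (τ : Perm α ⧸ evenSubgroup α) = τ * x := by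
  obtain ⟨g, rfl⟩ := QuotientGroup.mk_surjective x
  rw [← QuotientGroup.mk_mul, ← QuotientGroup.mk_mul, eq_comm, QuotientGroup.eq]
  change HasParity _ 0
  have h1 := (HasParity.of_isSwap hτ).inv.conj g⁻¹
  have h2 := h1.mul (HasParity.of_isSwap hτ)
  convert h2 using 1
  group
  rfl

/-- If `x y = y x τ` with `τ` a central involution, then `y ^ 2` commutes with `x`. -/
theorem commute_sq_of_mul_eq {Q : Type*} [Group Q] {x y τ : Q} (hτ : ∀ z, z * τ = τ * z)
    (hτ2 : τ * τ = 1) (h : x * y = y * x * τ) : Commute x (y ^ 2) := by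
  have h' : τ * y = y * τ := (hτ y).symm
  calc x * y ^ 2 = x * y * y := by rw [pow_two, mul_assoc]
    _ = y * (x * (τ * y)) := by rw [h]; group
    _ = y * (x * y) * τ := by rw [h']; group
    _ = y * y * x * (τ * τ) := by rw [h]; group
    _ = y ^ 2 * x := by rw [hτ2, mul_one, pow_two]

theorem mk_swap_mul_self {α : Type*} [DecidableEq α] {τ : Perm α} (hτ : τ.IsSwap) :
    (τ : Perm α ⧸ evenSubgroup α) * τ = 1 := by
  obtain ⟨u, v, -, rfl⟩ := hτ
  rw [← QuotientGroup.mk_mul, Equiv.swap_mul_self, QuotientGroup.mk_one]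

theorem mk_rayShift_mul {i j k : Fin n} (hij : i ≠ j) (hik : i ≠ k) (hjk : j ≠ k) :
    (rayShift i j hij : Perm (RaySpace n) ⧸ evenSubgroup (RaySpace n)) * rayShift i k hik =
      rayShift i k hik * rayShift i j hij * (Equiv.swap (j, 0) (k, 0) : Perm (RaySpace n)) := by
  rw [← QuotientGroup.mk_mul, rayShift_mul_rayShift hij hik hjk]
  rfl

theorem isSwap_swap_initial {j k : Fin n} (hjk : j ≠ k) (m : ℕ) :
    (Equiv.swap (j, m) (k, m) : Perm (RaySpace n)).IsSwap := ⟨_, _, by simp [hjk], rfl⟩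

theorem commute_mk_rayShift_sq {i j k : Fin n} (hij : i ≠ j) (hik : i ≠ k) (hjk : j ≠ k) :
    Commute (rayShift i j hij : Perm (RaySpace n) ⧸ evenSubgroup (RaySpace n))
      ((rayShift i k hik : Perm (RaySpace n) ⧸ evenSubgroup (RaySpace n)) ^ 2) :=
  commute_sq_of_mul_eq (mk_swap_comm (isSwap_swap_initial hjk 0))
    (mk_swap_mul_self (isSwap_swap_initial hjk 0)) (mk_rayShift_mul hij hik hjk)

/-- For odd `p` and at least three rays, `U_p` contains an odd finitary permutation. -/
theorem exists_odd_mem_closure_shiftPowers (hn : 2 ≤ n) (h3 : 3 ≤ n) {p : ℕ} (hp : Odd p) :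
    ∃ u ∈ Subgroup.closure (shiftPowers hn p), HasParity u 1 := by
  obtain ⟨q, rfl⟩ := hp
  set j : Fin n := ray₂ hn
  set k : Fin n := ⟨2, h3⟩
  have hij : ray₁ hn ≠ j := ray₁_ne_ray₂ hn
  have hik : ray₁ hn ≠ k := by simp [ray₁, k]
  have hjk : j ≠ k := by simp [ray₂, j, k]
  set x := rayShift _ j hij
  set y := rayShift _ k hik
  have hτ := isSwap_swap_initial hjk 0
  -- Modulo even permutations the square of each shift commutes with the other shift, so the odd
  -- powers have the same commutator class as the shifts themselves, that of a transposition.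
  refine ⟨(y ^ (2 * q + 1))⁻¹ * (x ^ (2 * q + 1))⁻¹ * y ^ (2 * q + 1) * x ^ (2 * q + 1), ?_, ?_⟩
  · have hx : x ^ (2 * q + 1) ∈ Subgroup.closure (shiftPowers hn (2 * q + 1)) :=
      Subgroup.subset_closure ⟨j, hij, rfl⟩
    have hy : y ^ (2 * q + 1) ∈ Subgroup.closure (shiftPowers hn (2 * q + 1)) :=
      Subgroup.subset_closure ⟨k, hik, rfl⟩
    exact mul_mem (mul_mem (mul_mem (inv_mem hy) (inv_mem hx)) hy) hx
  · set X : Perm (RaySpace n) ⧸ evenSubgroup (RaySpace n) := QuotientGroup.mk x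
    set Y : Perm (RaySpace n) ⧸ evenSubgroup (RaySpace n) := QuotientGroup.mk y
    set τ : Perm (RaySpace n) := Equiv.swap (j, 0) (k, 0)
    set T : Perm (RaySpace n) ⧸ evenSubgroup (RaySpace n) := QuotientGroup.mk τ
    have c1 : Commute X (Y ^ (2 * q)) := by
      rw [pow_mul]
      exact (commute_mk_rayShift_sq hij hik hjk).pow_right q
    have c2 : Commute (X ^ (2 * q)) Y := by
      rw [pow_mul]
      exact ((commute_mk_rayShift_sq hik hij hjk.symm).pow_right q).symm
    have c3 : Commute (X ^ (2 * q)) (Y ^ (2 * q)) := c1.pow_left _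
    have key : X ^ (2 * q + 1) * Y ^ (2 * q + 1) = Y ^ (2 * q + 1) * X ^ (2 * q + 1) * T := by
      calc X ^ (2 * q + 1) * Y ^ (2 * q + 1) = X ^ (2 * q) * (X * Y ^ (2 * q)) * Y := by
            rw [pow_succ, pow_succ, mul_assoc, mul_assoc, mul_assoc]
        _ = X ^ (2 * q) * Y ^ (2 * q) * (X * Y) := by rw [c1.eq]; group
        _ = Y ^ (2 * q) * (X ^ (2 * q) * Y) * X * T := by
            rw [c3.eq, mk_rayShift_mul hij hik hjk]
            simp only [mul_assoc, X, Y, T, x, y, τ]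
        _ = Y ^ (2 * q + 1) * X ^ (2 * q + 1) * T := by
            rw [c2.eq, pow_succ, pow_succ]
            simp only [mul_assoc]
    have h1 : HasParity ((x ^ (2 * q + 1) * y ^ (2 * q + 1))⁻¹ *
        (y ^ (2 * q + 1) * x ^ (2 * q + 1) * τ)) 0 := by
      have := QuotientGroup.eq (s := evenSubgroup (RaySpace n)).1 key
      exact this
    have h2 := h1.mul (HasParity.of_isSwap hτ)
    rw [zero_add] at h2
    convert h2 using 1
    simp only [mul_inv_rev, mul_assoc, Equiv.swap_mul_self, mul_one, τ]

/-- Coordinate `i ≠ r` sees only the `i`-th vector, with coefficient `-p`. -/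
theorem zsmul_eq_zero_of_vec {ι : Type*} [Fintype ι] [DecidableEq ι] {p : ℕ} (hp : 1 ≤ p) {r : ι}
    {k : {i : ι // r ≠ i} → ℤ}
    (h : ∑ i, k i • (p • (Pi.single r 1 - Pi.single i.1 1 : ι → ℤ)) = 0) : k = 0 := by
  funext i
  have := congrFun h i.1
  simp only [Finset.sum_apply, Pi.smul_apply, Pi.sub_apply, Pi.single_apply, if_neg i.2.symm,
    Pi.zero_apply, zero_sub, Subtype.coe_inj] at this
  simp only [smul_eq_mul, nsmul_eq_mul, mul_neg, mul_ite, mul_one, mul_zero,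
    Finset.sum_neg_distrib, Finset.sum_ite_eq, Finset.mem_univ, if_true, neg_eq_zero,
    mul_eq_zero] at this
  rcases this with h | h
  · exact h
  · omega

theorem HasParity.translatesBy {e : ZMod 2} {f : Perm (RaySpace n)} (hf : HasParity f e) :
    TranslatesBy f 0 := by
  obtain ⟨l, hl, -, rfl⟩ := hf
  obtain ⟨s, hs⟩ := exists_ofSubtype_of_list l hl
  obtain ⟨σ, -, hσ⟩ := hs s subset_rfl
  refine ⟨∑ z ∈ s, z.2 + 1, fun i m hm => ?_⟩
  rw [← hσ, Perm.ofSubtype_apply_of_not_mem]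
  · simp
  · intro hmem
    have := Finset.single_le_sum (f := fun z : RaySpace n => z.2) (fun _ _ => Nat.zero_le _) hmem
    dsimp only at this
    omega

theorem TranslatesBy.exists_hasParity {f : Perm (RaySpace n)} (hf : TranslatesBy f 0) :
    ∃ e, HasParity f e := by
  obtain ⟨M, hf⟩ := hf.exists_fixes
  refine exists_hasParity_of_finite (Finset.univ ×ˢ Finset.range M) fun x hx => ?_
  by_contra h
  apply hx
  exact hf x.1 x.2 (by simpa using h)

/-- For even `p`, or two rays, odd finitary permutations are not in `U_p`. -/
theorem not_genParity_one_one (hn : 2 ≤ n) {p : ℕ} (hp : 1 ≤ p) (h : n = 2 ∨ Even p) :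
    ¬ GenParity (shiftPowers hn p) 1 1 := by
  intro hG
  obtain ⟨f, u, hf, hu, hfu⟩ := hG.exists_factor
  let ι := {i : Fin n // ray₁ hn ≠ i}
  let Q := Perm (RaySpace n) ⧸ evenSubgroup (RaySpace n)
  let x : ι → Q := fun i => ((rayShift (ray₁ hn) i.1 i.2 ^ p : Perm (RaySpace n)) : Q)
  -- For `n = 2` there is only one generator; for even `p` each generator is a power of the square
  -- of a shift.
  have hcomm : Pairwise fun i j : ι => Commute (x i) (x j) := by
    intro i j hij
    have hij' : i.1 ≠ j.1 := fun h => hij (Subtype.ext h)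
    rcases h with h | ⟨q, rfl⟩
    · exfalso
      apply hij'
      have h1 : i.1.1 ≠ 0 := fun h => i.2 (Fin.ext h.symm)
      have h2 : j.1.1 ≠ 0 := fun h => j.2 (Fin.ext h.symm)
      have := i.1.2
      have := j.1.2
      exact Fin.ext (by omega)
    · have := (commute_mk_rayShift_sq i.2 j.2 hij').pow_right q
      rw [← pow_mul] at this
      have := this.pow_left (q + q)
      rwa [two_mul] at this
  -- The class of `u` modulo even permutations is the image of an exponent vector that its
  -- translations determine. As `u` is finitary, the exponents vanish, so `u` is even as well as
  -- odd.
  let Φ : (ι → Multiplicative ℤ) →* Q := MonoidHom.noncommPiCoprod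
    (fun i => zpowersHom Q (x i)) fun i j hij y z => by
      simp only [zpowersHom_apply]
      exact (hcomm hij).zpow_zpow _ _
  have hΦ : ∀ i, Φ (Pi.mulSingle i (Multiplicative.ofAdd 1)) = x i := by
    intro i
    refine (MonoidHom.noncommPiCoprod_mulSingle _ _ _).trans ?_
    simp [zpowersHom_apply]
  let vec : (ι → Multiplicative ℤ) → (Fin n → ℤ) := fun k =>
    ∑ i : ι, (Multiplicative.toAdd (k i)) • (p • (Pi.single (ray₁ hn) 1 - Pi.single i.1 1))
  have hvec : ∀ k l, vec (k * l) = vec k + vec l := by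
    intro k l
    simp only [vec, Pi.mul_apply, toAdd_mul, add_smul, Finset.sum_add_distrib]
  have hvec' : ∀ k, vec k⁻¹ = - vec k := by
    intro k
    simp only [vec, Pi.inv_apply, toAdd_inv, neg_smul, Finset.sum_neg_distrib]
  have hsingle : ∀ i, vec (Pi.mulSingle i (Multiplicative.ofAdd 1)) =
      p • (Pi.single (ray₁ hn) 1 - Pi.single i.1 1) := by
    intro i
    simp only [vec]
    rw [Finset.sum_eq_single i]
    · simp
    · intro j _ hj
      simp [Pi.mulSingle_eq_of_ne hj]
    · simp
  have hgen : ∀ i : ι, (∃ k, x i = Φ k ∧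
      TranslatesBy (rayShift (ray₁ hn) i.1 i.2 ^ p) (vec k)) := fun i =>
    ⟨_, (hΦ i).symm, by rw [hsingle]; exact (rayShift_translatesBy i.2).pow p⟩
  have hall : ∃ k, (u : Q) = Φ k ∧ TranslatesBy u (vec k) := by
    clear hfu
    induction hu using Subgroup.closure_induction with
    | mem y hy =>
      obtain ⟨i, hi, rfl⟩ := hy
      exact hgen ⟨i, hi⟩
    | one => exact ⟨1, by simp, by simpa [vec] using TranslatesBy.one⟩
    | mul y z _ _ ih1 ih2 =>
      obtain ⟨k, h1, h2⟩ := ih1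
      obtain ⟨l, h3, h4⟩ := ih2
      exact ⟨k * l, by rw [map_mul, ← h1, ← h3]; rfl, by rw [hvec]; exact h2.mul h4⟩
    | inv y _ ih =>
      obtain ⟨k, h1, h2⟩ := ih
      exact ⟨k⁻¹, by rw [map_inv, ← h1]; rfl, by rw [hvec']; exact h2.inv⟩
  obtain ⟨k, h1, h2⟩ := hall
  have huf : u = f⁻¹ := (inv_eq_of_mul_eq_one_right hfu.symm).symm
  have hu1 : HasParity u 1 := huf ▸ hf.inv
  have hu0 : TranslatesBy u 0 := hu1.translatesBy
  have hk : (fun i => Multiplicative.toAdd (k i)) = 0 := zsmul_eq_zero_of_vec hp (h2.unique hu0)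
  have hk1 : k = 1 := by
    funext i
    exact congrFun hk i
  rw [hk1, map_one] at h1
  have : HasParity u 0 := (QuotientGroup.eq_one_iff u).1 h1
  exact absurd (this.unique hu1) (by decide)

theorem GenParity.exists_translatesBy {hn : 2 ≤ n} {p : ℕ} {e : ZMod 2} {h : Perm (RaySpace n)}
    (hh : GenParity (shiftPowers hn p) e h) : ∃ k : Fin n → ℤ, TranslatesBy h (p • k) := by
  induction hh with
  | one => exact ⟨0, by simpa using TranslatesBy.one⟩
  | swap h1 _ ih =>
    obtain ⟨k, hk⟩ := ih
    exact ⟨k, by simpa using (HasParity.of_isSwap h1).translatesBy.mul hk⟩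
  | gen h1 _ ih =>
    obtain ⟨k, hk⟩ := ih
    obtain ⟨i, hi, rfl⟩ := h1
    exact ⟨_, by rw [smul_add]; exact ((rayShift_translatesBy hi).pow p).mul hk⟩
  | gen_inv h1 _ ih =>
    obtain ⟨k, hk⟩ := ih
    obtain ⟨i, hi, rfl⟩ := h1
    refine ⟨-(Pi.single (ray₁ hn) 1 - Pi.single i 1) + k, ?_⟩
    rw [smul_add, smul_neg]
    exact ((rayShift_translatesBy hi).pow p).inv.mul hk

/-- The total translation is zero, so the vector is a combination of those of the generators;
dividing by a corresponding product leaves a finitary permutation, which has a parity. -/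
theorem exists_genParity_of_translatesBy (hn : 2 ≤ n) {p : ℕ} (hp : 1 ≤ p)
    {h : Perm (RaySpace n)} {k : Fin n → ℤ} (hh : TranslatesBy h (p • k)) :
    ∃ e, GenParity (shiftPowers hn p) e h := by
  classical
  let A : AddSubgroup (Fin n → ℤ) :=
    { carrier := {t | ∃ u ∈ Subgroup.closure (shiftPowers hn p), TranslatesBy u t}
      zero_mem' := ⟨1, one_mem _, .one⟩
      add_mem' := by
        rintro t t' ⟨u, h1, h2⟩ ⟨u', h1', h2'⟩
        exact ⟨u * u', mul_mem h1 h1', h2.mul h2'⟩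
      neg_mem' := by
        rintro t ⟨u, h1, h2⟩
        exact ⟨u⁻¹, inv_mem h1, h2.inv⟩ }
  have hA : ∀ i : Fin n, p • (Pi.single (ray₁ hn) 1 - Pi.single i 1 : Fin n → ℤ) ∈ A := by
    intro i
    by_cases hi : ray₁ hn = i
    · rw [hi, sub_self, smul_zero]
      exact zero_mem _
    · exact ⟨_, Subgroup.subset_closure ⟨i, hi, rfl⟩, (rayShift_translatesBy hi).pow p⟩
  have hsum : ∑ i, k i = 0 := by
    have := hh.sum_univ_eq_zero
    simp only [Pi.smul_apply, nsmul_eq_mul] at this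
    rw [← Finset.mul_sum] at this
    rcases mul_eq_zero.1 this with h | h
    · omega
    · exact h
  have hmem : ∑ i, (- k i) • (p • (Pi.single (ray₁ hn) 1 - Pi.single i 1 : Fin n → ℤ)) ∈ A :=
    sum_mem fun i _ => zsmul_mem (hA i) _
  have e : ∑ i, (- k i) • (p • (Pi.single (ray₁ hn) 1 - Pi.single i 1 : Fin n → ℤ)) = p • k := by
    simp only [smul_comm _ p, ← Finset.smul_sum]
    congr 1
    funext j
    have : ∀ x, (-k x • (Pi.single (ray₁ hn) 1 - Pi.single x 1 : Fin n → ℤ)) j =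
        k x * (-Pi.single (ray₁ hn) 1 : Fin n → ℤ) j + if j = x then k x else 0 := by
      intro x
      simp only [Pi.smul_apply, Pi.sub_apply, Pi.neg_apply, smul_eq_mul, Pi.single_apply]
      split_ifs <;> ring
    simp only [Finset.sum_apply, this, Finset.sum_add_distrib, ← Finset.sum_mul, hsum]
    simp
  rw [e] at hmem
  obtain ⟨u, h1, h2⟩ := hmem
  have h3 := hh.mul h2.inv
  rw [add_neg_cancel] at h3
  obtain ⟨e, he⟩ := h3.exists_hasParity
  refine ⟨e, ?_⟩
  have := (he.genParity (G := shiftPowers hn p)).mul (genParity_of_mem_closure h1)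
  simpa using this

/-- In the exceptional case an odd finitary element of `U_p` corrects an odd parity. -/
theorem mem_subgroupU_iff_exists_parity (hn : 2 ≤ n) {p : ℕ} {h : Perm (RaySpace n)} :
    h ∈ subgroupU hn p ↔
      ∃ e, GenParity (shiftPowers hn p) e h ∧ (e = 0 ∨ (3 ≤ n ∧ Odd p)) := by
  rw [mem_subgroupU_iff]
  refine ⟨fun hh => ⟨0, hh, Or.inl rfl⟩, ?_⟩
  rintro ⟨e, hh, he⟩
  rcases zmod_two_cases e with rfl | rfl
  · exact hh
  · rcases he with he | ⟨h3, hp⟩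
    · exact absurd he (by decide)
    · obtain ⟨u, h1, h2⟩ := exists_odd_mem_closure_shiftPowers hn h3 hp
      have h4 := (((h2.inv.genParity (G := shiftPowers hn p)).mul hh)).mul
        (GenParity.one (G := shiftPowers hn p))
      have h5 := (genParity_of_mem_closure h1).mul h4
      have h11 : (1 + 1 : ZMod 2) = 0 := by decide
      simpa [h11] using h5

theorem notMem_subgroupU_of_parity_one (hn : 2 ≤ n) {p : ℕ} (hp : 1 ≤ p)
    (hnp : ¬ (3 ≤ n ∧ Odd p)) {h : Perm (RaySpace n)} (hh : GenParity (shiftPowers hn p) 1 h) :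
    h ∉ subgroupU hn p := by
  rw [mem_subgroupU_iff]
  intro h0
  have := hh.mul h0.inv
  rw [mul_inv_cancel, add_zero] at this
  refine not_genParity_one_one hn hp ?_ this
  by_cases h3 : 3 ≤ n
  · exact Or.inr (Nat.not_odd_iff_even.1 fun h => hnp ⟨h3, h⟩)
  · exact Or.inl (by omega)

end RayShifts

/-! ### Transport to the split rays: block-constant translations -/

section Transport

theorem GenParity.permCongr {α β : Type*} [DecidableEq α] [DecidableEq β] (φ : α ≃ β)
    {G : Set (Perm α)} {e : ZMod 2} {h : Perm α} (hh : GenParity G e h) :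
    GenParity (φ.permCongrHom '' G) e (φ.permCongrHom h) := by
  induction hh with
  | one => rw [map_one]; exact .one
  | swap h1 _ ih =>
    rw [map_mul]
    refine .swap ?_ ih
    obtain ⟨u, v, huv, rfl⟩ := h1
    refine ⟨φ u, φ v, φ.injective.ne huv, ?_⟩
    ext x
    simp [Equiv.permCongrHom, Equiv.permCongr_apply, Equiv.swap_apply_def, Equiv.symm_apply_eq]
    split_ifs <;> simp
  | gen h1 _ ih => rw [map_mul]; exact .gen ⟨_, h1, rfl⟩ ih
  | gen_inv h1 _ ih => rw [map_mul, map_inv]; exact .gen_inv ⟨_, h1, rfl⟩ ih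

variable {n p : ℕ}

/-- The images in `Sym(X_{np})` of the generators `g_i ^ p`. -/
def blockShifts (hn : 2 ≤ n) (hp : 1 ≤ p) : Set (Perm (RaySpace (n * p))) :=
  (raySplit n p hp).permCongrHom '' shiftPowers hn p

theorem genParity_blockShifts_iff (hn : 2 ≤ n) (hp : 1 ≤ p) {e : ZMod 2}
    {h : Perm (RaySpace n)} :
    GenParity (blockShifts hn hp) e ((raySplit n p hp).permCongrHom h) ↔
      GenParity (shiftPowers hn p) e h := by
  refine ⟨fun hh => ?_, fun hh => hh.permCongr _⟩
  have hs : ∀ g : Perm (RaySpace n), (raySplit n p hp).symm.permCongrHom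
      ((raySplit n p hp).permCongrHom g) = g := by
    intro g
    ext1 x
    simp [Equiv.permCongrHom, Equiv.permCongr_apply]
  have := hh.permCongr (raySplit n p hp).symm
  rw [hs, blockShifts, ← Set.image_comp] at this
  have hid : (⇑(raySplit n p hp).symm.permCongrHom ∘ ⇑(raySplit n p hp).permCongrHom) = id :=
    funext hs
  rwa [hid, Set.image_id] at this

theorem mem_imageU_iff (hn : 2 ≤ n) (hp : 1 ≤ p) {y : Perm (RaySpace (n * p))} :
    y ∈ imageU hn hp ↔
      ∃ e, GenParity (blockShifts hn hp) e y ∧ (e = 0 ∨ (3 ≤ n ∧ Odd p)) := by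
  obtain ⟨h, rfl⟩ := (raySplit n p hp).permCongrHom.surjective y
  simp only [genParity_blockShifts_iff, ← mem_subgroupU_iff_exists_parity, imageU]
  exact Subgroup.mem_map_iff_mem (raySplit n p hp).permCongrHom.injective

theorem notMem_imageU_of_parity_one (hn : 2 ≤ n) (hp : 1 ≤ p)
    (hnp : ¬ (3 ≤ n ∧ Odd p)) {y : Perm (RaySpace (n * p))}
    (hy : GenParity (blockShifts hn hp) 1 y) : y ∉ imageU hn hp := by
  obtain ⟨h, rfl⟩ := (raySplit n p hp).permCongrHom.surjective y
  rw [genParity_blockShifts_iff] at hy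
  intro hmem
  exact notMem_subgroupU_of_parity_one hn hp hnp hy
    ((Subgroup.mem_map_iff_mem (raySplit n p hp).permCongrHom.injective).1 hmem)

/-- The block of `p` rays containing the ray `l`. -/
def rayBlock (l : Fin (n * p)) : Fin n := (finProdFinEquiv.symm l).1

theorem rayBlock_finProdFinEquiv (i : Fin n) (d : Fin p) :
    rayBlock (finProdFinEquiv (i, d)) = i :=
  congrArg Prod.fst (finProdFinEquiv.symm_apply_apply (i, d))

theorem raySplit_permCongr_apply (hp : 1 ≤ p) (h : Perm (RaySpace n)) (z : RaySpace (n * p)) :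
    (raySplit n p hp).permCongrHom h z = raySplit n p hp (h ((raySplit n p hp).symm z)) := rfl

/-- A move by `p * k i` keeps the residue modulo `p` and changes the quotient by `k i`, the same on
all `p` rays of the block. -/
theorem translatesBy_permCongr_iff (hp : 1 ≤ p) {h : Perm (RaySpace n)} {k : Fin n → ℤ} :
    TranslatesBy ((raySplit n p hp).permCongrHom h) (fun l => k (rayBlock l)) ↔
      TranslatesBy h (p • k) := by
  have hp' : (0 : ℤ) < p := by exact_mod_cast hp
  constructor
  · rintro ⟨M, hM⟩
    refine ⟨p * M, fun i m hm => ?_⟩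
    have hq : M ≤ m / p := (Nat.le_div_iff_mul_le hp).2 (by rwa [mul_comm])
    obtain ⟨u, hu⟩ : ∃ u : ℕ, (u : ℤ) = ((m / p : ℕ) : ℤ) + k i := by
      have := (hM (finProdFinEquiv (i, ⟨m % p, Nat.mod_lt _ hp⟩)) (m / p) hq).2
      simp only [rayBlock_finProdFinEquiv] at this
      exact ⟨_, this⟩
    have e := hM.apply (i := finProdFinEquiv (i, ⟨m % p, Nat.mod_lt _ hp⟩)) (k := u) hq (by
      rw [rayBlock_finProdFinEquiv]
      exact hu)
    have e0 : (finProdFinEquiv (i, ⟨m % p, Nat.mod_lt _ hp⟩), m / p) = raySplit n p hp (i, m) := rfl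
    rw [raySplit_permCongr_apply, e0, Equiv.symm_apply_apply, ← Equiv.eq_symm_apply] at e
    rw [e]
    simp only [raySplit, Equiv.coe_fn_symm_mk, Equiv.symm_apply_apply, Pi.smul_apply,
      nsmul_eq_mul, true_and]
    have := Nat.mod_add_div m p
    push_cast at hu ⊢
    rw [hu]
    have h2 : (m : ℤ) = m % p + p * (m / p) := by exact_mod_cast this.symm
    conv_rhs => rw [h2]
    ring
  · rintro ⟨M, hM⟩
    refine ⟨M, fun l q hq => ?_⟩
    obtain ⟨⟨i, d⟩, rfl⟩ := finProdFinEquiv.surjective l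
    have hle : M ≤ d + p * q := hq.trans ((Nat.le_mul_of_pos_left q hp).trans (by omega))
    obtain ⟨h1, h2⟩ := hM i (d + p * q) hle
    rw [raySplit_permCongr_apply]
    have e0 : (raySplit n p hp).symm (finProdFinEquiv (i, d), q) = (i, d + p * q) := by
      rw [Equiv.symm_apply_eq]
      simp only [raySplit, Equiv.coe_fn_mk, Nat.add_mul_mod_self_left, Nat.mod_eq_of_lt d.2,
        Nat.add_mul_div_left _ _ hp, Nat.div_eq_of_lt d.2, zero_add]
    rw [e0]
    simp only [rayBlock_finProdFinEquiv]
    simp only [Pi.smul_apply, nsmul_eq_mul] at h2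
    set y := h (i, d + p * q) with hy
    have hd : (d : ℕ) < p := d.2
    have hy2 : (y.2 : ℤ) = d + p * (q + k i) := by
      rw [h2]
      push_cast
      ring
    have hmod : y.2 % p = d := by
      have : ((y.2 % p : ℕ) : ℤ) = d := by
        push_cast
        rw [hy2, Int.add_mul_emod_self_left]
        exact Int.emod_eq_of_lt (by omega) (by exact_mod_cast hd)
      exact_mod_cast this
    have hdiv : ((y.2 / p : ℕ) : ℤ) = q + k i := by
      push_cast
      rw [hy2, Int.add_mul_ediv_left _ _ hp'.ne', Int.ediv_eq_zero_of_lt (by omega)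
        (by exact_mod_cast hd), zero_add]
    constructor
    · simp only [raySplit, Equiv.coe_fn_mk, hmod, h1]
    · simpa only [raySplit, Equiv.coe_fn_mk] using hdiv

theorem GenParity.exists_block_translatesBy {hn : 2 ≤ n} {hp : 1 ≤ p} {e : ZMod 2}
    {y : Perm (RaySpace (n * p))} (hy : GenParity (blockShifts hn hp) e y) :
    ∃ k : Fin n → ℤ, TranslatesBy y fun l => k (rayBlock l) := by
  obtain ⟨h, rfl⟩ := (raySplit n p hp).permCongrHom.surjective y
  rw [genParity_blockShifts_iff] at hy
  obtain ⟨k, hk⟩ := hy.exists_translatesBy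
  exact ⟨k, (translatesBy_permCongr_iff hp).2 hk⟩

theorem exists_genParity_of_block_translatesBy (hn : 2 ≤ n) (hp : 1 ≤ p)
    {y : Perm (RaySpace (n * p))} {k : Fin n → ℤ} (hy : TranslatesBy y fun l => k (rayBlock l)) :
    ∃ e, GenParity (blockShifts hn hp) e y := by
  obtain ⟨h, rfl⟩ := (raySplit n p hp).permCongrHom.surjective y
  simp only [genParity_blockShifts_iff]
  exact exists_genParity_of_translatesBy hn hp ((translatesBy_permCongr_iff hp).1 hy)

end Transport

/-! ### Odd finitary permutations commuting with `a` -/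

section FinitaryCentralizer

variable {α : Type*} [DecidableEq α]

theorem HasParity.pow {f : Perm α} {e : ZMod 2} (hf : HasParity f e) (k : ℕ) :
    HasParity (f ^ k) (k * e) := by
  induction k with
  | zero => simpa using HasParity.one
  | succ k ih =>
    rw [pow_succ, Nat.cast_succ, add_mul, one_mul]
    exact ih.mul hf

theorem Commute.apply_apply {α : Type*} {a f : Perm α} (h : Commute f a) (z : α) : f (a z) = a (f z) := by
  rw [← Perm.mul_apply, h.eq, Perm.mul_apply]

theorem hasParity_formPerm (x : α) (l : List α) (h : (x :: l).Nodup) :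
    HasParity (List.formPerm (x :: l)) l.length := by
  induction l generalizing x with
  | nil => simpa using HasParity.one
  | cons y l ih =>
    rw [List.formPerm_cons_cons, List.length_cons, Nat.cast_add, Nat.cast_one, add_comm]
    refine HasParity.mul (.of_isSwap ⟨x, y, ?_, rfl⟩) (ih y (List.nodup_cons.1 h).2)
    rintro rfl
    simp at h

theorem pow_apply_injOn_minimalPeriod {α : Type*} (a : Perm α) (z : α) {k l : ℕ}
    (hk : k < Function.minimalPeriod a z) (hl : l < Function.minimalPeriod a z)
    (h : (a ^ k) z = (a ^ l) z) : k = l := by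
  rw [Perm.coe_pow, Perm.coe_pow] at h
  exact Function.iterate_injOn_Iio_minimalPeriod hk hl h

theorem pow_minimalPeriod_apply {α : Type*} (a : Perm α) (z : α) :
    (a ^ Function.minimalPeriod a z) z = z := by
  rw [Perm.coe_pow]
  exact Function.isPeriodicPt_minimalPeriod a z

/-- The restriction of `a` to a finite orbit of even length is odd and commutes with `a`. -/
theorem exists_odd_commute_of_even_period (a : Perm α) (z : α)
    (h0 : 0 < Function.minimalPeriod a z) (h : Even (Function.minimalPeriod a z)) :
    ∃ f, Commute f a ∧ HasParity f 1 := by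
  set r := Function.minimalPeriod a z with hr
  -- The cycle along this list agrees with `a` on the orbit and is a product of `r - 1`
  -- transpositions.
  let l : List α := (List.range r).map fun k => (a ^ k) z
  have hlen : l.length = r := by simp [l]
  have hget : ∀ k (hk : k < l.length), l[k] = (a ^ k) z := fun k hk => by simp [l]
  have hnd : l.Nodup := by
    refine List.Nodup.map_on ?_ List.nodup_range
    intro x hx y hy hxy
    exact pow_apply_injOn_minimalPeriod a z (List.mem_range.1 hx) (List.mem_range.1 hy) hxy
  have hrz : (a ^ r) z = z := pow_minimalPeriod_apply a z
  have hmem : ∀ k : ℕ, (a ^ k) z ∈ l := by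
    intro k
    refine List.mem_map.2 ⟨k % r, List.mem_range.2 (Nat.mod_lt _ h0), ?_⟩
    conv_rhs => rw [← Nat.mod_add_div k r, pow_add, Perm.mul_apply, pow_mul]
    congr 1
    exact (Function.IsFixedPt.perm_pow hrz _).symm
  have hf : ∀ x ∈ l, l.formPerm x = a x := by
    intro x hx
    obtain ⟨k, hk, rfl⟩ := List.getElem_of_mem hx
    rw [List.formPerm_apply_getElem l hnd k hk, hget, hget, ← Perm.mul_apply, ← pow_succ', hlen]
    rw [hlen] at hk
    rcases Nat.lt_or_ge (k + 1) r with h1 | h1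
    · rw [Nat.mod_eq_of_lt h1]
    · have : k + 1 = r := by omega
      rw [this, Nat.mod_self, hrz]
      rfl
  have hal : ∀ x, a x ∈ l ↔ x ∈ l := by
    intro x
    constructor
    · intro hx
      obtain ⟨k, -, hk⟩ := List.mem_map.1 hx
      obtain ⟨r', hr'⟩ : ∃ r', r = r' + 1 := ⟨r - 1, by omega⟩
      have : x = (a ^ (k + r')) z := by
        apply a.injective
        rw [← hk, ← Perm.mul_apply, ← pow_succ', add_assoc, ← hr', pow_add, Perm.mul_apply, hrz]
      rw [this]
      exact hmem _
    · intro hx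
      obtain ⟨k, -, rfl⟩ := List.mem_map.1 hx
      rw [← Perm.mul_apply, ← pow_succ']
      exact hmem _
  refine ⟨l.formPerm, ?_, ?_⟩
  · ext1 x
    rw [Perm.mul_apply, Perm.mul_apply]
    by_cases hx : x ∈ l
    · rw [hf x hx, hf _ ((hal x).2 hx)]
    · rw [List.formPerm_apply_of_notMem hx, List.formPerm_apply_of_notMem fun h => hx ((hal x).1 h)]
  · obtain ⟨y, l', hl'⟩ : ∃ y l', l = y :: l' :=
      List.exists_cons_of_ne_nil fun h => by simp [h] at hlen; omega
    rw [hl'] at hnd hlen ⊢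
    have := hasParity_formPerm y l' hnd
    convert this
    obtain ⟨q, hq⟩ := h
    rw [List.length_cons] at hlen
    have : ((l'.length + 1 : ℕ) : ZMod 2) = 0 := by
      rw [hlen, ZMod.natCast_eq_zero_iff_even]
      exact ⟨q, hq⟩
    push_cast at this
    generalize (l'.length : ZMod 2) = e at this
    revert e
    decide

theorem commute_swap_swap {x y u v : α} (h1 : x ≠ u) (h2 : x ≠ v) (h3 : y ≠ u) (h4 : y ≠ v) :
    Commute (Equiv.swap x y) (Equiv.swap u v) := by
  ext1 w
  simp only [Perm.mul_apply, Equiv.swap_apply_def]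
  grind

/-- The exchange of two finite orbits of equal odd length is odd and commutes with `a`. -/
theorem exists_odd_commute_of_same_period (a : Perm α) (z z' : α)
    (h : Odd (Function.minimalPeriod a z)) (h' : ∀ k : ℕ, (a ^ k) z = z ↔ (a ^ k) z' = z')
    (hne : ∀ k : ℕ, (a ^ k) z ≠ z') :
    ∃ f, Commute f a ∧ HasParity f 1 := by
  set r := Function.minimalPeriod a z with hr
  have hrz : (a ^ r) z = z := pow_minimalPeriod_apply a z
  have hrz' : (a ^ r) z' = z' := (h' r).1 hrz
  obtain ⟨q, hq⟩ : ∃ q, r = q + 1 := ⟨r - 1, by have := h.pos; omega⟩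
  let s : ℕ → Perm α := fun k => Equiv.swap ((a ^ k) z) ((a ^ k) z')
  have hne' : ∀ k l : ℕ, (a ^ k) z ≠ (a ^ l) z' := by
    intro k l e
    apply hne (l * q + k)
    rw [pow_add, Perm.mul_apply, e, ← Perm.mul_apply, ← pow_add,
      show l * q + l = r * l by rw [hq]; ring, pow_mul]
    exact Function.IsFixedPt.perm_pow hrz' l
  -- Conjugation by `a` permutes the `r` factors cyclically; as the first commutes with the others,
  -- their product is unchanged.
  have hconj : ∀ k, a * s k * a⁻¹ = s (k + 1) := by
    intro k
    simp only [s]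
    rw [← Equiv.swap_apply_apply, pow_succ', Perm.mul_apply, Perm.mul_apply]
  let P : Perm α := ((List.range q).map fun k => s (k + 1)).prod
  have hf1 : ((List.range r).map s).prod = s 0 * P := by
    rw [hq, List.range_succ_eq_map, List.map_cons, List.prod_cons, List.map_map]
    rfl
  have hf2 : a * ((List.range r).map s).prod * a⁻¹ = P * s 0 := by
    have e : a * ((List.range r).map s).prod * a⁻¹ = MulAut.conj a ((List.range r).map s).prod := rfl
    rw [e, map_list_prod, List.map_map, hq, List.range_succ, List.map_append, List.prod_append]
    have e1 : (⇑(MulAut.conj a) ∘ s) = fun k => s (k + 1) := by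
      funext k
      exact hconj k
    rw [e1]
    have e2 : s (q + 1) = s 0 := by
      simp only [s, ← hq, hrz, hrz', pow_zero, Perm.one_apply]
    simp [P, e2]
  have hP : Commute (s 0) P := by
    refine Commute.list_prod_right _ _ fun x hx => ?_
    obtain ⟨k, hk, rfl⟩ := List.mem_map.1 hx
    have hk' := List.mem_range.1 hk
    simp only [s, pow_zero, Perm.one_apply]
    refine commute_swap_swap ?_ (hne' 0 _) (hne' _ 0).symm ?_
    · intro e
      have := pow_apply_injOn_minimalPeriod a z (k := 0) (l := k + 1) (by omega) (by omega)
        (by simpa using e)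
      omega
    · intro e
      have := pow_apply_injOn_minimalPeriod a z (k := 0) (l := k + 1) (by omega) (by omega)
        (by simpa using ((h' (k + 1)).2 e.symm).symm)
      omega
  refine ⟨((List.range r).map s).prod, ?_, (List.range r).map s, ?_, ?_, rfl⟩
  · have : a * ((List.range r).map s).prod * a⁻¹ = ((List.range r).map s).prod := by
      rw [hf2, hf1, hP.eq]
    exact (mul_inv_eq_iff_eq_mul.1 this).symm
  · intro g hg
    obtain ⟨k, -, rfl⟩ := List.mem_map.1 hg
    exact ⟨_, _, hne' k k, rfl⟩
  · rw [List.length_map, List.length_range]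
    exact (ZMod.natCast_eq_one_iff_odd).2 h

variable {n : ℕ} {a : Perm (RaySpace n)} {M L H : ℕ} {s : Fin n → ℤ}

/-- `a` has no drift-free rays, and its finite orbits have pairwise distinct odd lengths. -/
def HasRigidOrbits {n : ℕ} (a : Perm (RaySpace n)) (H : ℕ) (s : Fin n → ℤ) : Prop :=
  (∀ i, s i ≠ 0) ∧ ∀ z z' : RaySpace n, z.2 < H → z'.2 < H →
    (∃ k : ℕ, H ≤ ((a ^ k) z).2) ∨ (∃ k : ℕ, H ≤ ((a ^ k) z').2) ∨
      ((∃ k : ℕ, Odd k ∧ (a ^ k) z = z) ∧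
        ((∃ k : ℕ, (a ^ k) z = z') ∨ ∃ k : ℕ, ¬ ((a ^ k) z = z ↔ (a ^ k) z' = z')))

/-- A finitary `f` commuting with `a` fixes infinite orbits pointwise, since they leave its support,
and preserves each finite orbit, since the lengths differ. There it acts as a power of `a`, of odd
order. So an odd power of `f` is the identity, and `f` is not odd. -/
theorem HasRigidOrbits.not_hasParity_one (hL : TranslatesFrom H (a ^ L) s)
    (hr : HasRigidOrbits a H s) {f : Perm (RaySpace n)} (hf : Commute f a) :
    ¬ HasParity f 1 := by
  intro hpar
  obtain ⟨K, hK⟩ := hpar.translatesBy.exists_fixes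
  have hfk : ∀ (k : ℕ) z, f ((a ^ k) z) = (a ^ k) (f z) := fun k z =>
    (hf.pow_right k).apply_apply z
  have hinf : ∀ z, (∃ k : ℕ, H ≤ ((a ^ k) z).2) → f z = z := by
    rintro z ⟨k, hk⟩
    have hz : ∀ l : ℕ, 0 < l → (a ^ l) z ≠ z :=
      pow_apply_ne_of_zpow k fun l hl => by
        rw [zpow_natCast]
        exact pow_apply_ne_of_far hL (hr.1 _) hk hl
    obtain ⟨k₀, hk₀⟩ := eventually_height_ge hz K
    apply (a ^ k₀).injective
    rw [← hfk]
    exact hK _ _ (hk₀ k₀ le_rfl)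
  have hodd : ∀ z, ∃ k : ℕ, Odd k ∧ (f ^ k) z = z := by
    intro z
    by_cases h1 : ∃ k : ℕ, H ≤ ((a ^ k) z).2
    · exact ⟨1, odd_one, by simpa using hinf z h1⟩
    by_cases h2 : ∃ k : ℕ, H ≤ ((a ^ k) (f z)).2
    · have := f.injective (hinf (f z) h2)
      rw [this] at h2
      exact absurd h2 h1
    have hz : z.2 < H := not_le.1 fun h => h1 ⟨0, by simpa using h⟩
    have hfz : (f z).2 < H := not_le.1 fun h => h2 ⟨0, by simpa using h⟩
    rcases hr.2 z (f z) hz hfz with h | h | ⟨⟨k, hk, hkz⟩, ⟨l, hl⟩ | ⟨l, hl⟩⟩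
    · exact absurd h h1
    · exact absurd h h2
    · refine ⟨k, hk, ?_⟩
      have hpow : ∀ q : ℕ, (f ^ q) z = (a ^ (l * q)) z := by
        intro q
        induction q with
        | zero => simp
        | succ q ih =>
          rw [pow_succ', Perm.mul_apply, ih, hfk, ← hl, ← Perm.mul_apply, ← pow_add]
          rfl
      rw [hpow, mul_comm, pow_mul]
      exact Function.IsFixedPt.perm_pow hkz l
    · refine absurd ?_ hl
      rw [← hfk, f.injective.eq_iff]
  choose k hk1 hk2 using hodd
  let S : Finset (RaySpace n) := Finset.univ ×ˢ Finset.range K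
  have hprod : Odd (∏ z ∈ S, k z) :=
    Finset.prod_induction k Odd (fun _ _ h1 h2 => h1.mul h2) odd_one fun z _ => hk1 z
  have hone : f ^ (∏ z ∈ S, k z) = 1 := by
    ext1 z
    rw [Perm.one_apply]
    by_cases hz : z ∈ S
    · obtain ⟨q, hq⟩ := Finset.dvd_prod_of_mem k hz
      rw [hq, pow_mul]
      exact Function.IsFixedPt.perm_pow (hk2 z) q
    · exact Function.IsFixedPt.perm_pow (hK z.1 z.2 (by simpa [S] using hz)) _
  have := hpar.pow (∏ z ∈ S, k z)
  rw [hone, (ZMod.natCast_eq_one_iff_odd).2 hprod, one_mul] at this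
  exact not_hasParity_one_one this

/-- Any failure gives an odd commuting permutation: an even orbit by its rotation, two orbits of
equal odd length by their exchange. A drift-free ray has such a pair through two neighbouring far
points. -/
theorem hasRigidOrbits_of_forall (ha : Tame M a) (hL : TranslatesFrom H (a ^ L) s) (hL0 : 0 < L)
    (h : ∀ f, Commute f a → ¬ HasParity f 1) : HasRigidOrbits a H s := by
  have hodd : ∀ z, (∃ k : ℕ, 0 < k ∧ (a ^ k) z = z) → Odd (Function.minimalPeriod a z) := by
    rintro z ⟨k, hk, hkz⟩
    by_contra hcon
    obtain ⟨f, h1, h2⟩ := exists_odd_commute_of_even_period a z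
      (Function.IsPeriodicPt.minimalPeriod_pos hk (by
        rw [Function.IsPeriodicPt, Function.IsFixedPt, ← Perm.coe_pow]; exact hkz))
      (Nat.not_odd_iff_even.1 hcon)
    exact h f h1 h2
  refine ⟨fun i hi => ?_, fun z z' _ _ => ?_⟩
  · set K := H + L * M
    have hfix : ∀ m, K ≤ m → (a ^ L) (i, m) = (i, m) := fun m hm =>
      hL.apply (by omega) (by rw [hi, add_zero])
    have hmod : ∀ k : ℕ, ∃ k' < L, ∀ z, (a ^ L) z = z → (a ^ k) z = (a ^ k') z := fun k => by
      simpa using exists_zpow_apply_eq_pow a hL0 k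
    have hKm : ∀ k' < L, k' * M ≤ K := fun k' hk' => by
      have := Nat.mul_le_mul_right M hk'.le
      omega
    obtain ⟨f, h1, h2⟩ := exists_odd_commute_of_same_period a (i, K) (i, K + 1)
      (hodd _ ⟨L, hL0, hfix K le_rfl⟩) (fun k => by
        obtain ⟨k', hk', e⟩ := hmod k
        rw [e _ (hfix K le_rfl), e _ (hfix (K + 1) (by omega)), ← ha.fixesRay_iff (hKm k' hk'),
          ← ha.fixesRay_iff ((hKm k' hk').trans (by omega))]) (fun k hk => by
        obtain ⟨k', hk', e⟩ := hmod k
        rw [e _ (hfix K le_rfl)] at hk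
        have h1 := (ha.pow_rayMap k' i (hKm k' hk')).1
        rw [hk] at h1
        have := (ha.fixesRay_iff (hKm k' hk')).1 (ha.fixesRay_of_ray_eq hL hL0 hi h1.symm)
        rw [hk] at this
        have := congrArg Prod.snd this
        dsimp only at this
        omega)
    exact h f h1 h2
  · by_cases h1 : ∃ k : ℕ, H ≤ ((a ^ k) z).2
    · exact Or.inl h1
    by_cases h2 : ∃ k : ℕ, H ≤ ((a ^ k) z').2
    · exact Or.inr (Or.inl h2)
    have hper : ∃ k : ℕ, 0 < k ∧ (a ^ k) z = z := by
      by_contra! hcon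
      obtain ⟨k, hk⟩ := eventually_height_ge hcon H
      exact h1 ⟨k, hk k le_rfl⟩
    have ho := hodd z hper
    refine Or.inr (Or.inr ⟨⟨_, ho, pow_minimalPeriod_apply a z⟩, ?_⟩)
    by_contra! hcon
    obtain ⟨f, h3, h4⟩ := exists_odd_commute_of_same_period a z z' ho
      (fun k => by have := hcon.2 k; tauto) hcon.1
    exact h f h3 h4

end FinitaryCentralizer

/-! ### Linear forms that detect nonmembership -/

section Duality

/-- A vector outside a subgroup of `ℤ ^ ι` is detected by a linear form modulo some `d`. -/
theorem exists_dual_certificate {ι : Type*} [Fintype ι] [DecidableEq ι]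
    (A : AddSubgroup (ι → ℤ)) {v : ι → ℤ} (hv : v ∉ A) :
    ∃ d : ℕ, 0 < d ∧ ∃ lam : ι → ℕ, (∀ i, lam i < d) ∧
      (∀ w ∈ A, (d : ℤ) ∣ ∑ i, lam i * w i) ∧ ¬ (d : ℤ) ∣ ∑ i, lam i * v i := by
  have hne : (QuotientAddGroup.mk v : (ι → ℤ) ⧸ A) ≠ 0 := by
    rwa [Ne, QuotientAddGroup.eq_zero_iff]
  -- Characters to `ℚ/ℤ` separate points of the quotient; lifting the values on unit vectors to `ℚ`
  -- and clearing denominators gives an integral form modulo `d`.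
  obtain ⟨c, hc⟩ := CharacterModule.exists_character_apply_ne_zero_of_ne_zero hne
  let f : (ι → ℤ) →+ AddCircle (1 : ℚ) :=
    AddMonoidHom.comp (c : (ι → ℤ) ⧸ A →+ AddCircle (1 : ℚ)) (QuotientAddGroup.mk' A)
  have hfA : ∀ w ∈ A, f w = 0 := by
    intro w hw
    have : (QuotientAddGroup.mk w : (ι → ℤ) ⧸ A) = 0 := (QuotientAddGroup.eq_zero_iff w).2 hw
    change c (QuotientAddGroup.mk w) = 0
    rw [this, map_zero]
  have hfv : f v ≠ 0 := hc
  choose q hq using fun i => QuotientAddGroup.mk_surjective (f (Pi.single i 1))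
  have hf : ∀ w : ι → ℤ, f w = ((∑ i, w i * q i : ℚ) : AddCircle (1 : ℚ)) := by
    intro w
    have e : w = ∑ i, w i • (Pi.single i 1 : ι → ℤ) := by
      funext j
      simp [Finset.sum_apply, Pi.single_apply]
    conv_lhs => rw [e]
    rw [map_sum]
    have : ((∑ i, w i * q i : ℚ) : AddCircle (1 : ℚ)) =
        ∑ i, ((w i * q i : ℚ) : AddCircle (1 : ℚ)) :=
      map_sum (QuotientAddGroup.mk' (AddSubgroup.zmultiples (1 : ℚ))) _ _
    rw [this]
    refine Finset.sum_congr rfl fun i _ => ?_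
    rw [map_zsmul, ← hq i, ← zsmul_eq_mul]
    rfl
  set d : ℕ := ∏ i, (q i).den with hd
  have hd0 : 0 < d := Finset.prod_pos fun i _ => (q i).den_pos
  have hint : ∀ i, ∃ k : ℤ, (k : ℚ) = q i * d := by
    intro i
    obtain ⟨e, he⟩ := Finset.dvd_prod_of_mem (fun i => (q i).den) (Finset.mem_univ i)
    refine ⟨(q i).num * e, ?_⟩
    rw [hd, he]
    push_cast
    rw [← mul_assoc, Rat.mul_den_eq_num]
  choose k hk using hint
  have hiff : ∀ w : ι → ℤ, f w = 0 ↔ (d : ℤ) ∣ ∑ i, k i * w i := by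
    intro w
    rw [hf, AddCircle.coe_eq_zero_iff]
    have hdq : (d : ℚ) ≠ 0 := by positivity
    have hsum : ((∑ i, k i * w i : ℤ) : ℚ) = (∑ i, w i * q i) * d := by
      push_cast
      rw [Finset.sum_mul]
      exact Finset.sum_congr rfl fun i _ => by rw [hk]; ring
    constructor
    · rintro ⟨m, hm⟩
      refine ⟨m, ?_⟩
      have : ((∑ i, k i * w i : ℤ) : ℚ) = ((d * m : ℤ) : ℚ) := by
        rw [hsum, ← hm]
        push_cast
        simp [mul_comm]
      exact_mod_cast this
    · rintro ⟨m, hm⟩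
      refine ⟨m, ?_⟩
      rw [hm] at hsum
      push_cast at hsum
      rw [zsmul_one]
      apply mul_right_cancel₀ hdq
      rw [← hsum, mul_comm]
  have hdz : (0 : ℤ) < d := by exact_mod_cast hd0
  -- Only residues matter, so the coefficients can be digits in base `d`.
  have hmod : ∀ w : ι → ℤ, ((d : ℤ) ∣ ∑ i, ((k i % d).toNat : ℤ) * w i) ↔
      (d : ℤ) ∣ ∑ i, k i * w i := by
    intro w
    refine dvd_iff_dvd_of_dvd_sub ?_
    rw [← Finset.sum_sub_distrib]
    refine Finset.dvd_sum fun i _ => ?_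
    rw [← sub_mul, Int.toNat_of_nonneg (Int.emod_nonneg _ hdz.ne')]
    exact Dvd.dvd.mul_right (dvd_sub_comm.1 (Int.dvd_self_sub_emod)) _
  refine ⟨d, hd0, fun i => (k i % d).toNat, fun i => ?_, fun w hw => ?_, ?_⟩
  · have := Int.emod_lt_of_pos (k i) hdz
    dsimp only
    omega
  · rw [hmod, ← hiff]
    exact hfA w hw
  · rw [hmod, ← hiff]
    exact hfv

end Duality

/-! ### Certificates for the absence of a conjugator -/

section Certificates

variable {n p : ℕ} {hn : 2 ≤ n} {hp : 1 ≤ p} {a b x : Perm (RaySpace (n * p))} {M L H B : ℕ}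
  {s tx : Fin (n * p) → ℤ}

/-- A linear form modulo `d` showing that `ρ` leads to no solution. -/
def DualCertificate (a : Perm (RaySpace (n * p))) (M H B : ℕ) (s tx ρ : Fin (n * p) → ℤ) : Prop :=
  ∃ d : ℕ, 0 < d ∧ ∃ lam : Fin (n * p) → ℕ, (∀ i, lam i < d) ∧
    (∀ j : Fin n, (d : ℤ) ∣ ∑ i : Fin (n * p), if rayBlock i = j then (lam i : ℤ) else 0) ∧
    (∀ w : Fin (n * p) → ℤ, (∀ i, (w i).natAbs ≤ B) →
      ¬ IsAdmissible a M H B s w ∨ (d : ℤ) ∣ ∑ i, lam i * (2 * w i)) ∧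
    ¬ (d : ℤ) ∣ ∑ i, lam i * (ρ i + tx i)

/-- An odd conjugator whose translation vector is `ρ + tx` modulo twice the commuting
translations, in a situation where oddness is an obstruction. -/
def OddCertificate (hn : 2 ≤ n) (hp : 1 ≤ p) (a b : Perm (RaySpace (n * p))) (H : ℕ)
    (s tx ρ : Fin (n * p) → ℤ) : Prop :=
  ¬ (3 ≤ n ∧ Odd p) ∧ HasRigidOrbits a H s ∧ ∃ y c : Perm (RaySpace (n * p)),
    GenParity (blockShifts hn hp) 1 y ∧ y * a = b * y ∧ Commute c a ∧
    ∃ ty tc, TranslatesBy y ty ∧ TranslatesBy c tc ∧ ∀ i, ty i = tx i + ρ i + 2 * tc i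

/-- The bounded vectors generate `T`: in `w = ρ + 2v` a bound `m > B` for `w` gives the smaller
bound `(m + B) / 2` for `v`. -/
theorem dvd_two_smul_of_bounded (ha : Tame M a) (hL : TranslatesFrom H (a ^ L) s) (hL0 : 0 < L)
    (hB : n * p * (n * p) ≤ B) (hs : ∀ i, 2 * (s i).natAbs ≤ B) {d : ℕ} {lam : Fin (n * p) → ℕ}
    (h : ∀ w ∈ commutingTranslations a, (∀ i, (w i).natAbs ≤ B) →
      (d : ℤ) ∣ ∑ i, lam i * (2 * w i)) :
    ∀ w ∈ commutingTranslations a, (d : ℤ) ∣ ∑ i, lam i * (2 * w i) := by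
  have key : ∀ m : ℕ, ∀ w ∈ commutingTranslations a, (∀ i, (w i).natAbs ≤ m) →
      (d : ℤ) ∣ ∑ i, lam i * (2 * w i) := by
    intro m
    induction m using Nat.strong_induction_on with
    | _ m ih =>
    intro w hw hm
    rcases le_or_gt m B with hmB | hmB
    · exact h w hw fun i => (hm i).trans hmB
    · obtain ⟨ρ, hρ, v, hv, hρB, rfl⟩ := exists_bounded_add_two_smul ha hL hL0 hB hs hw
      have hv' := ih ((m + B) / 2) (by omega) v hv fun i => by
        have h1 := hm i
        have h2 := hρB i
        simp only [Pi.add_apply, Pi.smul_apply, smul_eq_mul] at h1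
        omega
      have e : ∑ i, (lam i : ℤ) * (2 * (ρ + (2 : ℤ) • v) i) =
          ∑ i, (lam i : ℤ) * (2 * ρ i) + 2 * ∑ i, (lam i : ℤ) * (2 * v i) := by
        rw [Finset.mul_sum, ← Finset.sum_add_distrib]
        refine Finset.sum_congr rfl fun i _ => ?_
        simp only [Pi.add_apply, Pi.smul_apply, smul_eq_mul]
        ring
      rw [e]
      exact dvd_add (h ρ hρ hρB) (Dvd.dvd.mul_left hv' 2)
  exact fun w hw => key _ w hw (natAbs_le_sum w)

theorem sum_mul_block (lam : Fin (n * p) → ℕ) (k : Fin n → ℤ) :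
    ∑ i, (lam i : ℤ) * k (rayBlock i) =
      ∑ j : Fin n, k j * ∑ i : Fin (n * p), if rayBlock i = j then (lam i : ℤ) else 0 := by
  simp only [Finset.mul_sum, mul_ite, mul_zero]
  rw [Finset.sum_comm]
  refine Finset.sum_congr rfl fun i _ => ?_
  rw [Finset.sum_ite_eq, if_pos (Finset.mem_univ _), mul_comm]

/-- Conjugators differ by elements that commute with `a`. -/
theorem commute_inv_mul {G : Type*} [Group G] {x y a b : G} (hx : x * a = b * x)
    (hy : y * a = b * y) : Commute (x⁻¹ * y) a := by
  have : b = x * a * x⁻¹ := by rw [hx]; group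
  rw [this] at hy
  change x⁻¹ * y * a = a * (x⁻¹ * y)
  rw [mul_assoc, hy]
  group

/-- Absence of a conjugator in `imageU` is equivalent to the existence of certificates for all
bounded classes. -/
theorem forall_certificate_iff (ha : Tame M a) (hL : TranslatesFrom H (a ^ L) s) (hL0 : 0 < L)
    (hB : n * p * (n * p) ≤ B) (hs : ∀ i, 2 * (s i).natAbs ≤ B) (hx : x * a = b * x)
    (htx : TranslatesBy x tx) :
    (∀ ρ : Fin (n * p) → ℤ, (∀ i, (ρ i).natAbs ≤ B) → ¬ IsAdmissible a M H B s ρ ∨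
      DualCertificate a M H B s tx ρ ∨ OddCertificate hn hp a b H s tx ρ) ↔
    ¬ ∃ y ∈ imageU hn hp, y * a = b * y := by
  constructor
  · rintro hcert ⟨y, hyU, hy⟩
    obtain ⟨e, hye, -⟩ := (mem_imageU_iff hn hp).1 hyU
    obtain ⟨k, hk⟩ := hye.exists_block_translatesBy
    have hcomm := commute_inv_mul hx hy
    have htc := htx.inv.mul hk
    obtain ⟨ρ, hρ, v, hv, hρB, hsum⟩ := exists_bounded_add_two_smul ha hL hL0 hB hs
      (mem_commutingTranslations.2 ⟨_, htc, hcomm⟩)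
    have hsum' : ∀ i, k (rayBlock i) = tx i + ρ i + 2 * v i := fun i => by
      have := congrFun hsum i
      simp only [Pi.add_apply, Pi.neg_apply, Pi.smul_apply, smul_eq_mul] at this
      linarith
    rcases hcert ρ hρB with h | h | h
    · exact h (isAdmissible_of_mem ha hL hρB hρ)
    · obtain ⟨d, -, lam, -, hblock, h2, hne⟩ := h
      have h2' := dvd_two_smul_of_bounded ha hL hL0 hB hs (d := d) (lam := lam)
        (fun w hw hwB => (h2 w hwB).resolve_left
          (not_not.2 (isAdmissible_of_mem ha hL hwB hw))) v hv
      apply hne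
      have e : ∑ i, (lam i : ℤ) * (ρ i + tx i) =
          ∑ i, (lam i : ℤ) * k (rayBlock i) - ∑ i, (lam i : ℤ) * (2 * v i) := by
        rw [← Finset.sum_sub_distrib]
        refine Finset.sum_congr rfl fun i _ => ?_
        rw [hsum' i]
        ring
      rw [e, sum_mul_block]
      exact dvd_sub (Finset.dvd_sum fun j _ => Dvd.dvd.mul_left (hblock j) _) h2'
    · obtain ⟨hE, hrigid, y₁, c₁, hy₁, hya, hca, ty, tc, hty, htc', hrel⟩ := h
      -- The quotient `h` of `y₁` and `y` turns out to be even, so that `y` in the subgroup would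
      -- force the odd `y₁` into it.
      refine notMem_imageU_of_parity_one hn hp hE hy₁ ?_
      obtain ⟨k₁, hk₁⟩ := hy₁.exists_block_translatesBy
      obtain rfl := hty.unique hk₁
      obtain ⟨c₂, hc₂, hc₂a⟩ := hv
      set g := c₁⁻¹ * c₂
      have hga : Commute g a := hca.inv_left.mul_left hc₂a
      have hgt : TranslatesBy g (-tc + v) := htc'.inv.mul hc₂
      set h := y₁⁻¹ * y
      have hha : Commute h a := commute_inv_mul hya hy
      have hht := hk₁.inv.mul hk
      have hrel2 : ∀ i, -k₁ (rayBlock i) + k (rayBlock i) = 2 * (-tc i + v i) := fun i => by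
        have := hrel i
        have := hsum' i
        linarith
      have hgblock : ∃ k' : Fin n → ℤ, TranslatesBy g fun i => k' (rayBlock i) := by
        -- Twice the vector of `g` is a difference of block-constant vectors, so the division is
        -- exact on every occurring block.
        refine ⟨fun j => (-k₁ j + k j) / 2, ?_⟩
        convert hgt using 1
        funext i
        have := hrel2 i
        simp only [Pi.add_apply, Pi.neg_apply]
        omega
      obtain ⟨k', hk'⟩ := hgblock
      obtain ⟨eg, heg⟩ := exists_genParity_of_block_translatesBy hn hp hk'
      -- `h` is `g ^ 2` times a finitary permutation commuting with `a`, which rigidity forces to be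
      -- even.
      set f := g⁻¹ * g⁻¹ * h
      have hft : TranslatesBy f 0 := by
        have := (hgt.inv.mul hgt.inv).mul hht
        convert this using 1
        funext i
        have := hrel2 i
        simp only [Pi.add_apply, Pi.neg_apply, Pi.zero_apply]
        linarith
      have hfa : Commute f a := (hga.inv_left.mul_left hga.inv_left).mul_left hha
      obtain ⟨ef, hef⟩ := hft.exists_hasParity
      rcases zmod_two_cases ef with rfl | rfl
      swap
      · exact absurd hef (hrigid.not_hasParity_one hL hfa)
      have hee : eg + eg + 0 = 0 := (by decide : ∀ e : ZMod 2, e + e + 0 = 0) eg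
      have hh0 : GenParity (blockShifts hn hp) 0 h := by
        have := (heg.mul heg).mul (hef.genParity (G := blockShifts hn hp))
        rw [hee] at this
        convert this using 1
        simp only [f]
        group
      have hhU : h ∈ imageU hn hp := (mem_imageU_iff hn hp).2 ⟨0, hh0, Or.inl rfl⟩
      have : y₁ = y * h⁻¹ := by
        simp only [h]
        group
      rw [this]
      exact mul_mem hyU (inv_mem hhU)
  · intro hno ρ hρB
    rw [or_iff_not_imp_left, not_not]
    intro hadm
    have hρ := (mem_commutingTranslations_iff ha hL hL0 hρB).2 hadm
    let Blk : AddSubgroup (Fin (n * p) → ℤ) :=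
      { carrier := {t | ∃ k : Fin n → ℤ, t = fun i => k (rayBlock i)}
        zero_mem' := ⟨0, rfl⟩
        add_mem' := by
          rintro _ _ ⟨k, rfl⟩ ⟨k', rfl⟩
          exact ⟨k + k', rfl⟩
        neg_mem' := by
          rintro _ ⟨k, rfl⟩
          exact ⟨-k, rfl⟩ }
    let T2 : AddSubgroup (Fin (n * p) → ℤ) :=
      (commutingTranslations a).map (DistribSMul.toAddMonoidHom _ (2 : ℤ))
    by_cases hmem : ρ + tx ∈ T2 ⊔ Blk
    · right
      obtain ⟨t, ⟨v, hv, rfl⟩, _, ⟨k, rfl⟩, hk⟩ := AddSubgroup.mem_sup.1 hmem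
      have hk' : ∀ i, 2 * v i + k (rayBlock i) = ρ i + tx i := fun i => congrFun hk i
      -- With this `c` the conjugator `x * c` has the block-constant vector `k`, so only parity can
      -- keep it out of the subgroup.
      obtain ⟨c, hc, hca⟩ := sub_mem hρ (zsmul_mem hv (2 : ℤ))
      obtain ⟨c₁, hc₁, hc₁a⟩ := neg_mem hv
      have hxc : x * c * a = b * (x * c) := by
        rw [mul_assoc, hca.eq, ← mul_assoc, hx, mul_assoc]
      have hxt : TranslatesBy (x * c) fun i => k (rayBlock i) := by
        have := htx.mul hc
        convert this using 1
        funext i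
        have := hk' i
        simp only [Pi.add_apply, Pi.sub_apply, Pi.smul_apply, smul_eq_mul]
        linarith
      obtain ⟨e, he⟩ := exists_genParity_of_block_translatesBy hn hp hxt
      have hnot : ¬ (e = 0 ∨ (3 ≤ n ∧ Odd p)) := fun h =>
        hno ⟨x * c, (mem_imageU_iff hn hp).2 ⟨e, he, h⟩, hxc⟩
      push Not at hnot
      obtain rfl : e = 1 := (zmod_two_cases e).resolve_left hnot.1
      refine ⟨fun h => hnot.2 h.1 h.2, hasRigidOrbits_of_forall ha hL hL0 fun f hf hf1 => ?_,
        x * c, c₁, he, hxc, hc₁a, _, _, hxt, hc₁, fun i => ?_⟩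
      -- An odd finitary permutation in the centralizer would repair the parity.
      · refine hno ⟨x * c * f, (mem_imageU_iff hn hp).2 ⟨_, he.mul hf1.genParity, Or.inl ?_⟩, ?_⟩
        · decide
        · rw [mul_assoc, hf.eq, ← mul_assoc, hxc, mul_assoc]
      · have := hk' i
        simp only [Pi.neg_apply]
        linarith
    · left
      obtain ⟨d, hd, lam, hlam, h1, h2⟩ := exists_dual_certificate _ hmem
      refine ⟨d, hd, lam, hlam, fun j => ?_, fun w hwB => ?_, h2⟩
      · have := h1 (fun i => (Pi.single j 1 : Fin n → ℤ) (rayBlock i))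
          (AddSubgroup.mem_sup_right ⟨_, rfl⟩)
        rw [sum_mul_block] at this
        simpa [Pi.single_apply] using this
      · rw [← mem_commutingTranslations_iff ha hL hL0 hwB]
        by_cases hw : w ∈ commutingTranslations a
        · exact Or.inr (h1 _ (AddSubgroup.mem_sup_left ⟨w, hw, rfl⟩))
        · exact Or.inl hw

end Certificates

/-! ### Permutations acting on pairs of natural numbers -/

section NumericModel

/-- The points of `X_n` as pairs of natural numbers. -/
def pointCode {n : ℕ} (z : RaySpace n) : ℕ × ℕ := (z.1, z.2)

theorem pointCode_injective {n : ℕ} : Function.Injective (pointCode (n := n)) := by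
  rintro ⟨i, m⟩ ⟨j, k⟩ h
  simpa [pointCode, Fin.ext_iff] using h

/-- `f` describes the action of the permutation `g` on coded points. -/
def Represents {n : ℕ} (f : ℕ × ℕ → ℕ × ℕ) (g : Perm (RaySpace n)) : Prop :=
  ∀ z, f (pointCode z) = pointCode (g z)

variable {n : ℕ} {f f' : ℕ × ℕ → ℕ × ℕ} {g g' : Perm (RaySpace n)}

theorem Represents.unique (h : Represents f g) (h' : Represents f g') : g = g' :=
  Equiv.ext fun z => pointCode_injective ((h z).symm.trans (h' z))

theorem Represents.one : Represents (fun z => z) (1 : Perm (RaySpace n)) := fun _ => rfl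

theorem Represents.mul (h : Represents f g) (h' : Represents f' g') :
    Represents (fun z => f (f' z)) (g * g') := fun z => by
  dsimp only
  rw [h' z, h, Perm.mul_apply]

theorem Represents.iterate (h : Represents f g) (k : ℕ) : Represents f^[k] (g ^ k) := by
  induction k with
  | zero => exact Represents.one
  | succ k ih =>
    rw [Function.iterate_succ, pow_succ]
    exact ih.mul h

theorem Represents.apply (h : Represents f g) (i : Fin n) (m : ℕ) :
    f (i, m) = (((g (i, m)).1 : ℕ), (g (i, m)).2) := h (i, m)

theorem Represents.apply_eq_iff (h : Represents f g) (z z' : RaySpace n) :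
    f (pointCode z) = pointCode z' ↔ g z = z' := by
  rw [h z, pointCode_injective.eq_iff]

/-- The ray shift between ray `0` and ray `i`, or its inverse, on coded points. -/
def shiftCode (i : ℕ) (forward : Prop) [Decidable forward] (z : ℕ × ℕ) : ℕ × ℕ :=
  if forward then
    if z.1 = 0 then (0, z.2 + 1)
    else if z.1 = i then (if z.2 = 0 then (0, 0) else (i, z.2 - 1))
    else z
  else
    if z.1 = 0 then (if z.2 = 0 then (i, 0) else (0, z.2 - 1))
    else if z.1 = i then (i, z.2 + 1)
    else z

theorem represents_shiftCode (hn : 2 ≤ n) (i : Fin n) (hi : ray₁ hn ≠ i) (c : Prop) [Decidable c] :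
    Represents (shiftCode i c)
      (if c then rayShift (ray₁ hn) i hi else (rayShift (ray₁ hn) i hi)⁻¹) := by
  have h0 : (i : ℕ) ≠ 0 := fun h => hi (Fin.ext h.symm)
  have hr : ∀ k : Fin n, (k : ℕ) = 0 ↔ k = ray₁ hn := fun k => by simp [Fin.ext_iff, ray₁]
  rintro ⟨k, m⟩
  by_cases hc : c
  · simp only [shiftCode, hc, if_true, pointCode, rayShift, Equiv.coe_fn_mk, hr, ← Fin.ext_iff]
    grind [ray₁]
  · simp only [shiftCode, hc, if_false, pointCode, Perm.inv_def, rayShift, Equiv.coe_fn_symm_mk,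
      hr, ← Fin.ext_iff]
    grind [ray₁]

/-- The bijection `raySplit` on coded points. -/
def splitCode (p : ℕ) (z : ℕ × ℕ) : ℕ × ℕ := (z.2 % p + p * z.1, z.2 / p)

/-- The inverse of `raySplit` on coded points. -/
def unsplitCode (p : ℕ) (z : ℕ × ℕ) : ℕ × ℕ := (z.1 / p, z.1 % p + p * z.2)

theorem Represents.permCongr {p : ℕ} (hp : 1 ≤ p) (h : Represents f g) :
    Represents (fun z => splitCode p (f (unsplitCode p z)))
      ((raySplit n p hp).permCongrHom g) := by
  intro z
  rw [raySplit_permCongr_apply]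
  have h1 : unsplitCode p (pointCode z) = pointCode ((raySplit n p hp).symm z) := rfl
  dsimp only
  rw [h1, h]
  rfl

/-- The `p`-th power of a ray shift, on coded points of the split space. -/
def blockShiftCode (p i : ℕ) (forward : Prop) [Decidable forward] (z : ℕ × ℕ) : ℕ × ℕ :=
  splitCode p ((shiftCode i forward)^[p] (unsplitCode p z))

theorem blockShiftCode_one (i : ℕ) (c : Prop) [Decidable c] :
    blockShiftCode 1 i c = shiftCode i c := by
  funext z
  simp [blockShiftCode, splitCode, unsplitCode, Nat.mod_one]

theorem rayShift_inv_tame {i j : Fin n} (hij : i ≠ j) : Tame 1 (rayShift i j hij)⁻¹ := by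
  intro l k
  simp only [Perm.inv_def, rayShift, Equiv.coe_fn_symm_mk]
  grind

/-- One step on a split ray is `p` steps on the original one, so heights are divided by `p`. -/
theorem Tame.permCongr {p M : ℕ} (hp : 1 ≤ p) (hg : Tame (M * p) g) :
    Tame M ((raySplit n p hp).permCongrHom g) := by
  intro l k
  have e : ∀ m, (raySplit n p hp).symm (l, m) =
      ((finProdFinEquiv.symm l).1, ((finProdFinEquiv.symm l).2 : ℕ) + p * m) := fun _ => rfl
  rw [raySplit_permCongr_apply, raySplit_permCongr_apply, e, e]
  have h : ((finProdFinEquiv.symm l).2 : ℕ) + p * (M + k) =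
      ((finProdFinEquiv.symm l).2 + p * M) + p * k := by ring
  rw [h, hg.apply_add _ (by rw [mul_comm]; exact Nat.le_add_left _ _)]
  simp [raySplit, Nat.add_mul_div_left _ _ hp]

end NumericModel

/-! ### Lists of letters as codes for block-translating permutations -/

section Lists

/-- A letter `(0, u, v)` stands for the transposition of the points `u`, `v`; a letter `(t, u, v)`
with `t ≠ 0` for the block shift towards ray `u.1`, or its inverse, if `t ≠ 1`. -/
abbrev Letter : Type := ℕ × (ℕ × ℕ) × (ℕ × ℕ)

/-- Whether a letter is a transposition of two points of `X_{np}`. -/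
def IsSwapLetter (n p : ℕ) (c : Letter) : Prop :=
  c.1 = 0 ∧ c.2.1.1 < n * p ∧ c.2.2.1 < n * p ∧ c.2.1 ≠ c.2.2

instance (n p : ℕ) (c : Letter) : Decidable (IsSwapLetter n p c) :=
  inferInstanceAs (Decidable (_ ∧ _))

/-- Whether a letter is a block shift. -/
def IsShiftLetter (n : ℕ) (c : Letter) : Prop := c.1 ≠ 0 ∧ 0 < c.2.1.1 ∧ c.2.1.1 < n

instance (n : ℕ) (c : Letter) : Decidable (IsShiftLetter n c) :=
  inferInstanceAs (Decidable (_ ∧ _))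

/-- The action of a letter on coded points. -/
def letterEval (n p : ℕ) (c : Letter) (z : ℕ × ℕ) : ℕ × ℕ :=
  if IsSwapLetter n p c then (if z = c.2.1 then c.2.2 else if z = c.2.2 then c.2.1 else z)
  else if IsShiftLetter n c then blockShiftCode p c.2.1.1 (c.1 = 1) z
  else z

/-- The action of a list of letters on coded points; the last letter acts first. -/
def listEval (n p : ℕ) (l : List Letter) (z : ℕ × ℕ) : ℕ × ℕ :=
  l.foldr (fun c z => letterEval n p c z) z

/-- The number of transpositions in a list of letters. -/
def swapCount (n p : ℕ) (l : List Letter) : ℕ :=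
  l.foldr (fun c k => if IsSwapLetter n p c then k + 1 else k) 0

/-- A height from which on a list of letters acts rigidly. -/
def listHeight (l : List Letter) : ℕ :=
  l.foldr (fun c k => c.2.1.2 + c.2.2.2 + 1 + k) 0

/-- The elements of `G` are the permutations given by shift letters. -/
structure IsShiftCoding (n p : ℕ) {N : ℕ} (G : Set (Perm (RaySpace N))) : Prop where
  card : n * p = N
  exists_mem : ∀ i, 0 < i → i < n → ∃ g ∈ G, Represents (blockShiftCode p i True) g ∧
    Represents (blockShiftCode p i False) g⁻¹ ∧ Tame 1 g ∧ Tame 1 g⁻¹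
  exists_eq : ∀ g ∈ G, ∃ i, 0 < i ∧ i < n ∧ Represents (blockShiftCode p i True) g

theorem isShiftCoding_blockShifts {n p : ℕ} (hn : 2 ≤ n) (hp : 1 ≤ p) :
    IsShiftCoding n p (blockShifts hn hp) := by
  have key : ∀ (i : Fin n) (hi : ray₁ hn ≠ i) (c : Prop) [Decidable c],
      Represents (blockShiftCode p i c) ((raySplit n p hp).permCongrHom
        ((if c then rayShift (ray₁ hn) i hi else (rayShift (ray₁ hn) i hi)⁻¹) ^ p)) :=
    fun i hi c _ => ((represents_shiftCode hn i hi c).iterate p).permCongr hp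
  refine ⟨rfl, fun i h0 hi => ?_, ?_⟩
  · have hne : ray₁ hn ≠ ⟨i, hi⟩ := fun h => h0.ne (congrArg Fin.val h)
    refine ⟨_, ⟨_, ⟨⟨i, hi⟩, hne, rfl⟩, rfl⟩, ?_, ?_, ?_, ?_⟩
    · simpa using key ⟨i, hi⟩ hne True
    · rw [← map_inv, ← inv_pow]
      exact key ⟨i, hi⟩ hne False
    · refine Tame.permCongr hp ?_
      rw [mul_comm]
      exact (rayShift_tame hne).pow p
    · rw [← map_inv, ← inv_pow]
      refine Tame.permCongr hp ?_
      rw [mul_comm]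
      exact (rayShift_inv_tame hne).pow p
  · rintro _ ⟨_, ⟨i, hi, rfl⟩, rfl⟩
    exact ⟨i, Nat.pos_of_ne_zero fun h => hi (Fin.ext h.symm), i.2, by simpa using key i hi True⟩

/-- With `p = 1` the letter lists, without regard to parity, code all of the Houghton group; this
serves for centralizer elements. -/
theorem isShiftCoding_shiftPowers {n : ℕ} (hn : 2 ≤ n) :
    IsShiftCoding n 1 (shiftPowers hn 1) := by
  refine ⟨mul_one n, fun i h0 hi => ?_, ?_⟩
  · have hne : ray₁ hn ≠ ⟨i, hi⟩ := fun h => h0.ne (congrArg Fin.val h)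
    refine ⟨_, ⟨⟨i, hi⟩, hne, rfl⟩, ?_⟩
    simp only [blockShiftCode_one, pow_one]
    exact ⟨by simpa using represents_shiftCode hn ⟨i, hi⟩ hne True,
      by simpa using represents_shiftCode hn ⟨i, hi⟩ hne False, rayShift_tame hne,
      rayShift_inv_tame hne⟩
  · rintro _ ⟨i, hi, rfl⟩
    refine ⟨i, Nat.pos_of_ne_zero fun h => hi (Fin.ext h.symm), i.2, ?_⟩
    simpa [blockShiftCode_one] using represents_shiftCode hn i hi True

variable {n p N : ℕ} {G : Set (Perm (RaySpace N))}

theorem represents_swapCode (u v : RaySpace N) :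
    Represents (fun z => if z = pointCode u then pointCode v else if z = pointCode v then
      pointCode u else z) (Equiv.swap u v) := by
  intro z
  simp only [pointCode_injective.eq_iff, Equiv.swap_apply_def]
  split_ifs <;> rfl

theorem tame_swap (u v : RaySpace N) : Tame (u.2 + v.2 + 1) (Equiv.swap u v) := by
  have h : ∀ i m, u.2 + v.2 + 1 ≤ m → Equiv.swap u v (i, m) = (i, m) := fun i m hm =>
    Equiv.swap_apply_of_ne_of_ne (fun e => by simp [← e] at hm)
      (fun e => by simp [← e] at hm)
  intro i k
  rw [h i _ le_rfl, h i _ (by omega)]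

/-- Meaningless letters act as the identity and are not counted, so every list is a valid candidate
in a search. -/
theorem exists_represents_listEval (hG : IsShiftCoding n p G) (l : List Letter) :
    ∃ g, GenParity G (swapCount n p l : ZMod 2) g ∧ Represents (listEval n p l) g ∧
      Tame (listHeight l) g := by
  induction l with
  | nil => exact ⟨1, by simpa [swapCount] using GenParity.one, Represents.one, Tame.one⟩
  | cons c l ih =>
    obtain ⟨g, h1, h2, h3⟩ := ih
    suffices h : ∃ f, GenParity G ((if IsSwapLetter n p c then swapCount n p l + 1
        else swapCount n p l : ℕ) : ZMod 2) (f * g) ∧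
        Represents (letterEval n p c) f ∧ Tame (c.2.1.2 + c.2.2.2 + 1) f by
      obtain ⟨f, h4, h5, h6⟩ := h
      exact ⟨f * g, h4, h5.mul h2, h6.mul h3⟩
    unfold letterEval
    by_cases hs : IsSwapLetter n p c
    · obtain ⟨t, ⟨i, m⟩, ⟨j, m'⟩⟩ := c
      obtain ⟨-, hi, hj, hne⟩ := id hs
      rw [hG.card] at hi hj
      simp only [hs, if_true]
      refine ⟨Equiv.swap (⟨i, hi⟩, m) (⟨j, hj⟩, m'), ?_, represents_swapCode (⟨i, hi⟩, m)
        (⟨j, hj⟩, m'), tame_swap (⟨i, hi⟩, m) (⟨j, hj⟩, m')⟩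
      push_cast
      refine .swap ⟨_, _, fun h => hne ?_, rfl⟩ h1
      simpa using h
    · simp only [hs, if_false]
      by_cases ht : IsShiftLetter n c
      · simp only [ht, if_true]
        obtain ⟨-, h0, hn⟩ := ht
        obtain ⟨f, hf, h4, h5, h6, h7⟩ := hG.exists_mem _ h0 hn
        by_cases hc : c.1 = 1
        · simp only [hc]
          exact ⟨f, .gen hf h1, h4, h6.mono (by omega)⟩
        · simp only [hc]
          exact ⟨f⁻¹, .gen_inv hf h1, h5, h7.mono (by omega)⟩
      · simp only [ht, if_false]
        exact ⟨1, by simpa using h1, Represents.one, Tame.one.mono (Nat.zero_le _)⟩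

theorem GenParity.exists_listEval (hG : IsShiftCoding n p G) {e : ZMod 2} {g : Perm (RaySpace N)}
    (hg : GenParity G e g) :
    ∃ l, (swapCount n p l : ZMod 2) = e ∧ Represents (listEval n p l) g := by
  induction hg with
  | one => exact ⟨[], by simp [swapCount], Represents.one⟩
  | @swap e f h hf _ ih =>
    obtain ⟨l, rfl, hl⟩ := ih
    obtain ⟨u, v, huv, rfl⟩ := hf
    have hs : IsSwapLetter n p (0, pointCode u, pointCode v) :=
      ⟨rfl, hG.card ▸ u.1.2, hG.card ▸ v.1.2, pointCode_injective.ne huv⟩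
    refine ⟨(0, pointCode u, pointCode v) :: l, ?_, ?_⟩
    · change ((if _ then _ else _ : ℕ) : ZMod 2) = _
      rw [if_pos hs]
      push_cast
      rfl
    · refine Represents.mul (f := letterEval n p _) ?_ hl
      unfold letterEval
      simp only [hs, if_true]
      exact represents_swapCode u v
  | @gen e f h hf _ ih =>
    obtain ⟨l, rfl, hl⟩ := ih
    obtain ⟨i, h0, hi, hr⟩ := hG.exists_eq f hf
    refine ⟨(1, (i, 0), (0, 0)) :: l, ?_, ?_⟩
    · simp [swapCount, IsSwapLetter]
    · refine Represents.mul (f := letterEval n p (1, (i, 0), (0, 0))) ?_ hl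
      unfold letterEval
      simpa [IsSwapLetter, IsShiftLetter, h0, hi] using hr
  | @gen_inv e f h hf _ ih =>
    obtain ⟨l, rfl, hl⟩ := ih
    obtain ⟨i, h0, hi, hr⟩ := hG.exists_eq f hf
    obtain ⟨f', -, hr', hr'', -⟩ := hG.exists_mem i h0 hi
    obtain rfl := hr.unique hr'
    refine ⟨(2, (i, 0), (0, 0)) :: l, ?_, ?_⟩
    · simp [swapCount, IsSwapLetter]
    · refine Represents.mul (f := letterEval n p (2, (i, 0), (0, 0))) ?_ hl
      unfold letterEval
      simpa [IsSwapLetter, IsShiftLetter, h0, hi] using hr''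

end Lists

/-! ### Words in the generators -/

section Words

/-- The action of a letter of a word in the generators, or its inverse, on coded points of
`X_N`. -/
def genLetterEval (N : ℕ) (c : Fin 3 × Bool) (z : ℕ × ℕ) : ℕ × ℕ :=
  if c.1 = 0 then shiftCode 1 (c.2 = true) z
  else if c.1 = 1 then (if z.1 = 0 then 1 else if z.1 = 1 then 0 else z.1, z.2)
  else if N = 2 then (if z = (0, 0) then (1, 0) else if z = (1, 0) then (0, 0) else z)
  else if c.2 = true then (if z.1 + 1 = N then 0 else z.1 + 1, z.2)
  else (if z.1 = 0 then N - 1 else z.1 - 1, z.2)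

/-- The action of a word in the generators on coded points; the first letter acts first. -/
def wordEval (N : ℕ) (w : GenWord) (z : ℕ × ℕ) : ℕ × ℕ :=
  w.foldl (fun z c => genLetterEval N c z) z

variable {n : ℕ}

theorem represents_rayPerm_swap (hn : 2 ≤ n) :
    Represents (fun z => (if z.1 = 0 then 1 else if z.1 = 1 then 0 else z.1, z.2))
      (rayPerm (Equiv.swap (ray₁ hn) (ray₂ hn))) := by
  rintro ⟨k, m⟩
  simp only [pointCode, rayPerm, Equiv.prodCongr_apply, Prod.map, Equiv.swap_apply_def,
    Fin.ext_iff, ray₁, ray₂]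
  split_ifs <;> simp_all
  split_ifs <;> simp_all

theorem represents_rayPerm_finRotate (hn : 2 ≤ n) :
    Represents (fun z => (if z.1 + 1 = n then 0 else z.1 + 1, z.2)) (rayPerm (finRotate n)) := by
  obtain ⟨n, rfl⟩ : ∃ k, n = k + 1 := ⟨n - 1, by omega⟩
  rintro ⟨k, m⟩
  simp only [pointCode, rayPerm, Equiv.prodCongr_apply, Prod.map, coe_finRotate, Fin.ext_iff,
    Fin.val_last, Nat.add_right_cancel_iff]
  split_ifs <;> rfl

theorem represents_rayPerm_finRotate_inv (hn : 2 ≤ n) :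
    Represents (fun z => (if z.1 = 0 then n - 1 else z.1 - 1, z.2)) (rayPerm (finRotate n))⁻¹ := by
  intro z
  obtain ⟨z, rfl⟩ := (rayPerm (finRotate n)).surjective z
  rw [← represents_rayPerm_finRotate hn z, Perm.inv_def, Equiv.symm_apply_apply]
  have := z.1.2
  simp only [pointCode]
  split_ifs <;> simp_all
  omega

theorem tame_rayPerm (σ : Perm (Fin n)) : Tame 0 (rayPerm σ) := fun i k => by
  simp [rayPerm]

theorem rayPerm_inv (σ : Perm (Fin n)) : (rayPerm σ)⁻¹ = rayPerm σ⁻¹ := rfl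

theorem represents_genLetterEval (hn : 2 ≤ n) (s : Fin 3) (c : Bool) :
    Represents (genLetterEval n (s, c))
      (if c = true then generator hn s else (generator hn s)⁻¹) := by
  unfold genLetterEval
  fin_cases s
  · exact represents_shiftCode hn (ray₂ hn) (ray₁_ne_ray₂ hn) (c = true)
  · have h := represents_rayPerm_swap hn
    have h' : (rayPerm (Equiv.swap (ray₁ hn) (ray₂ hn)))⁻¹ =
        rayPerm (Equiv.swap (ray₁ hn) (ray₂ hn)) := by rw [rayPerm_inv, Equiv.swap_inv]
    simpa [generator, h'] using h
  · by_cases h2 : n = 2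
    · have h := represents_swapCode (ray₁ hn, 0) (ray₂ hn, 0)
      simp [generator, h2]
      exact h
    · have h := represents_rayPerm_finRotate hn
      have h' := represents_rayPerm_finRotate_inv hn
      cases c <;> simp [generator, h2, h, h']

theorem tame_generator (hn : 2 ≤ n) (s : Fin 3) (c : Bool) :
    Tame 1 (if c = true then generator hn s else (generator hn s)⁻¹) := by
  fin_cases s
  · cases c
    · exact rayShift_inv_tame (ray₁_ne_ray₂ hn)
    · exact rayShift_tame (ray₁_ne_ray₂ hn)
  · cases c
    · exact (tame_rayPerm _).mono zero_le_one
    · exact (tame_rayPerm _).mono zero_le_one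
  · by_cases h2 : n = 2
    · have h := tame_swap (ray₁ hn, 0) (ray₂ hn, 0)
      simpa [generator, h2] using h
    · cases c <;> simp only [generator, h2, if_false, if_true, rayPerm_inv, Bool.false_eq_true]
      · exact (tame_rayPerm _).mono zero_le_one
      · exact (tame_rayPerm _).mono zero_le_one

theorem GenWord.toPerm_cons (hn : 2 ≤ n) (s : Fin 3) (c : Bool) (w : GenWord) :
    GenWord.toPerm hn ((s, c) :: w) =
      w.toPerm hn * (if c = true then generator hn s else (generator hn s)⁻¹) := by
  cases c <;> rfl

theorem represents_wordEval (hn : 2 ≤ n) (w : GenWord) :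
    Represents (wordEval n w) (w.toPerm hn) := by
  induction w with
  | nil => exact Represents.one
  | cons c w ih =>
    rw [GenWord.toPerm_cons]
    exact ih.mul (represents_genLetterEval hn c.1 c.2)

theorem GenWord.tame_toPerm (hn : 2 ≤ n) (w : GenWord) : Tame w.length (w.toPerm hn) := by
  induction w with
  | nil => exact Tame.one
  | cons c w ih =>
    rw [GenWord.toPerm_cons]
    exact ih.mul (tame_generator hn c.1 c.2)

end Words

/-! ### Primitive recursive functions and searchable predicates -/

section PrimrecRules

variable {α β γ : Type*} [Primcodable α] [Primcodable β] [Primcodable γ]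

attribute [fun_prop] Primrec

attribute [fun_prop] Primrec.const Primrec.comp

@[fun_prop]
theorem Primrec.id_rule : Primrec fun a : α => a := Primrec.id

@[fun_prop]
theorem Primrec.pair_rule {f : α → β} {g : α → γ} (hf : Primrec f) (hg : Primrec g) :
    Primrec fun a => (f a, g a) := hf.pair hg

@[fun_prop]
theorem Primrec.fst_rule {f : α → β × γ} (hf : Primrec f) : Primrec fun a => (f a).1 :=
  Primrec.fst.comp hf

@[fun_prop]
theorem Primrec.snd_rule {f : α → β × γ} (hf : Primrec f) : Primrec fun a => (f a).2 :=
  Primrec.snd.comp hf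

variable {f g : α → ℕ}

@[fun_prop]
theorem Primrec.add_rule (hf : Primrec f) (hg : Primrec g) : Primrec fun a => f a + g a :=
  Primrec.nat_add.comp hf hg

@[fun_prop]
theorem Primrec.sub_rule (hf : Primrec f) (hg : Primrec g) : Primrec fun a => f a - g a :=
  Primrec.nat_sub.comp hf hg

@[fun_prop]
theorem Primrec.mul_rule (hf : Primrec f) (hg : Primrec g) : Primrec fun a => f a * g a :=
  Primrec.nat_mul.comp hf hg

@[fun_prop]
theorem Primrec.div_rule (hf : Primrec f) (hg : Primrec g) : Primrec fun a => f a / g a :=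
  Primrec.nat_div.comp hf hg

@[fun_prop]
theorem Primrec.mod_rule (hf : Primrec f) (hg : Primrec g) : Primrec fun a => f a % g a :=
  Primrec.nat_mod.comp hf hg

@[fun_prop]
theorem Primrec.pow_rule (hf : Primrec f) (hg : Primrec g) : Primrec fun a => f a ^ g a :=
  (Primrec₂.unpaired'.1 Nat.Primrec.pow).comp hf hg

@[fun_prop]
theorem Primrec.length_rule {f : α → List β} (hf : Primrec f) : Primrec fun a => (f a).length :=
  Primrec.list_length.comp hf



attribute [fun_prop] PrimrecPred

@[fun_prop]
theorem PrimrecPred.eq_rule {f g : α → β} (hf : Primrec f) (hg : Primrec g) :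
    PrimrecPred fun a => f a = g a := Primrec.eq.comp hf hg

@[fun_prop]
theorem PrimrecPred.le_rule (hf : Primrec f) (hg : Primrec g) :
    PrimrecPred fun a => f a ≤ g a := Primrec.nat_le.comp hf hg

@[fun_prop]
theorem PrimrecPred.lt_rule (hf : Primrec f) (hg : Primrec g) :
    PrimrecPred fun a => f a < g a := Primrec.nat_lt.comp hf hg

variable {q r : α → Prop}

@[fun_prop]
theorem PrimrecPred.and_rule (hq : PrimrecPred q) (hr : PrimrecPred r) :
    PrimrecPred fun a => q a ∧ r a := hq.and hr

@[fun_prop]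
theorem PrimrecPred.ne_rule {f g : α → β} (hf : Primrec f) (hg : Primrec g) :
    PrimrecPred fun a => f a ≠ g a := (PrimrecPred.eq_rule hf hg).not

@[fun_prop]
theorem Primrec.ite_rule {c : α → Prop} [DecidablePred c] {f g : α → β} (hc : PrimrecPred c)
    (hf : Primrec f) (hg : Primrec g) : Primrec fun a => if c a then f a else g a :=
  Primrec.ite hc hf hg

/-- A predicate of the form `∃ k, R a k` with a primitive recursive relation `R`. -/
@[fun_prop]
def IsSearchable (q : α → Prop) : Prop :=
  ∃ R : α × ℕ → Prop, PrimrecPred R ∧ ∀ a, q a ↔ ∃ k, R (a, k)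

theorem PrimrecPred.isSearchable (hq : PrimrecPred q) : IsSearchable q :=
  ⟨fun z => q z.1, hq.comp Primrec.fst, fun a => by simp⟩

@[fun_prop]
theorem IsSearchable.eq {f g : α → β} (hf : Primrec f) (hg : Primrec g) :
    IsSearchable fun a => f a = g a := (PrimrecPred.eq_rule hf hg).isSearchable

@[fun_prop]
theorem IsSearchable.ne {f g : α → β} (hf : Primrec f) (hg : Primrec g) :
    IsSearchable fun a => f a ≠ g a := (PrimrecPred.ne_rule hf hg).isSearchable

@[fun_prop]
theorem IsSearchable.le (hf : Primrec f) (hg : Primrec g) :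
    IsSearchable fun a => f a ≤ g a := (PrimrecPred.le_rule hf hg).isSearchable

@[fun_prop]
theorem IsSearchable.lt (hf : Primrec f) (hg : Primrec g) :
    IsSearchable fun a => f a < g a := (PrimrecPred.lt_rule hf hg).isSearchable

@[fun_prop]
theorem IsSearchable.and (hq : IsSearchable q) (hr : IsSearchable r) :
    IsSearchable fun a => q a ∧ r a := by
  obtain ⟨R, hR, hq⟩ := hq
  obtain ⟨S, hS, hr⟩ := hr
  refine ⟨fun z => R (z.1, z.2.unpair.1) ∧ S (z.1, z.2.unpair.2), ?_, fun a => ?_⟩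
  · have h := Primrec.unpair.comp (Primrec.snd (α := α) (β := ℕ))
    exact (hR.comp (Primrec.fst.pair (Primrec.fst.comp h))).and
      (hS.comp (Primrec.fst.pair (Primrec.snd.comp h)))
  · simp only [hq, hr]
    constructor
    · rintro ⟨⟨k, hk⟩, l, hl⟩
      exact ⟨Nat.pair k l, by simpa using ⟨hk, hl⟩⟩
    · rintro ⟨k, hk, hl⟩
      exact ⟨⟨_, hk⟩, _, hl⟩

@[fun_prop]
theorem IsSearchable.or (hq : IsSearchable q) (hr : IsSearchable r) :
    IsSearchable fun a => q a ∨ r a := by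
  obtain ⟨R, hR, hq⟩ := hq
  obtain ⟨S, hS, hr⟩ := hr
  refine ⟨fun z => R z ∨ S z, hR.or hS, fun a => ?_⟩
  simp only [hq, hr, exists_or]

-- One number codes both the candidate and its witness; numbers that decode to no candidate are
-- rejected.
@[fun_prop]
theorem IsSearchable.exists {q : α → β → Prop} (hq : IsSearchable fun z : α × β => q z.1 z.2) :
    IsSearchable fun a => ∃ b, q a b := by
  obtain ⟨R, hR, hq⟩ := hq
  have h := Primrec.unpair.comp (Primrec.snd (α := α) (β := ℕ))
  have hd : Primrec fun z : α × ℕ => (Encodable.decode (α := β) z.2.unpair.1) :=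
    Primrec.decode.comp (Primrec.fst.comp h)
  obtain ⟨inst, hR'⟩ := hR
  have hP : Primrec fun z : α × ℕ => (Option.casesOn (Encodable.decode (α := β) z.2.unpair.1)
      false (fun b => decide (R ((z.1, b), z.2.unpair.2))) : Bool) := by
    refine Primrec.option_casesOn hd (Primrec.const false) ?_
    exact hR'.comp (((Primrec.fst.comp Primrec.fst).pair Primrec.snd).pair
      (Primrec.snd.comp (h.comp Primrec.fst)))
  refine ⟨_, PrimrecPred.eq_rule hP (Primrec.const true), fun a => ?_⟩
  constructor
  · rintro ⟨b, hb⟩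
    obtain ⟨k, hk⟩ := (hq (a, b)).1 hb
    exact ⟨Nat.pair (Encodable.encode b) k, by simpa using hk⟩
  · rintro ⟨k, hk⟩
    dsimp only at hk
    cases hd : Encodable.decode (α := β) k.unpair.1 with
    | none => simp [hd] at hk
    | some b =>
      simp only [hd, decide_eq_true_eq] at hk
      exact ⟨b, (hq (a, b)).2 ⟨_, hk⟩⟩

theorem PrimrecPred.forall_lt_rule {q : α → ℕ → Prop} (hf : Primrec f)
    (hq : PrimrecPred fun z : α × ℕ => q z.1 z.2) : PrimrecPred fun a => ∀ i < f a, q a i := by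
  have h : PrimrecRel fun (i : ℕ) (a : α) => q a i := hq.comp (Primrec.snd.pair Primrec.fst)
  simpa using h.forall_mem_list.comp (Primrec.list_range.comp hf) Primrec.id

theorem PrimrecPred.exists_lt_rule {q : α → ℕ → Prop} (hf : Primrec f)
    (hq : PrimrecPred fun z : α × ℕ => q z.1 z.2) : PrimrecPred fun a => ∃ i < f a, q a i := by
  have h : PrimrecRel fun (i : ℕ) (a : α) => q a i := hq.comp (Primrec.snd.pair Primrec.fst)
  simpa using h.exists_mem_list.comp (Primrec.list_range.comp hf) Primrec.id

/-- All numbers below `k` satisfy `q`. -/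
def ForallBelow (k : ℕ) (q : ℕ → Prop) : Prop := ∀ i < k, q i

-- Finitely many searches that all succeed do so below a common bound, and this bound is the
-- witness.
@[fun_prop]
theorem IsSearchable.forallBelow {q : α → ℕ → Prop} (hf : Primrec f)
    (hq : IsSearchable fun z : α × ℕ => q z.1 z.2) : IsSearchable fun a => ForallBelow (f a) (q a) := by
  obtain ⟨R, hR, hq⟩ := hq
  refine ⟨fun z => ∀ i < f z.1, ∃ k < z.2, R ((z.1, i), k), ?_, fun a => ?_⟩
  · refine PrimrecPred.forall_lt_rule (by fun_prop) (PrimrecPred.exists_lt_rule (by fun_prop) ?_)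
    exact hR.comp (by fun_prop)
  · simp only [ForallBelow, show ∀ i, q a i ↔ _ from fun i => hq (a, i)]
    constructor
    · intro h
      choose! k hk using h
      refine ⟨(Finset.range (f a)).sup k + 1, fun i hi => ⟨k i, ?_, hk i hi⟩⟩
      exact Nat.lt_succ_of_le (Finset.le_sup (f := k) (Finset.mem_range.2 hi))
    · rintro ⟨K, hK⟩ i hi
      obtain ⟨k, -, hk⟩ := hK i hi
      exact ⟨k, hk⟩

@[fun_prop]
theorem Primrec.sum_range_rule {F : α → ℕ → ℕ} (hf : Primrec f)
    (hF : Primrec fun z : α × ℕ => F z.1 z.2) :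
    Primrec fun a => ∑ i ∈ Finset.range (f a), F a i := by
  refine (Primrec.nat_rec' hf (Primrec.const 0) (h := fun a z => z.2 + F a z.1) ?_).of_eq fun a => ?_
  · exact Primrec₂.mk (by fun_prop)
  · induction f a with
    | zero => rfl
    | succ k ih => rw [Finset.sum_range_succ, ← ih]

end PrimrecRules

/-! ### Evaluation of words and lists is primitive recursive -/

section Evaluators

variable {α : Type*} [Primcodable α]

@[fun_prop]
theorem primrec_shiftCode {i : α → ℕ} {c : α → Prop} [DecidablePred c] {z : α → ℕ × ℕ}
    (hi : Primrec i) (hc : PrimrecPred c) (hz : Primrec z) :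
    Primrec fun a => shiftCode (i a) (c a) (z a) := by
  unfold shiftCode
  fun_prop

@[fun_prop]
theorem primrec_blockShiftCode {p i : α → ℕ} {c : α → Prop} [DecidablePred c] {z : α → ℕ × ℕ}
    (hp : Primrec p) (hi : Primrec i) (hc : PrimrecPred c) (hz : Primrec z) :
    Primrec fun a => blockShiftCode (p a) (i a) (c a) (z a) := by
  have hu : Primrec fun a => unsplitCode (p a) (z a) := by
    unfold unsplitCode
    fun_prop
  have hc' : PrimrecPred fun q : α × ℕ × ℕ => c q.1 := hc.comp Primrec.fst
  have h := Primrec.nat_iterate hp hu (h := fun a => shiftCode (i a) (c a)) (Primrec₂.mk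
    (primrec_shiftCode (i := fun q : α × ℕ × ℕ => i q.1) (c := fun q => c q.1) (by fun_prop) hc'
      (by fun_prop)))
  unfold blockShiftCode splitCode
  fun_prop

@[fun_prop]
theorem primrecPred_isSwapLetter {n p : α → ℕ} {c : α → Letter} (hn : Primrec n) (hp : Primrec p)
    (hc : Primrec c) : PrimrecPred fun a => IsSwapLetter (n a) (p a) (c a) := by
  unfold IsSwapLetter
  fun_prop

@[fun_prop]
theorem primrecPred_isShiftLetter {n : α → ℕ} {c : α → Letter} (hn : Primrec n)
    (hc : Primrec c) : PrimrecPred fun a => IsShiftLetter (n a) (c a) := by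
  unfold IsShiftLetter
  fun_prop

@[fun_prop]
theorem primrec_letterEval {n p : α → ℕ} {c : α → Letter} {z : α → ℕ × ℕ} (hn : Primrec n)
    (hp : Primrec p) (hc : Primrec c) (hz : Primrec z) :
    Primrec fun a => letterEval (n a) (p a) (c a) (z a) := by
  unfold letterEval
  fun_prop

@[fun_prop]
theorem primrec_listEval {n p : α → ℕ} {l : α → List Letter} {z : α → ℕ × ℕ} (hn : Primrec n)
    (hp : Primrec p) (hl : Primrec l) (hz : Primrec z) :
    Primrec fun a => listEval (n a) (p a) (l a) (z a) :=
  Primrec.list_foldr hl hz (h := fun a q => letterEval (n a) (p a) q.1 q.2)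
    (Primrec₂.mk (by fun_prop))

@[fun_prop]
theorem primrec_swapCount {n p : α → ℕ} {l : α → List Letter} (hn : Primrec n)
    (hp : Primrec p) (hl : Primrec l) : Primrec fun a => swapCount (n a) (p a) (l a) :=
  Primrec.list_foldr hl (Primrec.const 0)
    (h := fun a q => if IsSwapLetter (n a) (p a) q.1 then q.2 + 1 else q.2)
    (Primrec₂.mk (by fun_prop))

@[fun_prop]
theorem primrec_listHeight {l : α → List Letter} (hl : Primrec l) :
    Primrec fun a => listHeight (l a) :=
  Primrec.list_foldr hl (Primrec.const 0)
    (h := fun _ (q : Letter × ℕ) => q.1.2.1.2 + q.1.2.2.2 + 1 + q.2) (Primrec₂.mk (by fun_prop))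

@[fun_prop]
theorem primrec_genLetterEval {N : α → ℕ} {c : α → Fin 3 × Bool} {z : α → ℕ × ℕ} (hN : Primrec N)
    (hc : Primrec c) (hz : Primrec z) : Primrec fun a => genLetterEval (N a) (c a) (z a) := by
  unfold genLetterEval
  fun_prop

@[fun_prop]
theorem primrec_wordEval {N : α → ℕ} {w : α → GenWord} {z : α → ℕ × ℕ} (hN : Primrec N)
    (hw : Primrec w) (hz : Primrec z) : Primrec fun a => wordEval (N a) (w a) (z a) :=
  Primrec.list_foldl hw hz (h := fun a q => genLetterEval (N a) q.2 q.1)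
    (Primrec₂.mk (by fun_prop))

/-- The action of a power of a word on coded points. -/
def wordPow (N : ℕ) (w : GenWord) (k : ℕ) (z : ℕ × ℕ) : ℕ × ℕ := (wordEval N w)^[k] z

@[fun_prop]
theorem primrec_wordPow {N : α → ℕ} {w : α → GenWord} {k : α → ℕ} {z : α → ℕ × ℕ}
    (hN : Primrec N) (hw : Primrec w) (hk : Primrec k) (hz : Primrec z) :
    Primrec fun a => wordPow (N a) (w a) (k a) (z a) :=
  Primrec.nat_iterate hk hz (h := fun a => wordEval (N a) (w a)) (Primrec₂.mk (by fun_prop))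

end Evaluators

/-! ### Numerical form of the certificates -/

section CodedCertificates

/-- The base-`D` digit of `u` at place `i`. -/
def digitAt (D u i : ℕ) : ℕ := u / D ^ i % D

/-- The height of the image under `a ^ L` of the point at height `L * a.length` on ray `i`. -/
def driftHeight (N : ℕ) (a : GenWord) (L i : ℕ) : ℕ := (wordPow N a L (i, L * a.length)).2

/-- The vector coded by `u` violates `IsAdmissible`. -/
def CodedInadmissible (N : ℕ) (a : GenWord) (L β u : ℕ) : Prop :=
  (∃ i, i < N ∧ digitAt (2 * β + 1) u (wordEval N a (i, a.length)).1 ≠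
    digitAt (2 * β + 1) u i) ∨
  -- Digits exceed entries by `β`, so a vanishing sum becomes equality with the sum of `β` over the
  -- same rays.
  (∃ r, ∑ i ∈ Finset.range N, (if wordPow N a r (i, r * a.length) = (i, r * a.length) then
      digitAt (2 * β + 1) u i else 0) ≠
    ∑ i ∈ Finset.range N, (if wordPow N a r (i, r * a.length) = (i, r * a.length) then
      β else 0)) ∨
  -- Heights at least `L * a.length + β` are written `m + β`; translating by the coded entry gives
  -- `m` plus the digit.
  ∃ i m j m' k, i < N ∧ driftHeight N a L i ≠ L * a.length ∧
    driftHeight N a L j ≠ L * a.length ∧ L * a.length ≤ m ∧ L * a.length ≤ m' ∧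
    wordPow N a k (i, m + β) = (j, m' + β) ∧
    wordPow N a k (i, m + digitAt (2 * β + 1) u i) ≠ (j, m' + digitAt (2 * β + 1) u j)

/-- `DualCertificate` for the vector coded by `u`. -/
def CodedDual (n p : ℕ) (a x : GenWord) (L β u : ℕ) : Prop :=
  ∃ d lam, 0 < d ∧
    ForallBelow n (fun j => (∑ i ∈ Finset.range (n * p), if i / p = j then digitAt d lam i else 0)
      % d = 0) ∧
    ForallBelow ((2 * β + 1) ^ (n * p)) (fun v => CodedInadmissible (n * p) a L β v ∨
      (∑ i ∈ Finset.range (n * p), digitAt d lam i * (2 * digitAt (2 * β + 1) v i)) % d =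
      (∑ i ∈ Finset.range (n * p), digitAt d lam i * (2 * β)) % d) ∧
    (∑ i ∈ Finset.range (n * p), digitAt d lam i *
      (digitAt (2 * β + 1) u i + (wordEval (n * p) x (i, x.length)).2)) % d ≠
    (∑ i ∈ Finset.range (n * p), digitAt d lam i * (β + x.length)) % d

/-- `HasRigidOrbits` on coded points. -/
def CodedRigid (N : ℕ) (a : GenWord) (L : ℕ) : Prop :=
  ForallBelow N (fun i => driftHeight N a L i ≠ L * a.length) ∧
  ForallBelow N fun i => ForallBelow (L * a.length) fun m =>
    ForallBelow N fun i' => ForallBelow (L * a.length) fun m' =>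
      (∃ k, L * a.length ≤ (wordPow N a k (i, m)).2) ∨
      (∃ k, L * a.length ≤ (wordPow N a k (i', m')).2) ∨
      ((∃ k, k % 2 = 1 ∧ wordPow N a k (i, m) = (i, m)) ∧
        ((∃ k, wordPow N a k (i, m) = (i', m')) ∨
          ∃ k, (wordPow N a k (i, m) = (i, m) ∧ wordPow N a k (i', m') ≠ (i', m')) ∨
            (wordPow N a k (i, m) ≠ (i, m) ∧ wordPow N a k (i', m') = (i', m'))))

/-- The list `l` conjugates `a` to `b`. -/
def CodedConj (n p N : ℕ) (a b : GenWord) (l : List Letter) : Prop :=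
  ForallBelow N fun i => ForallBelow (listHeight l + a.length + b.length + 1) fun m =>
    listEval n p l (wordEval N a (i, m)) = wordEval N b (listEval n p l (i, m))

/-- `OddCertificate` for the vector coded by `u`. -/
def CodedOdd (n p : ℕ) (a b x : GenWord) (L β u : ℕ) : Prop :=
  (n < 3 ∨ p % 2 = 0) ∧ CodedRigid (n * p) a L ∧ ∃ l l' : List Letter,
    swapCount n p l % 2 = 1 ∧ CodedConj n p (n * p) a b l ∧
    CodedConj (n * p) 1 (n * p) a a l' ∧
    ForallBelow (n * p) fun i =>
      -- At this common height all three permutations act by their translations; `β` and the doubled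
      -- height on the left cancel the offsets.
      (listEval n p l (i, listHeight l + listHeight l' + x.length)).2 + β +
          2 * (listHeight l + listHeight l' + x.length) =
        (wordEval (n * p) x (i, listHeight l + listHeight l' + x.length)).2 +
          digitAt (2 * β + 1) u i +
          2 * (listEval (n * p) 1 l' (i, listHeight l + listHeight l' + x.length)).2

/-- A certificate that the elements are conjugate in `imageU`. -/
def CodedYes (n p : ℕ) (a b : GenWord) : Prop :=
  ∃ l : List Letter, (swapCount n p l % 2 = 0 ∨ (3 ≤ n ∧ p % 2 = 1)) ∧
    CodedConj n p (n * p) a b l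

/-- A certificate that the elements are not conjugate in `imageU`. -/
def CodedNo (n p : ℕ) (a b x : GenWord) : Prop :=
  ∃ L β, 0 < L ∧ n * p * (n * p) ≤ β ∧
    ForallBelow (n * p) (fun i => (wordPow (n * p) a L (i, L * a.length)).1 = i ∧
      -- Subtraction is truncated, so the two inequalities together bound the absolute value of the
      -- drift.
      2 * (driftHeight (n * p) a L i - L * a.length) ≤ β ∧
      2 * (L * a.length - driftHeight (n * p) a L i) ≤ β) ∧
    ForallBelow ((2 * β + 1) ^ (n * p)) fun u => CodedInadmissible (n * p) a L β u ∨
      CodedDual n p a x L β u ∨ CodedOdd n p a b x L β u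

/-- A certificate that the input is not a valid one. -/
def CodedInvalid (n p : ℕ) (a b x : GenWord) : Prop :=
  n < 2 ∨ p < 1 ∨ ∃ i m, i < n * p ∧ ((wordEval (n * p) x (i, x.length)).1 ≠ i ∨
    wordEval (n * p) x (wordEval (n * p) a (i, m)) ≠
      wordEval (n * p) b (wordEval (n * p) x (i, m)))

variable {α : Type*} [Primcodable α]

@[fun_prop]
theorem primrec_digitAt {D u i : α → ℕ} (hD : Primrec D) (hu : Primrec u) (hi : Primrec i) :
    Primrec fun q => digitAt (D q) (u q) (i q) := by
  unfold digitAt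
  fun_prop

@[fun_prop]
theorem primrec_driftHeight {N : α → ℕ} {a : α → GenWord} {L i : α → ℕ} (hN : Primrec N)
    (ha : Primrec a) (hL : Primrec L) (hi : Primrec i) :
    Primrec fun q => driftHeight (N q) (a q) (L q) (i q) := by
  unfold driftHeight
  fun_prop

@[fun_prop]
theorem isSearchable_codedInadmissible {N : α → ℕ} {a : α → GenWord} {L β u : α → ℕ}
    (hN : Primrec N) (ha : Primrec a) (hL : Primrec L) (hβ : Primrec β) (hu : Primrec u) :
    IsSearchable fun q => CodedInadmissible (N q) (a q) (L q) (β q) (u q) := by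
  unfold CodedInadmissible
  fun_prop

@[fun_prop]
theorem isSearchable_codedDual {n p : α → ℕ} {a x : α → GenWord} {L β u : α → ℕ}
    (hn : Primrec n) (hp : Primrec p) (ha : Primrec a) (hx : Primrec x) (hL : Primrec L)
    (hβ : Primrec β) (hu : Primrec u) :
    IsSearchable fun q => CodedDual (n q) (p q) (a q) (x q) (L q) (β q) (u q) := by
  unfold CodedDual
  fun_prop

@[fun_prop]
theorem isSearchable_codedRigid {N : α → ℕ} {a : α → GenWord} {L : α → ℕ}
    (hN : Primrec N) (ha : Primrec a) (hL : Primrec L) :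
    IsSearchable fun q => CodedRigid (N q) (a q) (L q) := by
  unfold CodedRigid
  fun_prop

@[fun_prop]
theorem isSearchable_codedConj {n p N : α → ℕ} {a b : α → GenWord} {l : α → List Letter}
    (hn : Primrec n) (hp : Primrec p) (hN : Primrec N) (ha : Primrec a) (hb : Primrec b)
    (hl : Primrec l) :
    IsSearchable fun q => CodedConj (n q) (p q) (N q) (a q) (b q) (l q) := by
  unfold CodedConj
  fun_prop

@[fun_prop]
theorem isSearchable_codedOdd {n p : α → ℕ} {a b x : α → GenWord} {L β u : α → ℕ}
    (hn : Primrec n) (hp : Primrec p) (ha : Primrec a) (hb : Primrec b) (hx : Primrec x)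
    (hL : Primrec L) (hβ : Primrec β) (hu : Primrec u) :
    IsSearchable fun q => CodedOdd (n q) (p q) (a q) (b q) (x q) (L q) (β q) (u q) := by
  unfold CodedOdd
  fun_prop

@[fun_prop]
theorem isSearchable_codedYes {n p : α → ℕ} {a b : α → GenWord}
    (hn : Primrec n) (hp : Primrec p) (ha : Primrec a) (hb : Primrec b) :
    IsSearchable fun q => CodedYes (n q) (p q) (a q) (b q) := by
  unfold CodedYes
  fun_prop

@[fun_prop]
theorem isSearchable_codedNo {n p : α → ℕ} {a b x : α → GenWord}
    (hn : Primrec n) (hp : Primrec p) (ha : Primrec a) (hb : Primrec b) (hx : Primrec x) :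
    IsSearchable fun q => CodedNo (n q) (p q) (a q) (b q) (x q) := by
  unfold CodedNo
  fun_prop

@[fun_prop]
theorem isSearchable_codedInvalid {n p : α → ℕ} {a b x : α → GenWord}
    (hn : Primrec n) (hp : Primrec p) (ha : Primrec a) (hb : Primrec b) (hx : Primrec x) :
    IsSearchable fun q => CodedInvalid (n q) (p q) (a q) (b q) (x q) := by
  unfold CodedInvalid
  fun_prop

end CodedCertificates

/-! ### Coding bounded vectors by digits -/

section Digits

theorem exists_digitAt {D : ℕ} (N : ℕ) (f : ℕ → ℕ) (hf : ∀ i < N, f i < D) :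
    ∃ u < D ^ N, ∀ i < N, digitAt D u i = f i := by
  induction N with
  | zero => exact ⟨0, by simp, by simp⟩
  | succ N ih =>
    obtain ⟨u, hu, h⟩ := ih fun i hi => hf i (by omega)
    have hD : 0 < D := (Nat.zero_le _).trans_lt (hf N (by omega))
    refine ⟨u + D ^ N * f N, ?_, fun i hi => ?_⟩
    · have := Nat.mul_le_mul_left (D ^ N) (Nat.succ_le_of_lt (hf N (by omega)))
      rw [Nat.mul_succ, ← pow_succ] at this
      omega
    · unfold digitAt
      rcases Nat.lt_succ_iff_lt_or_eq.1 hi with hi | rfl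
      · obtain ⟨k, rfl⟩ : ∃ k, N = i + (k + 1) := ⟨N - i - 1, by omega⟩
        have e : D ^ (i + (k + 1)) * f (i + (k + 1)) = D ^ i * (D * (D ^ k * f (i + (k + 1)))) := by
          ring
        rw [e, Nat.add_mul_div_left _ _ (by positivity), Nat.add_mul_mod_self_left]
        exact h i hi
      · rw [Nat.add_mul_div_left _ _ (by positivity), Nat.div_eq_of_lt hu, zero_add]
        exact Nat.mod_eq_of_lt (hf i (by omega))

/-- The vector with entries in `[-β, β]` coded by `u`. -/
def codedVector (N β u : ℕ) (i : Fin N) : ℤ := digitAt (2 * β + 1) u i - β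

theorem natAbs_codedVector_le (N β u : ℕ) (i : Fin N) : (codedVector N β u i).natAbs ≤ β := by
  have : digitAt (2 * β + 1) u i < 2 * β + 1 := Nat.mod_lt _ (by omega)
  unfold codedVector
  omega

theorem exists_codedVector {N β : ℕ} (w : Fin N → ℤ) (hw : ∀ i, (w i).natAbs ≤ β) :
    ∃ u < (2 * β + 1) ^ N, codedVector N β u = w := by
  obtain ⟨u, hu, h⟩ := exists_digitAt (D := 2 * β + 1) N
    (fun i => if hi : i < N then (w ⟨i, hi⟩ + β).toNat else 0) (fun i hi => by
      have := hw ⟨i, hi⟩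
      rw [dif_pos hi]
      omega)
  refine ⟨u, hu, funext fun i => ?_⟩
  have := hw i
  rw [codedVector, h i i.2, dif_pos i.2]
  simp only [Fin.eta]
  omega

theorem forallBelow_iff {N : ℕ} {q : ℕ → Prop} : ForallBelow N q ↔ ∀ i : Fin N, q i :=
  ⟨fun h i => h i i.2, fun h i hi => h ⟨i, hi⟩⟩

theorem forallBelow_codedVector_iff {N β : ℕ} {q : ℕ → Prop} {P : (Fin N → ℤ) → Prop}
    (h : ∀ u, q u ↔ P (codedVector N β u)) :
    ForallBelow ((2 * β + 1) ^ N) q ↔ ∀ w, (∀ i, (w i).natAbs ≤ β) → P w := by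
  constructor
  · intro hq w hw
    obtain ⟨u, hu, rfl⟩ := exists_codedVector w hw
    exact (h u).1 (hq u hu)
  · intro hP u _
    exact (h u).2 (hP _ (natAbs_codedVector_le N β u))

/-- Divisibility of a sum with signs is traded for a congruence between sums of natural numbers. -/
theorem natCast_dvd_sum_sub_iff {N d : ℕ} (f g : ℕ → ℕ) :
    (∑ i ∈ Finset.range N, f i) % d = (∑ i ∈ Finset.range N, g i) % d ↔
      (d : ℤ) ∣ ∑ i : Fin N, ((f i : ℤ) - g i) := by
  rw [Finset.sum_range, Finset.sum_range]
  change Nat.ModEq d _ _ ↔ _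
  rw [Nat.ModEq.comm, Nat.modEq_iff_dvd, Finset.sum_sub_distrib]
  push_cast
  rfl

end Digits

/-! ### The numerical conditions mean what they should -/

section Correctness

variable {N : ℕ} (hN : 2 ≤ N) (a b x : GenWord)

theorem represents_wordPow (k : ℕ) : Represents (wordPow N a k) (a.toPerm hN ^ k) :=
  (represents_wordEval hN a).iterate k

/-- The drift vector of the `L`-th power of a word. -/
def drift (L : ℕ) (i : Fin N) : ℤ :=
  (((a.toPerm hN ^ L) (i, L * a.length)).2 : ℤ) - (L * a.length : ℕ)

theorem driftHeight_eq (L : ℕ) (i : Fin N) :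
    (driftHeight N a L i : ℤ) = drift hN a L i + (L * a.length : ℕ) := by
  rw [driftHeight, (represents_wordPow hN a L).apply, drift]
  ring

theorem driftHeight_ne_iff (L : ℕ) (i : Fin N) :
    driftHeight N a L i ≠ L * a.length ↔ drift hN a L i ≠ 0 := by
  have := driftHeight_eq hN a L i
  omega

theorem isAdmissible_iff {a : Perm (RaySpace N)} {M H B : ℕ} {s w : Fin N → ℤ} :
    IsAdmissible a M H B s w ↔ (∀ i, w (a (i, M)).1 = w i) ∧
      (∀ r, open Classical in ∑ i with FixesRay a r i, w i = 0) ∧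
      ∀ z : RaySpace N, ∀ k : ℕ, s z.1 ≠ 0 → H + B ≤ z.2 → s ((a ^ k) z).1 ≠ 0 →
        H + B ≤ ((a ^ k) z).2 → (a ^ k) (shiftPoint w z) = shiftPoint w ((a ^ k) z) :=
  ⟨fun h => ⟨h.1, h.2, h.3⟩, fun h => ⟨h.1, h.2.1, h.2.2⟩⟩

theorem codedInadmissible_iff (L β u : ℕ) :
    CodedInadmissible N a L β u ↔
      ¬ IsAdmissible (a.toPerm hN) a.length (L * a.length) β (drift hN a L)
        (codedVector N β u) := by
  rw [isAdmissible_iff, not_and_or, not_and_or, CodedInadmissible]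
  refine or_congr ?_ (or_congr ?_ ?_)
  · rw [not_forall]
    constructor
    · rintro ⟨i, hi, h⟩
      refine ⟨⟨i, hi⟩, fun h' => h ?_⟩
      rw [(represents_wordEval hN a).apply ⟨i, hi⟩]
      simp only [codedVector] at h'
      dsimp only
      omega
    · rintro ⟨i, h⟩
      refine ⟨i, i.2, fun h' => h ?_⟩
      rw [(represents_wordEval hN a).apply i] at h'
      simp only [codedVector]
      dsimp only at h'
      omega
  · rw [not_forall]
    refine exists_congr fun r => not_congr ?_
    have hfix : ∀ i : Fin N, wordPow N a r (i, r * a.length) = (↑i, r * a.length) ↔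
        FixesRay (a.toPerm hN) r i := fun i => by
      rw [(a.tame_toPerm hN).fixesRay_iff le_rfl]
      exact (represents_wordPow hN a r).apply_eq_iff (i, _) (i, _)
    classical
    rw [Finset.sum_range, Finset.sum_range, Finset.sum_filter, ← Nat.cast_inj (R := ℤ),
      ← sub_eq_zero]
    push_cast
    rw [← Finset.sum_sub_distrib]
    simp only [hfix]
    refine Eq.congr (Finset.sum_congr rfl fun i _ => ?_) rfl
    split_ifs <;> simp [codedVector]
  · have hsh : ∀ (i : Fin N) (m : ℕ), pointCode (shiftPoint (codedVector N β u) (i, m + β)) =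
        ((i : ℕ), m + digitAt (2 * β + 1) u i) := fun i m => by
      simp only [pointCode, shiftPoint, codedVector, Prod.mk.injEq, true_and]
      push_cast
      omega
    push Not
    constructor
    · rintro ⟨i, m, j, m', k, hi, h1, h2, h3, h4, h5, h6⟩
      rw [(represents_wordPow hN a k).apply ⟨i, hi⟩] at h5
      obtain ⟨rfl, h7⟩ := Prod.mk.inj h5
      rw [driftHeight_ne_iff hN a L ⟨i, hi⟩] at h1
      rw [driftHeight_ne_iff hN] at h2
      refine ⟨(⟨i, hi⟩, m + β), k, h1, by dsimp only; omega, h2, by omega, fun h => h6 ?_⟩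
      rw [← hsh ⟨i, hi⟩ m, represents_wordPow hN a k, h, ← hsh, ← h7]
    · rintro ⟨⟨i, m⟩, k, h1, h2, h3, h4, h5⟩
      dsimp only at h1 h2
      obtain ⟨m, rfl⟩ : ∃ m₁, m = m₁ + β := ⟨m - β, by omega⟩
      obtain ⟨m', hm'⟩ : ∃ m₁, ((a.toPerm hN ^ k) (i, m + β)).2 = m₁ + β :=
        ⟨_ - β, (Nat.sub_add_cancel (by omega)).symm⟩
      refine ⟨i, m, ((a.toPerm hN ^ k) (i, m + β)).1, m', k, i.2,
        (driftHeight_ne_iff hN a L i).2 h1, (driftHeight_ne_iff hN a L _).2 h3, by omega, by omega,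
        ?_, fun h => h5 (pointCode_injective ?_)⟩
      · rw [(represents_wordPow hN a k).apply, hm']
      · rw [← hsh i m, represents_wordPow hN a k, ← hsh, ← hm'] at h
        exact h

theorem codedRigid_iff (L : ℕ) :
    CodedRigid N a L ↔ HasRigidOrbits (a.toPerm hN) (L * a.length) (drift hN a L) := by
  have hr := represents_wordPow hN a
  have h1 : ∀ k (i : Fin N) m, (wordPow N a k (i, m)).2 = ((a.toPerm hN ^ k) (i, m)).2 :=
    fun k i m => by rw [(hr k).apply]
  have h2 : ∀ k (i i' : Fin N) m m', wordPow N a k (i, m) = (↑i', m') ↔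
      (a.toPerm hN ^ k) (i, m) = (i', m') := fun k i i' m m' => (hr k).apply_eq_iff (i, m) (i', m')
  unfold CodedRigid HasRigidOrbits
  simp only [forallBelow_iff (N := N), driftHeight_ne_iff hN, ForallBelow.eq_def (L * a.length),
    h1, h2, ne_eq, Prod.forall, Nat.odd_iff]
  refine and_congr_right fun _ => ⟨fun h i m i' m' hm hm' => ?_, fun h i m hm i' m' hm' => ?_⟩
  · have := h i m hm i' m' hm'
    refine this.imp_right (Or.imp_right (And.imp_right (Or.imp_right ?_)))
    rintro ⟨k, hk⟩
    exact ⟨k, by tauto⟩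
  · have := h i m i' m' hm hm'
    refine this.imp_right (Or.imp_right (And.imp_right (Or.imp_right ?_)))
    rintro ⟨k, hk⟩
    exact ⟨k, by tauto⟩

/-- Both products are tame from the sum of the heights on, so the points up to that height decide
(`Tame.ext`). -/
theorem codedConj_iff {n p : ℕ} {l : List Letter} {y : Perm (RaySpace N)}
    (hy : Represents (listEval n p l) y) (ht : Tame (listHeight l) y) :
    CodedConj n p N a b l ↔ y * a.toPerm hN = b.toPerm hN * y := by
  have h1 := hy.mul (represents_wordEval hN a)
  have h2 := (represents_wordEval hN b).mul hy
  unfold CodedConj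
  rw [forallBelow_iff]
  constructor
  · intro h
    refine Tame.ext ((ht.mul (a.tame_toPerm hN)).mono (M' := listHeight l + a.length + b.length)
      (by omega)) (((b.tame_toPerm hN).mul ht).mono (by omega)) fun i m hm => ?_
    refine pointCode_injective ?_
    rw [← h1, ← h2]
    exact h i m (by omega)
  · intro h i m _
    rw [← h] at h2
    exact (h1 (i, m)).trans (h2 (i, m)).symm

end Correctness

/-! ### The two searches and the decision procedure -/

section Decision

variable {n p : ℕ} (hn : 2 ≤ n) (hp : 1 ≤ p) (a b x : GenWord)

/-- The translation vector of a word in the Houghton group. -/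
def wordTranslation {N : ℕ} (hN : 2 ≤ N) (x : GenWord) (i : Fin N) : ℤ :=
  ((x.toPerm hN (i, x.length)).2 : ℤ) - x.length

theorem codedDual_iff (L β u : ℕ) :
    CodedDual n p a x L β u ↔
      DualCertificate (a.toPerm (two_le_mul_of hn hp)) a.length (L * a.length) β
        (drift (two_le_mul_of hn hp) a L) (wordTranslation (two_le_mul_of hn hp) x)
        (codedVector (n * p) β u) := by
  -- The conditions are compared for a fixed form `f` with digit code `lam`; forms with coefficients
  -- below `d` and codes then correspond.
  have key : ∀ d lam : ℕ, ∀ f : Fin (n * p) → ℕ, (∀ i : Fin (n * p), digitAt d lam i = f i) →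
      ((ForallBelow n (fun j => (∑ i ∈ Finset.range (n * p),
          if i / p = j then digitAt d lam i else 0) % d = 0) ∧
        ForallBelow ((2 * β + 1) ^ (n * p)) (fun v => CodedInadmissible (n * p) a L β v ∨
          (∑ i ∈ Finset.range (n * p), digitAt d lam i * (2 * digitAt (2 * β + 1) v i)) % d =
          (∑ i ∈ Finset.range (n * p), digitAt d lam i * (2 * β)) % d) ∧
        (∑ i ∈ Finset.range (n * p), digitAt d lam i *
          (digitAt (2 * β + 1) u i + (wordEval (n * p) x (i, x.length)).2)) % d ≠
        (∑ i ∈ Finset.range (n * p), digitAt d lam i * (β + x.length)) % d) ↔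
      ((∀ j : Fin n, (d : ℤ) ∣ ∑ i : Fin (n * p), if rayBlock i = j then (f i : ℤ) else 0) ∧
        (∀ w : Fin (n * p) → ℤ, (∀ i, (w i).natAbs ≤ β) →
          ¬ IsAdmissible (a.toPerm (two_le_mul_of hn hp)) a.length (L * a.length) β
            (drift (two_le_mul_of hn hp) a L) w ∨ (d : ℤ) ∣ ∑ i, f i * (2 * w i)) ∧
        ¬ (d : ℤ) ∣ ∑ i, f i *
          (codedVector (n * p) β u i + wordTranslation (two_le_mul_of hn hp) x i))) := by
    intro d lam f hf
    refine and_congr ?_ (and_congr ?_ (not_congr ?_))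
    · rw [forallBelow_iff]
      refine forall_congr' fun j => ?_
      rw [← Nat.dvd_iff_mod_eq_zero, Finset.sum_range, ← Int.natCast_dvd_natCast]
      push_cast
      simp only [hf]
      have hb : ∀ i : Fin (n * p), (i : ℕ) / p = j ↔ rayBlock i = j := fun i => by
        rw [Fin.ext_iff]
        rfl
      simp only [hb]
    · refine forallBelow_codedVector_iff fun v => or_congr (codedInadmissible_iff _ a L β v) ?_
      rw [natCast_dvd_sum_sub_iff (fun i => digitAt d lam i * (2 * digitAt (2 * β + 1) v i))]
      refine Eq.to_iff (congrArg _ (Finset.sum_congr rfl fun i _ => ?_))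
      rw [hf, codedVector]
      push_cast
      ring
    · rw [natCast_dvd_sum_sub_iff (fun i => digitAt d lam i *
          (digitAt (2 * β + 1) u i + (wordEval (n * p) x (i, x.length)).2))]
      refine Eq.to_iff (congrArg _ (Finset.sum_congr rfl fun i _ => ?_))
      rw [hf, codedVector, wordTranslation,
        (represents_wordEval (two_le_mul_of hn hp) x).apply]
      push_cast
      ring
  constructor
  · rintro ⟨d, lam, hd, h⟩
    exact ⟨d, hd, fun i => digitAt d lam i, fun i => Nat.mod_lt _ hd,
      (key d lam _ fun _ => rfl).1 h⟩
  · rintro ⟨d, hd, f, hf, h⟩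
    obtain ⟨lam, -, hlam⟩ := exists_digitAt (D := d) (n * p)
      (fun i => if hi : i < n * p then f ⟨i, hi⟩ else 0) (fun i hi => by
        rw [dif_pos hi]
        exact hf _)
    exact ⟨d, lam, hd, (key d lam f fun i => by rw [hlam i i.2, dif_pos i.2]).2 h⟩

theorem natCast_zmod_two_eq_one_iff (k : ℕ) : (k : ZMod 2) = 1 ↔ k % 2 = 1 := by
  rw [ZMod.natCast_eq_one_iff_odd, Nat.odd_iff]

theorem natCast_zmod_two_eq_zero_iff (k : ℕ) : (k : ZMod 2) = 0 ↔ k % 2 = 0 := by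
  rw [ZMod.natCast_eq_zero_iff_even, Nat.even_iff]

theorem not_three_le_and_odd_iff : ¬ (3 ≤ n ∧ Odd p) ↔ n < 3 ∨ p % 2 = 0 := by
  rw [Nat.odd_iff]
  omega

theorem codedOdd_iff (hx : ∃ t, TranslatesBy (x.toPerm (two_le_mul_of hn hp)) t) (L β u : ℕ) :
    CodedOdd n p a b x L β u ↔
      OddCertificate hn hp (a.toPerm (two_le_mul_of hn hp)) (b.toPerm (two_le_mul_of hn hp))
        (L * a.length) (drift (two_le_mul_of hn hp) a L)
        (wordTranslation (two_le_mul_of hn hp) x) (codedVector (n * p) β u) := by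
  set hN := two_le_mul_of hn hp
  obtain ⟨tx, htx⟩ := hx
  have hX := (represents_wordEval hN x).apply
  have htx' : ∀ i, wordTranslation hN x i = tx i := fun i => by
    have := ((x.tame_toPerm hN).translatesBy_apply htx i le_rfl).2
    rw [wordTranslation]
    omega
  have key : ∀ l l' : List Letter, ∀ y c : Perm (RaySpace (n * p)), ∀ ty tc,
      Represents (listEval n p l) y → Tame (listHeight l) y → TranslatesBy y ty →
      Represents (listEval (n * p) 1 l') c → Tame (listHeight l') c → TranslatesBy c tc →
      ((ForallBelow (n * p) fun i =>
        (listEval n p l (i, listHeight l + listHeight l' + x.length)).2 + β +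
          2 * (listHeight l + listHeight l' + x.length) =
        (wordEval (n * p) x (i, listHeight l + listHeight l' + x.length)).2 +
          digitAt (2 * β + 1) u i +
          2 * (listEval (n * p) 1 l' (i, listHeight l + listHeight l' + x.length)).2) ↔
      ∀ i, ty i = wordTranslation hN x i + codedVector (n * p) β u i + 2 * tc i) := by
    intro l l' y c ty tc h1 h2 h3 h4 h5 h6
    rw [forallBelow_iff]
    refine forall_congr' fun i => ?_
    rw [h1.apply, h4.apply, hX, htx', codedVector]
    set K := listHeight l + listHeight l' + x.length with hK
    have e1 := (h2.translatesBy_apply h3 i (m := K) (by omega)).2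
    have e2 := (h5.translatesBy_apply h6 i (m := K) (by omega)).2
    have e3 := ((x.tame_toPerm hN).translatesBy_apply htx i (m := K) (by omega)).2
    dsimp only
    omega
  unfold CodedOdd OddCertificate
  rw [not_three_le_and_odd_iff, codedRigid_iff hN]
  refine and_congr_right fun _ => and_congr_right fun _ => ?_
  constructor
  · rintro ⟨l, l', h1, h2, h3, h4⟩
    obtain ⟨y, hy1, hy2, hy3⟩ := exists_represents_listEval (isShiftCoding_blockShifts hn hp) l
    obtain ⟨c, hc1, hc2, hc3⟩ := exists_represents_listEval (isShiftCoding_shiftPowers hN) l'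
    obtain ⟨ty, hty⟩ := hy1.exists_block_translatesBy
    obtain ⟨tc, htc⟩ := hc1.exists_translatesBy
    rw [(natCast_zmod_two_eq_one_iff _).2 h1] at hy1
    exact ⟨y, c, hy1, (codedConj_iff hN a b hy2 hy3).1 h2, (codedConj_iff hN a a hc2 hc3).1 h3, _,
      _, hty, htc, (key l l' y c _ _ hy2 hy3 hty hc2 hc3 htc).1 h4⟩
  · rintro ⟨y, c, h1, h2, h3, ty, tc, h4, h5, h6⟩
    obtain ⟨l, hl1, hl2⟩ := h1.exists_listEval (isShiftCoding_blockShifts hn hp)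
    -- With `p = 1` every translation vector is allowed, so `c` has a letter list; its parity is
    -- irrelevant.
    obtain ⟨e, he⟩ := exists_genParity_of_translatesBy hN le_rfl (k := tc) (h := c)
      (by rwa [one_smul])
    obtain ⟨l', -, hl2'⟩ := he.exists_listEval (isShiftCoding_shiftPowers hN)
    obtain ⟨y', -, hy2, hy3⟩ := exists_represents_listEval (isShiftCoding_blockShifts hn hp) l
    obtain ⟨c', -, hc2, hc3⟩ := exists_represents_listEval (isShiftCoding_shiftPowers hN) l'
    obtain rfl := hl2.unique hy2
    obtain rfl := hl2'.unique hc2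
    exact ⟨l, l', (natCast_zmod_two_eq_one_iff _).1 hl1, (codedConj_iff hN a b hy2 hy3).2 h2,
      (codedConj_iff hN a a hc2 hc3).2 h3, (key l l' y c _ _ hy2 hy3 h4 hc2 hc3 h5).2 h6⟩

theorem codedYes_iff :
    CodedYes n p a b ↔ ∃ y ∈ imageU hn hp,
      y * a.toPerm (two_le_mul_of hn hp) = b.toPerm (two_le_mul_of hn hp) * y := by
  have hG := isShiftCoding_blockShifts hn hp
  constructor
  · rintro ⟨l, h1, h2⟩
    obtain ⟨y, hy1, hy2, hy3⟩ := exists_represents_listEval hG l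
    refine ⟨y, (mem_imageU_iff hn hp).2 ⟨_, hy1, ?_⟩, (codedConj_iff _ a b hy2 hy3).1 h2⟩
    rwa [natCast_zmod_two_eq_zero_iff, Nat.odd_iff]
  · rintro ⟨y, hy, h⟩
    obtain ⟨e, hye, he⟩ := (mem_imageU_iff hn hp).1 hy
    obtain ⟨l, rfl, hl⟩ := hye.exists_listEval hG
    obtain ⟨y', -, hy2, hy3⟩ := exists_represents_listEval hG l
    obtain rfl := hl.unique hy2
    rw [natCast_zmod_two_eq_zero_iff, Nat.odd_iff] at he
    exact ⟨l, he, (codedConj_iff _ a b hy2 hy3).2 h⟩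

/-- Any `L` and `β` passing the numerical checks give a correct criterion, so it is enough to know
that some pair passes. -/
theorem codedNo_iff (hx : x.toPerm (two_le_mul_of hn hp) ∈ houghton (n * p))
    (hconj : x.toPerm (two_le_mul_of hn hp) * a.toPerm (two_le_mul_of hn hp) =
      b.toPerm (two_le_mul_of hn hp) * x.toPerm (two_le_mul_of hn hp)) :
    CodedNo n p a b x ↔ ¬ ∃ y ∈ imageU hn hp,
      y * a.toPerm (two_le_mul_of hn hp) = b.toPerm (two_le_mul_of hn hp) * y := by
  set hN := two_le_mul_of hn hp
  obtain ⟨tx, htx⟩ := mem_houghton_iff.1 hx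
  have htx' : TranslatesBy (x.toPerm hN) (wordTranslation hN x) := by
    have : wordTranslation hN x = tx := funext fun i => by
      have := ((x.tame_toPerm hN).translatesBy_apply htx i le_rfl).2
      rw [wordTranslation]
      omega
    rwa [this]
  have key : ∀ L β : ℕ, 0 < L → n * p * (n * p) ≤ β →
      (∀ i : Fin (n * p), ((a.toPerm hN ^ L) (i, L * a.length)).1 = i) →
      (∀ i, 2 * (drift hN a L i).natAbs ≤ β) →
      ((ForallBelow ((2 * β + 1) ^ (n * p)) fun u => CodedInadmissible (n * p) a L β u ∨
        CodedDual n p a x L β u ∨ CodedOdd n p a b x L β u) ↔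
      ¬ ∃ y ∈ imageU hn hp, y * a.toPerm hN = b.toPerm hN * y) := by
    intro L β hL hβ h1 h2
    rw [← forall_certificate_iff (a.tame_toPerm hN)
      (((a.tame_toPerm hN).pow L).translatesFrom h1) hL hβ h2 hconj htx']
    exact forallBelow_codedVector_iff fun u => or_congr (codedInadmissible_iff hN a L β u)
      (or_congr (codedDual_iff hn hp a x L β u) (codedOdd_iff hn hp a b x ⟨tx, htx⟩ L β u))
  constructor
  · rintro ⟨L, β, hL, hβ, h1, h2⟩
    rw [forallBelow_iff] at h1
    refine (key L β hL hβ (fun i => ?_) (fun i => ?_)).1 h2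
    · have := (h1 i).1
      rw [(represents_wordPow hN a L).apply] at this
      exact Fin.ext this
    · have h3 := (h1 i).2
      have h4 := driftHeight_eq hN a L i
      omega
  · intro h
    obtain ⟨L, hL, h1⟩ := (a.tame_toPerm hN).exists_pow_translatesFrom
    have h2 : ∀ i, 2 * (drift hN a L i).natAbs ≤
        n * p * (n * p) + 2 * ∑ i, (drift hN a L i).natAbs := fun i => by
      have := natAbs_le_sum (drift hN a L) i
      omega
    refine ⟨L, _, hL, Nat.le_add_right _ _, ?_, (key L _ hL (Nat.le_add_right _ _) h1 h2).2 h⟩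
    rw [forallBelow_iff]
    intro i
    have h4 := driftHeight_eq hN a L i
    have h5 := h2 i
    refine ⟨?_, by omega, by omega⟩
    rw [(represents_wordPow hN a L).apply, h1]

/-- Invalid input is recognized by a wrong ray at the rigid height of `x` or by a point where the
conjugation relation fails. -/
theorem codedInvalid_iff :
    CodedInvalid n p a b x ↔ ¬ (x.toPerm (two_le_mul_of hn hp) ∈ houghton (n * p) ∧
      x.toPerm (two_le_mul_of hn hp) * a.toPerm (two_le_mul_of hn hp) =
        b.toPerm (two_le_mul_of hn hp) * x.toPerm (two_le_mul_of hn hp)) := by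
  set hN := two_le_mul_of hn hp
  have h1 := represents_wordEval hN x
  have h2 := h1.mul (represents_wordEval hN a)
  have h3 := (represents_wordEval hN b).mul h1
  constructor
  · rintro h ⟨hx, hc⟩
    rcases h with h | h | ⟨i, m, hi, h⟩
    · omega
    · omega
    · obtain ⟨t, ht⟩ := mem_houghton_iff.1 hx
      rcases h with h | h
      · rw [h1.apply ⟨i, hi⟩] at h
        exact h (congrArg Fin.val ((x.tame_toPerm hN).translatesBy_apply ht ⟨i, hi⟩ le_rfl).1)
      · rw [← hc] at h3
        exact h ((h2 (⟨i, hi⟩, m)).trans (h3 (⟨i, hi⟩, m)).symm)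
  · intro h
    by_contra hinv
    simp only [CodedInvalid, not_or, not_exists, not_and, not_not] at hinv
    obtain ⟨-, -, h4⟩ := hinv
    refine h ⟨mem_houghton_iff.2 ⟨_, ((x.tame_toPerm hN).translatesFrom fun i => ?_).translatesBy⟩,
      Equiv.ext fun z => pointCode_injective ?_⟩
    · have := (h4 i 0 i.2).1
      rw [h1.apply] at this
      exact Fin.ext this
    · rw [← h2, ← h3]
      exact (h4 z.1 z.2 z.1.2).2

theorem conjugatesTo_iff {α : Type*} {x a b : Perm α} : ConjugatesTo x a b ↔ x * a = b * x := by
  have : (x.symm.trans a).trans x = x * a * x⁻¹ := rfl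
  rw [ConjugatesTo, this, mul_inv_eq_iff_eq_mul]

/-- If two searchable predicates cover the domain, a computable function finds for each point one
of them that holds there. -/
theorem exists_computable_of_isSearchable {α : Type*} [Primcodable α] {q r : α → Prop}
    (hq : IsSearchable q) (hr : IsSearchable r) (h : ∀ a, q a ∨ r a) :
    ∃ f : α → Bool, Computable f ∧ ∀ a, (f a = true → q a) ∧ (f a = false → r a) := by
  obtain ⟨Q, hQ, hq⟩ := hq
  obtain ⟨R, hR, hr⟩ := hr
  classical
  have hQ' : Primrec fun z : α × ℕ => decide (Q z) := hQ.decide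
  have hex : ∀ a, ∃ k, Q (a, k) ∨ R (a, k) := fun a => by
    rcases h a with h | h
    · obtain ⟨k, hk⟩ := (hq a).1 h
      exact ⟨k, .inl hk⟩
    · obtain ⟨k, hk⟩ := (hr a).1 h
      exact ⟨k, .inr hk⟩
  have hfind : Computable fun a => Nat.find (hex a) := by
    have hp : Partrec fun a => Nat.rfind fun k => (Part.some (decide (Q (a, k) ∨ R (a, k)))) :=
      Partrec.rfind (Primrec.to_comp ((hQ.or hR).decide)).partrec.to₂
    refine hp.of_eq_tot fun a => ?_
    exact Nat.mem_rfind.2 ⟨by simpa using Nat.find_spec (hex a),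
      fun {m} hm => by simpa using Nat.find_min (hex a) hm⟩
  refine ⟨fun a => decide (Q (a, Nat.find (hex a))),
    hQ'.to_comp.comp (Computable.id.pair hfind), fun a => ⟨fun hd => ?_, fun hd => ?_⟩⟩
  · exact (hq a).2 ⟨_, of_decide_eq_true hd⟩
  · exact (hr a).2 ⟨_, (Nat.find_spec (hex a)).resolve_left (of_decide_eq_false hd)⟩

end Decision

/-- Adding invalid inputs to the negative search makes the two searches cover all inputs, so the
procedure is total; on valid input that alternative is void. -/
theorem mainTheorem8 :
    ∃ decideConj : ℕ × ℕ × GenWord × GenWord × GenWord → Bool,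
      Computable decideConj ∧
      ∀ (n p : ℕ) (hn : 2 ≤ n) (hp : 1 ≤ p) (a b x : GenWord),
        x.toPerm (two_le_mul_of hn hp) ∈ houghton (n * p) →
        ConjugatesTo (x.toPerm (two_le_mul_of hn hp)) (a.toPerm (two_le_mul_of hn hp))
          (b.toPerm (two_le_mul_of hn hp)) →
        (decideConj (n, p, a, b, x) = true ↔
          ∃ y ∈ imageU hn hp, ConjugatesTo y (a.toPerm (two_le_mul_of hn hp))
            (b.toPerm (two_le_mul_of hn hp))) := by
  obtain ⟨f, hf, h⟩ := exists_computable_of_isSearchable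
    (q := fun z : ℕ × ℕ × GenWord × GenWord × GenWord => CodedYes z.1 z.2.1 z.2.2.1 z.2.2.2.1)
    (r := fun z => CodedNo z.1 z.2.1 z.2.2.1 z.2.2.2.1 z.2.2.2.2 ∨
      CodedInvalid z.1 z.2.1 z.2.2.1 z.2.2.2.1 z.2.2.2.2) (by fun_prop) (by fun_prop) (by
      rintro ⟨n, p, a, b, x⟩
      by_cases hn : 2 ≤ n
      · by_cases hp : 1 ≤ p
        · have h1 := codedYes_iff hn hp a b
          have h2 := codedNo_iff hn hp a b x
          have h3 := codedInvalid_iff hn hp a b x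
          dsimp only
          tauto
        · exact .inr (.inr (.inr (.inl (by simpa using hp))))
      · exact .inr (.inr (.inl (by simpa using hn))))
  refine ⟨f, hf, fun n p hn hp a b x hx hconj => ?_⟩
  rw [conjugatesTo_iff] at hconj
  simp only [conjugatesTo_iff]
  rw [← codedYes_iff hn hp a b]
  refine ⟨(h (n, p, a, b, x)).1, fun hy => ?_⟩
  by_contra hf'
  rcases (h (n, p, a, b, x)).2 (by simpa using hf') with h' | h'
  · exact (codedNo_iff hn hp a b x hx hconj).1 h' ((codedYes_iff hn hp a b).1 hy)
  · exact (codedInvalid_iff hn hp a b x).1 h' ⟨hx, hconj⟩
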